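/- **Theorem 1.1.** *Setting.* Graphs are finite, simple and undirected. In Vertex Cover, given an $n$-vertex graph $G$ and an integer $k\ge 0$, one asks whether at most $k$ vertices of $G$ meet all edges of $G$. In Split Vertex Deletion, given an $n$-vertex graph $G$ and an integer $k\ge 0$, one asks whether at most $k$ vertices can be deleted from $G$ so that the remaining induced subgraph is a split graph, i.e. its vertex set can be partitioned into two (possibly empty) parts, one inducing a clique and the other an independent set. Algorithms are deterministic multi-tape Turing machines (in the form of machines with a fixed finite number of stacks over finite alphabets); an instance $(G,k)$ with vertex set $\{0,\dots,n-1\}$ is given as $k$ in binary together with the adjacency matrix of $G$, written row by row with separators. Time is the number of steps until the machine halts with its yes/no answer, and space is the maximum, over the run, of the number of cells in use (including those of the input). *Statement.* There is an absolute constant $c\in\mathbb N$ such that the following holds for all functions $f,g:\mathbb N\times\mathbb N\to\mathbb R$. If there is an algorithm that solves Vertex Cover parameterized by the solution size $k$ on $n$-vertex graphs in time at most $f(k,n)$ and space at most $g(k,n)$, for all $k,n\ge 0$, then there are a constant $C$ and an algorithm that solves Split Vertex Deletion on $n$-vertex graphs, for all $k,n\ge 0$, in time at most $$C\cdot\bigl(f(k,n)\,k^{c\log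 k}+n^{c}\bigr)$$ and space at most $$C\cdot\bigl(g(k,n)+n^{c}\bigr).$$ That is, Split Vertex Deletion is solved in $\mathcal O(f(k,n)\,k^{\mathcal O(\log k)}+n^{\mathcal O(1)})$ time and $\mathcal O(g(k,n)+n^{\mathcal O(1)})$ space. (For $k=0$ the factor $k^{c\log k}$ is read as $1$.) -/

import Mathlib

namespace SplitVD

/-! ### The two graph problems -/

/-- A split graph: the vertex set is partitioned into two (possibly empty) parts, one inducing a
clique and the other an independent set. -/
def IsSplitGraph {V : Type*} (H : SimpleGraph V) : Prop :=
  ∃ C I : Set V, C ∪ I = Set.univ ∧ Disjoint C I ∧ H.IsClique C ∧ H.IsIndepSet I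

/-- A parameterized decision problem on graphs with vertex set `{0, …, n - 1}`: an instance is a
graph together with a parameter `k`. -/
abbrev GraphProblem : Type :=
  (n : ℕ) → SimpleGraph (Fin n) → ℕ → Prop

/-- Vertex Cover: is there a set of at most `k` vertices that meets every edge? -/
def VertexCover : GraphProblem := fun n G k =>
  ∃ S : Finset (Fin n), S.card ≤ k ∧ G.IsVertexCover (S : Set (Fin n))

/-- Split Vertex Deletion: can one delete at most `k` vertices so that the subgraph induced by the
remaining ones is a split graph? -/
def SplitVertexDeletion : GraphProblem := fun n G k =>
  ∃ S : Finset (Fin n), S.card ≤ k ∧ IsSplitGraph (G.induce ((S : Set (Fin n))ᶜ))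

/-! ### Encoding of instances

Words over the three-letter alphabet `Option Bool`, with `none` as a separator. -/

open Classical in
/-- The instance `(G, k)` as a word: `k` in binary (least significant bit first), a separator, and
then the rows of the adjacency matrix of `G`, each followed by a separator. -/
noncomputable def encode {n : ℕ} (G : SimpleGraph (Fin n)) (k : ℕ) : List (Option Bool) :=
  k.bits.map some ++ none ::
    (List.finRange n).flatMap fun i =>
      (List.finRange n).map (fun j => some (decide (G.Adj i j))) ++ [none]

/-! ### Machines, time and space

Machines are Mathlib's Turing machines `Turing.FinTM2` with finitely many work stacks (two stacks
are one tape). Mathlib asks only the input alphabet to be finite; here all alphabets are. -/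

/-- A deterministic machine that reads words over `Option Bool` and answers with a Boolean. -/
structure Machine extends Turing.TM2ComputableAux (Option Bool) Bool where
  finite_alphabet : ∀ s, Finite (tm.Γ s)

/-- The initial configuration: the word `w` on the input stack (first letter on top), all other
stacks empty. -/
def Machine.init (M : Machine) (w : List (Option Bool)) : M.tm.Cfg :=
  Turing.initList M.tm (w.map M.inputAlphabet.symm)

/-- The configuration after `t` steps on input `w` (`none` if the machine halted before). -/
def Machine.run (M : Machine) (w : List (Option Bool)) (t : ℕ) : Option M.tm.Cfg :=
  (fun o => o.bind M.tm.step)^[t] (some (M.init w))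

/-- The number of cells that a configuration occupies: the total length of all stacks, the input
stack included. -/
def Machine.size (M : Machine) (c : M.tm.Cfg) : ℕ :=
  letI := M.tm.kFin
  ∑ s : M.tm.K, (Turing.TM2.Cfg.stk c s).length

/-- On input `w`, the machine halts after at most `T` steps with `b` on top of the output stack,
and no configuration of the run occupies more than `S` cells. -/
def Machine.Answers (M : Machine) (w : List (Option Bool)) (b : Bool) (T S : ℝ) : Prop :=
  (∃ (t : ℕ) (c : M.tm.Cfg), (t : ℝ) ≤ T ∧ M.run w t = some c ∧ Turing.TM2.Cfg.l c = none ∧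
      (Turing.TM2.Cfg.stk c M.tm.k₁).head? = some (M.outputAlphabet.symm b)) ∧
    ∀ (t : ℕ) (c : M.tm.Cfg), M.run w t = some c → (M.size c : ℝ) ≤ S

/-- The problem `P` with parameter `k` on `n`-vertex graphs can be solved in time `f k n` and
space `g k n`: one machine decides all instances within these bounds. -/
def SolvableIn (P : GraphProblem) (f g : ℕ → ℕ → ℝ) : Prop :=
  ∃ M : Machine, ∀ (n : ℕ) (G : SimpleGraph (Fin n)) (k : ℕ),
    ∃ b : Bool, (b = true ↔ P n G k) ∧ M.Answers (encode G k) b (f k n) (g k n)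

end SplitVD

namespace SplitVD

open Function

/-! ### A structured language for stack machines -/

/-! Split Vertex Deletion reduces to `2 ^ O(log² k)` Vertex Cover instances on the same vertex set
and with the same `k`. They are generated and solved one after the other, so that only one of them
is in memory at a time.

Suppose that a set `K` is fixed in advance as the clique side. Then the deleted vertices must form a
vertex cover of the graph `inst` that joins the non-adjacent pairs inside `K` and the adjacent pairs
outside `K`. For every `K`, a vertex cover of this graph leaves a split graph
(`svd_of_vertexCover`). Conversely, a solution is such a cover if `K` contains its clique and avoids
its independent set (`vertexCover_of_sol`). So a small family of sets `K` is needed, one of which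
separates the two sides of some solution.

The first step confines the uncertainty to few vertices. Take a maximal packing of disjoint copies
of `2K₂`, `C₄` and `C₅`. A solution deletes a vertex of each copy, so the packing has a vertex set
`X` of size at most `5k` if a solution exists. The rest has none of these subgraphs and is split
(`exists_split_of_no_bad`); degrees reveal a partition (`exists_threshold`). A solution need not
respect this partition. But after moving every vertex that can change sides without conflict, at
most one vertex of each part is misplaced, and it lies in a set of `O(|X|³)` candidates
(`Sol.exists_extended`).

The second step guesses the sides on the remaining `k ^ O(1)` vertices by the classical protocol for
clique versus independent set (`round_list`). Call a vertex a clique vertex if it is adjacent to a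
majority of the undecided vertices. If this misjudges an undecided vertex, naming that vertex and
its true side decides at least half of the undecided vertices. After `O(log k)` rounds of `O(log k)`
bits each, the majority rule is right. The bits are read from a tape, and all tapes of length
`tapeLen k` are tried (`svd_iff`).

The rest is machine work. A small command language over vertex sets and the adjacency matrix
compiles to polynomial-time stack programs (`Cmd.go_comp`). A given Vertex Cover machine is
simulated with constant overhead per step and additive constant overhead in space
(`Machine.simLoop_exec`), and a binary counter drives the enumeration (`Exec.search`). The total
time is a constant times `2 ^ tapeLen k * (U n + f)` with a polynomial `U`. Writing `E` for the
power of two, `E * U ≤ E² * f + U²` separates the dependence on `n` from that on `k`, and `E²` is at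
most a constant times `k ^ (c log k)`. -/

/-- The contents of the stacks. -/
abbrev Stk {K : Type} (Γ : K → Type) : Type := ∀ k, List (Γ k)

/-- Structured programs over finitely many stacks; all control is by the tops of stacks. -/
inductive Prog {K : Type} (Γ : K → Type) : Type
  | skip : Prog Γ
  | push (k : K) (a : Γ k) : Prog Γ
  | pop (k : K) : Prog Γ
  | seq (P Q : Prog Γ) : Prog Γ
  | case (k : K) (br : Option (Γ k) → Prog Γ) : Prog Γ
  | loop (k : K) (p : Option (Γ k) → Bool) (P : Prog Γ) : Prog Γ

section Language

set_option linter.unusedSectionVars false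

variable {K : Type} {Γ : K → Type} [DecidableEq K]

/-- `Exec B P s s' t`: started on `s`, the program `P` stops with stacks `s'` after at most `t`
steps, and all stacks met before the end satisfy `B`. -/
inductive Exec (B : Stk Γ → Prop) : Prog Γ → Stk Γ → Stk Γ → ℕ → Prop
  | skip {s} : B s → Exec B .skip s s 1
  | push {k a s} : B s → Exec B (.push k a) s (update s k (a :: s k)) 1
  | pop {k s} : B s → Exec B (.pop k) s (update s k (s k).tail) 1
  | seq {P Q s s' s'' t t'} : Exec B P s s' t → Exec B Q s' s'' t' →
      Exec B (.seq P Q) s s'' (t + t')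
  | case {k br s s' t} : B s → Exec B (br (s k).head?) s s' t → Exec B (.case k br) s s' (t + 1)
  | loop_done {k p P s} : B s → p (s k).head? = false → Exec B (.loop k p P) s s 1
  | loop_step {k p P s s' s'' t t'} : B s → p (s k).head? = true → Exec B P s s' t →
      Exec B (.loop k p P) s' s'' t' → Exec B (.loop k p P) s s'' (t + t' + 1)
  | mono {P s s' t t'} : Exec B P s s' t → t ≤ t' → Exec B P s s' t'

/-! ### Time bounds as space bounds -/

/-- The total length of all stacks. -/
def size [Fintype K] (s : Stk Γ) : ℕ := ∑ k, (s k).length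

theorem size_update_le [Fintype K] (s : Stk Γ) (k : K) (l : List (Γ k)) (d : ℕ)
    (h : l.length ≤ (s k).length + d) : size (update s k l) ≤ size s + d := by
  unfold size
  rw [← Finset.add_sum_erase _ _ (Finset.mem_univ k),
    ← Finset.add_sum_erase Finset.univ (fun k => (s k).length) (Finset.mem_univ k)]
  have : ∑ x ∈ Finset.univ.erase k, (update s k l x).length =
      ∑ x ∈ Finset.univ.erase k, (s x).length :=
    Finset.sum_congr rfl fun x hx => by rw [update_of_ne (Finset.ne_of_mem_erase hx)]
  rw [this, update_self]
  omega

/-- A step pushes at most one letter, so the time bounds the growth of the memory. -/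
theorem Exec.size_le [Fintype K] {B : Stk Γ → Prop} {P : Prog Γ} {s s' : Stk Γ} {t : ℕ}
    (h : Exec B P s s' t) : size s' ≤ size s + t := by
  induction h with
  | skip => omega
  | push => exact size_update_le _ _ _ 1 (by simp)
  | pop => exact size_update_le _ _ _ 1 (by simp; omega)
  | seq => omega
  | case => omega
  | loop_done => omega
  | loop_step => omega
  | mono => omega

/-- The polynomial-time pieces get their space bounds from their time bounds in this way. Only the
simulated machine, whose time may far exceed its space, needs an invariant of its own. -/
theorem Exec.bounded [Fintype K] {B : Stk Γ → Prop} {P : Prog Γ} {s s' : Stk Γ} {t : ℕ}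
    (h : Exec B P s s' t) {S : ℕ} (hS : size s + t ≤ S) :
    Exec (fun x => size x ≤ S) P s s' t := by
  induction h with
  | skip => exact .skip (by omega)
  | push => exact .push (by omega)
  | pop => exact .pop (by omega)
  | seq h₁ _ ih₁ ih₂ => exact .seq (ih₁ (by omega)) (ih₂ (by have := h₁.size_le; omega))
  | case _ _ ih => exact .case (by omega) (ih (by omega))
  | loop_done _ hp => exact .loop_done (by omega) hp
  | loop_step _ hp h₁ _ ih₁ ih₂ =>
    exact .loop_step (by omega) hp (ih₁ (by omega)) (ih₂ (by have := h₁.size_le; omega))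
  | mono _ hle ih => exact .mono (ih (by omega)) hle

theorem Exec.imp {B B' : Stk Γ → Prop} {P : Prog Γ} {s s' : Stk Γ} {t : ℕ}
    (h : Exec B P s s' t) (hB : ∀ x, B x → B' x) : Exec B' P s s' t := by
  induction h with
  | skip h => exact .skip (hB _ h)
  | push h => exact .push (hB _ h)
  | pop h => exact .pop (hB _ h)
  | seq h₁ _ ih₁ ih₂ => exact .seq ih₁ ih₂
  | case h _ ih => exact .case (hB _ h) ih
  | loop_done h hp => exact .loop_done (hB _ h) hp
  | loop_step h hp h₁ _ ih₁ ih₂ => exact .loop_step (hB _ h) hp ih₁ ih₂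
  | mono _ hle ih => exact .mono ih hle

/-- A loop that runs through the states `f 0, …, f m`. -/
theorem Exec.loop_count {B : Stk Γ → Prop} {k : K} {p : Option (Γ k) → Bool} {P : Prog Γ}
    (f : ℕ → Stk Γ) (m T : ℕ) (hB : ∀ i ≤ m, B (f i))
    (hstep : ∀ i < m, p (f i k).head? = true ∧ Exec B P (f i) (f (i + 1)) T)
    (hend : p (f m k).head? = false) :
    Exec B (.loop k p P) (f 0) (f m) (m * (T + 1) + 1) := by
  induction m generalizing f with
  | zero => exact (Exec.loop_done (hB 0 le_rfl) hend).mono (by omega)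
  | succ m ih =>
    have := ih (fun i => f (i + 1)) (fun i hi => hB _ (by omega)) (fun i hi => hstep _ (by omega))
      hend
    exact (Exec.loop_step (hB 0 (by omega)) (hstep 0 (by omega)).1 (hstep 0 (by omega)).2
      this).mono (by ring_nf; omega)

/-- A loop that empties a stack. -/
theorem clear_exec (s : Stk Γ) (k : K) : Exec (fun _ => True) (.loop k Option.isSome (.pop k)) s
    (update s k []) ((s k).length * 2 + 1) := by
  generalize hl : s k = l
  induction l generalizing s with
  | nil =>
    rw [show update s k [] = s by rw [← hl]; simp]
    exact (Exec.loop_done trivial (by rw [hl]; rfl)).mono (by omega)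
  | cons a l ih =>
    have h := ih (update s k l) (by simp)
    rw [update_idem] at h
    have g := Exec.pop (B := fun _ => True) (k := k) (s := s) trivial
    rw [hl] at g
    exact (Exec.loop_step trivial (by rw [hl]; rfl) g h).mono (by simp; omega)

/-! #### Extending programs to more stacks -/

variable {J : Type} {Δ : J → Type}

/-- The same program in the presence of further stacks. -/
def Prog.lift (Δ : J → Type) : Prog Γ → Prog (Sum.elim Γ Δ)
  | .skip => .skip
  | .push k a => .push (Sum.inl k) a
  | .pop k => .pop (Sum.inl k)
  | .seq P Q => .seq (P.lift Δ) (Q.lift Δ)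
  | .case k br => .case (Sum.inl k) fun x => (br x).lift Δ
  | .loop k p P => .loop (Sum.inl k) p (P.lift Δ)

/-- Two families of stacks side by side. -/
def join (s : Stk Γ) (F : Stk Δ) : Stk (Sum.elim Γ Δ)
  | Sum.inl k => s k
  | Sum.inr j => F j

variable [DecidableEq J]

theorem join_update_left (s : Stk Γ) (F : Stk Δ) (k : K) (l : List (Γ k)) :
    join (update s k l) F = update (join s F) (Sum.inl k) l := by
  refine eq_update_iff.2 ⟨update_self (β := fun k => List (Γ k)) k l s, fun x hx => ?_⟩
  rcases x with x | x
  · exact update_of_ne (fun h => hx (congrArg Sum.inl h)) l s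
  · rfl

theorem join_update_right (s : Stk Γ) (F : Stk Δ) (k : J) (l : List (Δ k)) :
    join s (update F k l) = update (join s F) (Sum.inr k) l := by
  refine eq_update_iff.2 ⟨update_self (β := fun k => List (Δ k)) k l F, fun x hx => ?_⟩
  rcases x with x | x
  · rfl
  · exact update_of_ne (fun h => hx (congrArg Sum.inr h)) l F

/-- A lifted program never looks at the added stacks, so their contents `F` are carried along
unchanged. -/
theorem Exec.lift {B : Stk Γ → Prop} {B' : Stk (Sum.elim Γ Δ) → Prop} {P : Prog Γ} {s s' : Stk Γ}
    {t : ℕ} (h : Exec B P s s' t) (F : Stk Δ) (hB : ∀ x, B x → B' (join x F)) :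
    Exec B' (P.lift Δ) (join s F) (join s' F) t := by
  induction h with
  | skip h => exact .skip (hB _ h)
  | push h => rw [join_update_left]; exact .push (hB _ h)
  | pop h => rw [join_update_left]; exact .pop (hB _ h)
  | seq h₁ _ ih₁ ih₂ => exact .seq ih₁ ih₂
  | case h _ ih => exact .case (hB _ h) ih
  | loop_done h hp => exact .loop_done (hB _ h) hp
  | loop_step h hp h₁ _ ih₁ ih₂ => exact .loop_step (hB _ h) hp ih₁ ih₂
  | mono _ hle ih => exact .mono ih hle

theorem size_join [Fintype K] [Fintype J] (s : Stk Γ) (F : Stk Δ) :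
    size (join s F) = size s + size F := by
  simp only [size, Fintype.sum_sum_type]
  rfl

/-! #### Compilation -/

/-- The control points of a program. -/
def Prog.Pos : Prog Γ → Type
  | .skip => Unit
  | .push _ _ => Unit
  | .pop _ => Unit
  | .seq P Q => P.Pos ⊕ Q.Pos
  | .case _ br => Unit ⊕ (Σ x, (br x).Pos)
  | .loop _ _ P => Unit ⊕ P.Pos

/-- The control point at which a program starts. -/
def Prog.entry : (P : Prog Γ) → P.Pos
  | .skip => ()
  | .push _ _ => ()
  | .pop _ => ()
  | .seq P _ => Sum.inl P.entry
  | .case _ _ => Sum.inl ()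
  | .loop _ _ _ => Sum.inl ()

theorem Prog.finite_pos [∀ k, Finite (Γ k)] (P : Prog Γ) : Finite P.Pos := by
  induction P with
  | skip => exact inferInstanceAs (Finite Unit)
  | push => exact inferInstanceAs (Finite Unit)
  | pop => exact inferInstanceAs (Finite Unit)
  | seq P Q ih₁ ih₂ => exact inferInstanceAs (Finite (P.Pos ⊕ Q.Pos))
  | case k br ih => exact inferInstanceAs (Finite (Unit ⊕ (Σ x, (br x).Pos)))
  | loop k p P ih => exact inferInstanceAs (Finite (Unit ⊕ P.Pos))

/-- The machine code of a program placed at the labels `ι`, with exit label `ex`. The internal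
state of the machine holds the target of the next jump. -/
def Prog.code {Λ : Type} : (P : Prog Γ) → (P.Pos → Λ) → Λ → P.Pos → Turing.TM2.Stmt Γ Λ Λ
  | .skip, _, ex, _ => .goto fun _ => ex
  | .push k a, _, ex, _ => .push k (fun _ => a) (.goto fun _ => ex)
  | .pop k, _, ex, _ => .pop k (fun v _ => v) (.goto fun _ => ex)
  | .seq P Q, ι, ex, q => match q with
    | Sum.inl q => P.code (fun x => ι (Sum.inl x)) (ι (Sum.inr Q.entry)) q
    | Sum.inr q => Q.code (fun x => ι (Sum.inr x)) ex q
  | .case k br, ι, ex, q => match q with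
    | Sum.inl _ => .peek k (fun _ x => ι (Sum.inr ⟨x, (br x).entry⟩)) (.goto id)
    | Sum.inr ⟨x, q⟩ => (br x).code (fun y => ι (Sum.inr ⟨x, y⟩)) ex q
  | .loop k p P, ι, ex, q => match q with
    | Sum.inl _ =>
      .peek k (fun _ x => if p x then ι (Sum.inr P.entry) else ex) (.goto id)
    | Sum.inr q => P.code (fun x => ι (Sum.inr x)) (ι (Sum.inl ())) q

/-- `Path m B c c' t`: the machine `m` gets from `c` to `c'` in exactly `t` steps, through
configurations whose stacks satisfy `B`. -/
inductive Path {Λ σ : Type} (m : Λ → Turing.TM2.Stmt Γ Λ σ) (B : Stk Γ → Prop) :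
    Turing.TM2.Cfg Γ Λ σ → Turing.TM2.Cfg Γ Λ σ → ℕ → Prop
  | refl (c) : Path m B c c 0
  | head {c d e t} : B c.stk → Turing.TM2.step m c = some d → Path m B d e t →
      Path m B c e (t + 1)

theorem Path.trans {Λ σ : Type} {m : Λ → Turing.TM2.Stmt Γ Λ σ} {B : Stk Γ → Prop}
    {c d e : Turing.TM2.Cfg Γ Λ σ} {t t' : ℕ} (h : Path m B c d t) (h' : Path m B d e t') :
    Path m B c e (t + t') := by
  induction h with
  | refl => simpa using h'
  | head hB hs _ ih => rw [Nat.add_right_comm]; exact .head hB hs (ih h')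

/-- Subprograms are placed at sublabels, with the start of their continuation as exit label, so the
runs concatenate. The internal state `v` at the entry is arbitrary because every jump that depends
on the state comes right after a `peek` that overwrites it. -/
theorem Exec.path {Λ : Type} {m : Λ → Turing.TM2.Stmt Γ Λ Λ} {B : Stk Γ → Prop} {P : Prog Γ}
    {s s' : Stk Γ} {t : ℕ} (h : Exec B P s s' t) (ι : P.Pos → Λ) (ex : Λ)
    (hm : ∀ q, m (ι q) = P.code ι ex q) (v : Λ) :
    ∃ t' ≤ t, ∃ v', Path m B ⟨some (ι P.entry), v, s⟩ ⟨some ex, v', s'⟩ t' := by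
  induction h generalizing ex v with
  | skip hB => exact ⟨1, le_rfl, v, .head hB (by simp [hm, Prog.code]) (.refl _)⟩
  | push hB => exact ⟨1, le_rfl, v, .head hB (by simp [hm, Prog.code]) (.refl _)⟩
  | pop hB => exact ⟨1, le_rfl, v, .head hB (by simp [hm, Prog.code]) (.refl _)⟩
  | @seq P Q s s' s'' t t' _ _ ih₁ ih₂ =>
    obtain ⟨t₁, h₁, v₁, p₁⟩ := ih₁ (fun x => ι (Sum.inl x)) (ι (Sum.inr Q.entry))
      (fun q => hm (Sum.inl q)) v
    obtain ⟨t₂, h₂, v₂, p₂⟩ := ih₂ (fun x => ι (Sum.inr x)) ex (fun q => hm (Sum.inr q)) v₁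
    exact ⟨t₁ + t₂, by omega, v₂, p₁.trans p₂⟩
  | @case k br s s' t hB _ ih =>
    obtain ⟨t₁, h₁, v₁, p₁⟩ := ih (fun y => ι (Sum.inr ⟨(s k).head?, y⟩)) ex
      (fun q => hm (Sum.inr ⟨_, q⟩)) (ι (Sum.inr ⟨(s k).head?, (br (s k).head?).entry⟩))
    exact ⟨t₁ + 1, by omega, v₁, .head hB (congrArg some
      (congrArg (fun q => Turing.TM2.stepAux q v s) (hm (Sum.inl ())))) p₁⟩
  | @loop_done k p P s hB hp =>
    exact ⟨1, le_rfl, ex, .head hB (congrArg some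
      ((congrArg (fun q => Turing.TM2.stepAux q v s) (hm (Sum.inl ()))).trans
        (by simp only [Prog.code, Turing.TM2.stepAux, hp]; rfl))) (.refl _)⟩
  | @loop_step k p P s s' s'' t t' hB hp _ _ ih₁ ih₂ =>
    obtain ⟨t₁, h₁, v₁, p₁⟩ := ih₁ (fun x => ι (Sum.inr x)) (ι (Sum.inl ()))
      (fun q => hm (Sum.inr q)) (ι (Sum.inr P.entry))
    obtain ⟨t₂, h₂, v₂, p₂⟩ := ih₂ ι ex hm v₁
    exact ⟨t₁ + t₂ + 1, by omega, v₂,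
      .head hB (congrArg some
        ((congrArg (fun q => Turing.TM2.stepAux q v s) (hm (Sum.inl ()))).trans
          (by simp only [Prog.code, Turing.TM2.stepAux, hp]; rfl))) (p₁.trans p₂)⟩
  | mono _ hle ih =>
    obtain ⟨t₁, h₁, v₁, p₁⟩ := ih ι ex hm v
    exact ⟨t₁, by omega, v₁, p₁⟩

end Language

/-! #### From programs to machines -/

/-- The machine that executes a program and then halts. -/
noncomputable def Prog.machine {K : Type} {Γ : K → Type} [DecidableEq K] [Fintype K]
    [∀ k, Finite (Γ k)] (P : Prog Γ) (k₀ k₁ : K) (e₀ : Γ k₀ ≃ Option Bool) (e₁ : Γ k₁ ≃ Bool) :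
    Machine where
  tm :=
    letI := P.finite_pos
    letI := Fintype.ofFinite (Option P.Pos)
    letI := Fintype.ofFinite (Γ k₀)
    { K := K
      k₀ := k₀
      k₁ := k₁
      Γ := Γ
      Λ := Option P.Pos
      main := some P.entry
      σ := Option P.Pos
      initialState := none
      m := fun l => match l with
        | none => .halt
        | some q => P.code some none q }
  inputAlphabet := e₀
  outputAlphabet := e₁
  finite_alphabet := inferInstance

theorem Machine.run_succ (M : Machine) (w : List (Option Bool)) (t : ℕ) :
    M.run w (t + 1) = (M.run w t).bind M.tm.step := by
  simp only [Machine.run, iterate_succ_apply']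

theorem Machine.run_of_path (M : Machine) (w : List (Option Bool)) {B : Stk M.tm.Γ → Prop}
    {c d : M.tm.Cfg} {t i : ℕ} (hc : M.run w i = some c)
    (h : @Path M.tm.K M.tm.Γ M.tm.kDecidableEq M.tm.Λ M.tm.σ M.tm.m B c d t) :
    M.run w (i + t) = some d ∧
      ∀ j < i + t, i ≤ j → ∃ e, M.run w j = some e ∧ B (Turing.TM2.Cfg.stk e) := by
  induction h generalizing i with
  | refl => exact ⟨hc, fun j hj hij => by omega⟩
  | @head c d e t hB hs _ ih =>
    have h₁ : M.run w (i + 1) = some d := by rw [Machine.run_succ, hc]; exact hs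
    obtain ⟨h₂, h₃⟩ := ih h₁
    refine ⟨by rw [← h₂]; congr 1; omega, fun j hj hij => ?_⟩
    rcases Nat.eq_or_lt_of_le hij with heq | hlt
    · subst heq
      exact ⟨c, hc, hB⟩
    · exact h₃ j (by omega) hlt

theorem Machine.run_none (M : Machine) (w : List (Option Bool)) {i : ℕ} {c : M.tm.Cfg}
    (hc : M.run w i = some c) (hl : Turing.TM2.Cfg.l c = none) (j : ℕ) (hj : i < j) :
    M.run w j = none := by
  induction j, hj using Nat.le_induction with
  | base =>
    rw [Machine.run_succ, hc]
    obtain ⟨l, v, s⟩ := c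
    cases hl
    rfl
  | succ j _ ih => rw [Machine.run_succ, ih]; rfl

theorem Prog.machine_answers {K : Type} {Γ : K → Type} [DecidableEq K] [Fintype K]
    [∀ k, Finite (Γ k)] (P : Prog Γ) (k₀ k₁ : K) (e₀ : Γ k₀ ≃ Option Bool) (e₁ : Γ k₁ ≃ Bool)
    (w : List (Option Bool)) (b : Bool) (T S : ℕ) (s' : Stk Γ)
    (h : Exec (fun x => size x ≤ S) P
      (update (fun _ => []) k₀ (w.map e₀.symm)) s' T)
    (hs' : size s' ≤ S) (hb : (s' k₁).head? = some (e₁.symm b)) :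
    (P.machine k₀ k₁ e₀ e₁).Answers w b (T + 1 : ℕ) S := by
  set M := P.machine k₀ k₁ e₀ e₁
  obtain ⟨t, ht, v, hp⟩ := h.path (m := M.tm.m) some none (fun _ => rfl) none
  have h₀ : M.run w 0 = some ⟨some (some P.entry), none,
      update (fun _ => []) k₀ (w.map e₀.symm)⟩ := by
    simp only [Machine.run, iterate_zero, id, Machine.init, Turing.initList]
    refine congrArg some ?_
    exact congrArg (Turing.TM2.Cfg.mk _ _)
      (eq_update_iff.2 ⟨dif_pos rfl, fun k hk => dif_neg hk⟩)
  obtain ⟨h₁, h₂⟩ := M.run_of_path w h₀ hp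
  -- The exit label `none` holds the `halt` statement, whose execution is the one step beyond `T`.
  have h₃ : M.run w (0 + t + 1) = some ⟨none, v, s'⟩ := by
    rw [Machine.run_succ, h₁]; rfl
  refine ⟨⟨0 + t + 1, _, by exact_mod_cast (by omega : 0 + t + 1 ≤ T + 1), h₃, rfl, hb⟩, ?_⟩
  intro j c hj
  -- After halting the run is `none`, so only finitely many configurations have to be checked for
  -- space.
  have hjt : j ≤ 0 + t + 1 := by
    by_contra hcon
    rw [M.run_none w h₃ rfl j (by omega)] at hj
    cases hj
  rcases Nat.lt_or_ge j (0 + t) with hlt | hge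
  · obtain ⟨e, he, hB⟩ := h₂ j hlt (Nat.zero_le _)
    rw [hj] at he
    cases he
    exact_mod_cast hB
  · have : j = 0 + t ∨ j = 0 + t + 1 := by omega
    rcases this with heq | heq <;> subst heq
    · rw [h₁] at hj; cases hj
      exact_mod_cast hs'
    · rw [h₃] at hj; cases hj
      exact_mod_cast hs'

/-! ### Registers and basic macros -/

/-- The work stacks. -/
inductive Reg
  | mat | rev | ptr (i : Fin 6) | cop (i : Fin 6) | set (i : Fin 7) | bs | ta | tp | tq | ct
  | tape | out | ext (i : Fin 6)
  deriving DecidableEq, Fintype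

/-- All work stacks hold letters of the input alphabet. -/
abbrev RegΓ : Reg → Type := fun _ => Option Bool

/-- Execution without a bound on the space. -/
abbrev Go (P : Prog RegΓ) (s s' : Stk RegΓ) (t : ℕ) : Prop := Exec (fun _ => True) P s s' t

theorem go_skip (s : Stk RegΓ) : Go .skip s s 1 := Exec.skip trivial

theorem go_push (s : Stk RegΓ) (k : Reg) (a : Option Bool) :
    Go (.push k a) s (update s k (a :: s k)) 1 := Exec.push trivial

theorem go_pop (s : Stk RegΓ) (k : Reg) : Go (.pop k) s (update s k (s k).tail) 1 :=
  Exec.pop trivial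

/-- Move one letter. -/
def mv (k k' : Reg) : Prog RegΓ :=
  .case k fun
    | none => .skip
    | some a => .seq (.pop k) (.push k' a)

/-- The final stacks are given pointwise, not as nested updates, so that applications only compare
stacks one at a time. -/
theorem go_mv_cons {s s' : Stk RegΓ} {k k' : Reg} {a : Option Bool} {l : List (Option Bool)}
    (hs : s k = a :: l) (hk : k ≠ k') (h₁ : s' k = l) (h₂ : s' k' = a :: s k')
    (h₃ : ∀ x, x ≠ k → x ≠ k' → s' x = s x) : Go (mv k k') s s' 3 := by
  have : s' = update (update s k l) k' (a :: s k') := by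
    refine eq_update_iff.2 ⟨h₂, fun x hx => ?_⟩
    by_cases hxk : x = k
    · subst hxk; simpa using h₁
    · rw [update_of_ne hxk]; exact h₃ x hxk hx
  rw [this]
  refine Exec.case trivial ?_
  rw [hs]
  have h := (go_pop s k).seq (go_push _ k' a)
  rw [hs, List.tail_cons, update_of_ne hk.symm] at h
  exact h

theorem go_mv_nil {s : Stk RegΓ} {k : Reg} (k' : Reg) (hs : s k = []) : Go (mv k k') s s 3 := by
  refine Exec.mono (t := 2) (Exec.case trivial ?_) (by omega)
  rw [hs]
  exact Exec.skip trivial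

/-- Move letters along two pairs of stacks in parallel until the first one is exhausted. -/
def shift (k k' j j' : Reg) : Prog RegΓ :=
  .loop k Option.isSome (.seq (mv k k') (mv j j'))

/-- If the first stack is a unary number `i`, this uncovers the letter number `i` of the stack `j`,
and shifting back restores both. When `j` runs out early its half of the work becomes idle, as
happens in the comparison of two pointers. -/
theorem go_shift {s s' : Stk RegΓ} {k k' j j' : Reg} (hd : [k, k', j, j'].Nodup)
    (h₁ : s' k = []) (h₂ : s' k' = (s k).reverse ++ s k') (h₃ : s' j = (s j).drop (s k).length)
    (h₄ : s' j' = ((s j).take (s k).length).reverse ++ s j')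
    (h₅ : ∀ x, x ≠ k → x ≠ k' → x ≠ j → x ≠ j' → s' x = s x) :
    Go (shift k k' j j') s s' ((s k).length * 7 + 1) := by
  simp only [List.nodup_cons, List.mem_cons, not_or, List.not_mem_nil, not_false_eq_true,
    List.nodup_nil, and_true] at hd
  obtain ⟨⟨d₁, d₂, d₃⟩, ⟨d₄, d₅⟩, d₆⟩ := hd
  generalize hl : s k = l at *
  induction l generalizing s with
  | nil =>
    have : s' = s := by
      funext x
      by_cases e₁ : x = k
      · subst e₁; rw [h₁, hl]
      by_cases e₂ : x = k'
      · subst e₂; simpa using h₂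
      by_cases e₃ : x = j
      · subst e₃; simpa using h₃
      by_cases e₄ : x = j'
      · subst e₄; simpa using h₄
      exact h₅ x e₁ e₂ e₃ e₄
    rw [this]
    exact (Exec.loop_done trivial (by rw [hl]; rfl)).mono (by omega)
  | cons a l ih =>
    set s₁ : Stk RegΓ := update (update s k l) k' (a :: s k') with hs₁
    have g₁ : Go (mv k k') s s₁ 3 := by
      refine go_mv_cons hl d₁ ?_ ?_ ?_
      · simp [hs₁, d₁]
      · simp [hs₁]
      · intro x hx hx'; simp [hs₁, hx, hx']
    have hj : s₁ j = s j := by simp [hs₁, Ne.symm d₂, Ne.symm d₄]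
    obtain ⟨s₂, g₂, e₁, e₂, e₃, e₄, e₅⟩ : ∃ s₂, Go (mv j j') s₁ s₂ 3 ∧ s₂ k = l ∧
        s₂ k' = a :: s k' ∧ s₂ j = (s j).drop 1 ∧ s₂ j' = ((s j).take 1).reverse ++ s j' ∧
        ∀ x, x ≠ k → x ≠ k' → x ≠ j → x ≠ j' → s₂ x = s x := by
      rcases hj' : s j with _ | ⟨b, m⟩
      · refine ⟨s₁, go_mv_nil j' (by rw [hj, hj']), ?_, ?_, ?_, ?_, ?_⟩
        · simp [hs₁, d₁]
        · simp [hs₁]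
        · simp [hj, hj']
        · simp [hs₁, Ne.symm d₃, Ne.symm d₅]
        · intro x a₁ a₂ _ _; simp [hs₁, a₁, a₂]
      · refine ⟨update (update s₁ j m) j' (b :: s₁ j'), go_mv_cons (by rw [hj, hj']) d₆
          ?_ ?_ ?_, ?_, ?_, ?_, ?_, ?_⟩
        · simp [d₆]
        · simp
        · intro x hx hx'; simp [hx, hx']
        · simp [hs₁, d₁, d₂, d₃]
        · simp [hs₁, d₄, d₅]
        · simp [d₆]
        · simp [hs₁, Ne.symm d₃, Ne.symm d₅]
        · intro x a₁ a₂ a₃ a₄; simp [hs₁, a₁, a₂, a₃, a₄]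
    have := @ih s₂ (fun x a₁ a₂ a₃ a₄ => by rw [h₅ x a₁ a₂ a₃ a₄, e₅ x a₁ a₂ a₃ a₄]) e₁
      (by rw [h₂, e₂]; simp) (by rw [h₃, e₃]; simp)
      (by
        rw [h₄, e₃, e₄]
        rcases s j with _ | ⟨b, m⟩ <;> simp)
    exact (Exec.loop_step trivial (by rw [hl]; rfl) (g₁.seq g₂) this).mono (by simp; omega)

/-- Move letters until the first letter that fails `p`. -/
def mvWhile (p : Option (Option Bool) → Bool) (k k' : Reg) : Prog RegΓ := .loop k p (mv k k')

theorem go_mvWhile {p : Option (Option Bool) → Bool} {s s' : Stk RegΓ} {k k' : Reg} (hd : k ≠ k')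
    {l r : List (Option Bool)} (hs : s k = l ++ r) (hl : ∀ a ∈ l, p (some a) = true)
    (hr : p r.head? = false) (h₁ : s' k = r) (h₂ : s' k' = l.reverse ++ s k')
    (h₃ : ∀ x, x ≠ k → x ≠ k' → s' x = s x) :
    Go (mvWhile p k k') s s' (l.length * 4 + 1) := by
  induction l generalizing s with
  | nil =>
    have : s' = s := by
      funext x
      by_cases e₁ : x = k
      · subst e₁; rw [h₁, hs]; rfl
      by_cases e₂ : x = k'
      · subst e₂; simpa using h₂
      exact h₃ x e₁ e₂
    rw [this]
    exact (Exec.loop_done trivial (by rw [hs]; exact hr)).mono (by omega)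
  | cons a l ih =>
    set s₁ : Stk RegΓ := update (update s k (l ++ r)) k' (a :: s k') with hs₁
    have g₁ : Go (mv k k') s s₁ 3 := by
      refine go_mv_cons hs hd ?_ ?_ ?_
      · simp [hs₁, hd]
      · simp [hs₁]
      · intro x hx hx'; simp [hs₁, hx, hx']
    have := @ih s₁ (by simp [hs₁, hd]) (fun b hb => hl b (by simp [hb]))
      (by rw [h₂]; simp [hs₁]) (fun x hx hx' => by rw [h₃ x hx hx']; simp [hs₁, hx, hx'])
    exact (Exec.loop_step trivial (by rw [hs]; exact hl a (by simp)) g₁ this).mono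
      (by simp; omega)

/-- Move all letters. -/
def mvAll (k k' : Reg) : Prog RegΓ := mvWhile Option.isSome k k'

theorem go_mvAll {s s' : Stk RegΓ} {k k' : Reg} (hd : k ≠ k') (h₁ : s' k = [])
    (h₂ : s' k' = (s k).reverse ++ s k') (h₃ : ∀ x, x ≠ k → x ≠ k' → s' x = s x) :
    Go (mvAll k k') s s' ((s k).length * 4 + 1) :=
  go_mvWhile hd (List.append_nil _).symm (fun _ _ => rfl) rfl h₁ h₂ h₃

/-- Empty a stack. -/
def clear (k : Reg) : Prog RegΓ := .loop k Option.isSome (.pop k)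

theorem go_clear (s : Stk RegΓ) (k : Reg) :
    Go (clear k) s (update s k []) ((s k).length * 2 + 1) := clear_exec s k

/-! ### Polynomial bounds -/

/-- Bounded by a polynomial. -/
def PolyB (T : ℕ → ℕ) : Prop := ∃ a : ℕ, ∀ n, T n ≤ a * (n + 1) ^ a

theorem PolyB.const (c : ℕ) : PolyB fun _ => c :=
  ⟨c, fun n => by
    have : 1 ≤ (n + 1) ^ c := Nat.one_le_pow _ _ (by omega)
    nlinarith⟩

theorem PolyB.id : PolyB fun n => n := ⟨1, fun n => by simp⟩

theorem PolyB.add {T T' : ℕ → ℕ} (h : PolyB T) (h' : PolyB T') : PolyB fun n => T n + T' n := by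
  obtain ⟨a, ha⟩ := h
  obtain ⟨b, hb⟩ := h'
  refine ⟨a + b, fun n => ?_⟩
  have h₁ : (n + 1) ^ a ≤ (n + 1) ^ (a + b) := Nat.pow_le_pow_right (by omega) (by omega)
  have h₂ : (n + 1) ^ b ≤ (n + 1) ^ (a + b) := Nat.pow_le_pow_right (by omega) (by omega)
  calc T n + T' n ≤ a * (n + 1) ^ a + b * (n + 1) ^ b := Nat.add_le_add (ha n) (hb n)
    _ ≤ a * (n + 1) ^ (a + b) + b * (n + 1) ^ (a + b) :=
        Nat.add_le_add (Nat.mul_le_mul_left _ h₁) (Nat.mul_le_mul_left _ h₂)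
    _ = _ := by ring

theorem PolyB.mul {T T' : ℕ → ℕ} (h : PolyB T) (h' : PolyB T') : PolyB fun n => T n * T' n := by
  obtain ⟨a, ha⟩ := h
  obtain ⟨b, hb⟩ := h'
  refine ⟨a * b + a + b, fun n => ?_⟩
  have h₁ : (n + 1) ^ (a + b) ≤ (n + 1) ^ (a * b + a + b) :=
    Nat.pow_le_pow_right (by omega) (by rw [add_assoc]; omega)
  calc T n * T' n ≤ (a * (n + 1) ^ a) * (b * (n + 1) ^ b) := Nat.mul_le_mul (ha n) (hb n)
    _ = (a * b) * (n + 1) ^ (a + b) := by ring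
    _ ≤ (a * b + a + b) * (n + 1) ^ (a * b + a + b) := Nat.mul_le_mul (by omega) h₁

/-! ### Formulas and commands -/

/-- The part of the memory that commands act on: seven sets of numbers, a tape of bits to be read,
and an output. -/
structure St where
  set : Fin 7 → ℕ → Bool
  tape : List Bool
  out : List (Option Bool)

/-- Formulas about the adjacency matrix and the sets, with Boolean folds and comparisons of
cardinalities as quantifiers. -/
inductive Fm
  | mem (i : Fin 7) (p : Fin 6)
  | adj (p q : Fin 6)
  | lt (p q : Fin 6)
  | nt (φ : Fm)
  | bop (f : Bool → Bool → Bool) (φ ψ : Fm)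
  | fold (f : Bool → Bool → Bool) (b : Bool) (p : Fin 6) (φ : Fm)
  | more (p : Fin 6) (φ ψ : Fm)

/-- The truth value of a formula. -/
def Fm.eval (n : ℕ) (A : ℕ → ℕ → Bool) (X : Fin 7 → ℕ → Bool) : Fm → (Fin 6 → ℕ) → Bool
  | .mem i p, ρ => X i (ρ p)
  | .adj p q, ρ => A (ρ p) (ρ q)
  | .lt p q, ρ => decide (ρ p < ρ q)
  | .nt φ, ρ => !φ.eval n A X ρ
  | .bop f φ ψ, ρ => f (φ.eval n A X ρ) (ψ.eval n A X ρ)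
  | .fold f b p φ, ρ => (List.range n).foldl (fun c u => f c (φ.eval n A X (update ρ p u))) b
  | .more p φ ψ, ρ => decide ((List.range n).countP (fun u => ψ.eval n A X (update ρ p u)) <
      (List.range n).countP (fun u => φ.eval n A X (update ρ p u)))

/-- All variables outside `B` are bound, and no variable is bound twice. -/
def Fm.WF : Fm → Finset (Fin 6) → Prop
  | .mem _ p, B => p ∈ B
  | .adj p q, B => p ∈ B ∧ q ∈ B ∧ p ≠ q
  | .lt p q, B => p ∈ B ∧ q ∈ B ∧ p ≠ q
  | .nt φ, B => φ.WF B
  | .bop _ φ ψ, B => φ.WF B ∧ ψ.WF B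
  | .fold _ _ p φ, B => p ∉ B ∧ φ.WF (insert p B)
  | .more p φ ψ, B => p ∉ B ∧ φ.WF (insert p B) ∧ ψ.WF (insert p B)

/-- Commands. -/
inductive Cmd
  | skip
  | seq (c d : Cmd)
  | assign (i : Fin 7) (p : Fin 6) (φ : Fm)
  | bit (c d : Cmd)
  | cond (φ : Fm) (c d : Cmd)
  | emit (φ : Fm)
  | sep
  | loop (p : Fin 6) (c : Cmd)

/-- The effect of a command. -/
def Cmd.eval (n : ℕ) (A : ℕ → ℕ → Bool) : Cmd → (Fin 6 → ℕ) → St → St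
  | .skip, _, st => st
  | .seq c d, ρ, st => d.eval n A ρ (c.eval n A ρ st)
  | .assign i p φ, ρ, st =>
    { st with set := update st.set i fun v => φ.eval n A st.set (update ρ p v) }
  | .bit c d, ρ, st =>
    if st.tape.head? = some true then c.eval n A ρ { st with tape := st.tape.tail }
    else d.eval n A ρ { st with tape := st.tape.tail }
  | .cond φ c d, ρ, st => if φ.eval n A st.set ρ then c.eval n A ρ st else d.eval n A ρ st
  | .emit φ, ρ, st => { st with out := some (φ.eval n A st.set ρ) :: st.out }
  | .sep, _, st => { st with out := none :: st.out }
  | .loop p c, ρ, st => (List.range n).foldl (fun st i => c.eval n A (update ρ p i) st) st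

/-- All variables outside `B` are bound, and no variable is bound twice. -/
def Cmd.WF : Cmd → Finset (Fin 6) → Prop
  | .skip, _ => True
  | .seq c d, B => c.WF B ∧ d.WF B
  | .assign _ p φ, B => p ∉ B ∧ φ.WF (insert p B)
  | .bit c d, B => c.WF B ∧ d.WF B
  | .cond φ c d, B => φ.WF B ∧ c.WF B ∧ d.WF B
  | .emit φ, B => φ.WF B
  | .sep, _ => True
  | .loop p c, B => p ∉ B ∧ c.WF (insert p B)

/-! ### The memory layout -/

/-- A row of the adjacency matrix with its separator. -/
def row (n : ℕ) (A : ℕ → ℕ → Bool) (i : ℕ) : List (Option Bool) :=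
  (List.range n).map (fun j => some (A i j)) ++ [none]

/-- The stacks that represent a memory state; `F` gives the contents of all other stacks. -/
def asm (n : ℕ) (A : ℕ → ℕ → Bool) (st : St) (ρ : Fin 6 → ℕ) (F : Stk RegΓ) : Stk RegΓ
  | .mat => (List.range n).flatMap (row n A)
  | .ptr i => List.replicate (ρ i) none
  | .cop i => List.replicate (n - ρ i) none
  | .set i => (List.range n).map fun v => some (st.set i v)
  | .tape => st.tape.map some
  | .out => st.out
  | .bs => F .bs
  | .ct => F .ct
  | .ext i => F (.ext i)
  | .rev => []
  | .ta => []
  | .tp => []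
  | .tq => []

section

variable {n : ℕ} {A : ℕ → ℕ → Bool} {st : St} {ρ : Fin 6 → ℕ} {F : Stk RegΓ}

theorem asm_update_bs (l : List (Option Bool)) :
    asm n A st ρ (update F .bs l) = update (asm n A st ρ F) .bs l := by
  refine eq_update_iff.2 ⟨?_, fun x hx => ?_⟩
  · simp [asm]
  · cases x <;> simp_all [asm]

theorem asm_update_ct (l : List (Option Bool)) :
    asm n A st ρ (update F .ct l) = update (asm n A st ρ F) .ct l := by
  refine eq_update_iff.2 ⟨?_, fun x hx => ?_⟩
  · simp [asm]
  · cases x <;> simp_all [asm]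

/-- Push a truth value on the evaluation stack. -/
def pushB (b : Bool) (s : Stk RegΓ) : Stk RegΓ := update s .bs (some b :: s .bs)

theorem asm_pushB (b : Bool) : asm n A st ρ (pushB b F) = pushB b (asm n A st ρ F) := by
  rw [pushB, asm_update_bs]; rfl

/-! ### Loops over all vertices -/

/-- The pointer `p` at position `i`. -/
def atPtr (n : ℕ) (p : Fin 6) (i : ℕ) (s : Stk RegΓ) : Stk RegΓ :=
  update (update s (.ptr p) (List.replicate i none)) (.cop p) (List.replicate (n - i) none)

/-- Run a program for all positions of a pointer. -/
def forLoop (p : Fin 6) (P : Prog RegΓ) : Prog RegΓ :=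
  .seq (.loop (.cop p) Option.isSome (.seq P (mv (.cop p) (.ptr p)))) (mvAll (.ptr p) (.cop p))

theorem asm_atPtr (p : Fin 6) (i : ℕ) :
    asm n A st (update ρ p i) F = atPtr n p i (asm n A st ρ F) := by
  refine eq_update_iff.2 ⟨by simp [asm], fun x hx => ?_⟩
  by_cases h : x = .ptr p
  · subst h; simp [asm]
  · rw [update_of_ne h]
    cases x with
    | ptr j => have : j ≠ p := fun e => h (by rw [e]); simp [asm, this]
    | cop j => have : j ≠ p := fun e => hx (by rw [e]); simp [asm, this]
    | _ => rfl

theorem asm_atPtr_zero {p : Fin 6} (hp : ρ p = 0) :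
    atPtr n p 0 (asm n A st ρ F) = asm n A st ρ F := by
  rw [← asm_atPtr, ← hp, update_eq_self]

/-- The length of `cop p` counts the iterations to come and that of `ptr p` those done. The overhead
of 8 per iteration consists of 3 for moving a letter, 1 for the loop test and 4 for the final reset
of the pointer. -/
theorem go_forLoop {p : Fin 6} {P : Prog RegΓ} {T : ℕ} (h : ℕ → Stk RegΓ)
    (hb : ∀ i < n, Go P (atPtr n p i (h i)) (atPtr n p i (h (i + 1))) T) :
    Go (forLoop p P) (atPtr n p 0 (h 0)) (atPtr n p 0 (h n)) (n * (T + 8) + 2) := by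
  have h₁ : Go (.loop (.cop p) Option.isSome (.seq P (mv (.cop p) (.ptr p))))
      (atPtr n p 0 (h 0)) (atPtr n p n (h n)) (n * (T + 3 + 1) + 1) := by
    refine Exec.loop_count (fun i => atPtr n p i (h i)) n (T + 3) (fun _ _ => trivial)
      (fun i hi => ⟨?_, ?_⟩) ?_
    · obtain ⟨m, hm⟩ : ∃ m, n - i = m + 1 := ⟨n - i - 1, by omega⟩
      simp [atPtr, hm, List.replicate_succ]
    · refine (hb i hi).seq ?_
      obtain ⟨m, hm⟩ : ∃ m, n - i = m + 1 := ⟨n - i - 1, by omega⟩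
      have hm' : n - (i + 1) = m := by omega
      refine go_mv_cons (a := none) (l := List.replicate m none) ?_ (by simp) ?_ ?_ ?_
      · simp [atPtr, hm, List.replicate_succ]
      · simp [atPtr, hm']
      · simp [atPtr, List.replicate_succ]
      · intro x hx hx'
        simp [atPtr, hx, hx']
    · simp [atPtr]
  have h₂ : Go (mvAll (.ptr p) (.cop p)) (atPtr n p n (h n)) (atPtr n p 0 (h n)) (n * 4 + 1) := by
    have := @go_mvAll (atPtr n p n (h n)) (atPtr n p 0 (h n)) (.ptr p) (.cop p) (by simp)
      (by simp [atPtr]) (by simp [atPtr]) (fun x hx hx' => by simp [atPtr, hx, hx'])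
    simpa [atPtr] using this
  exact (h₁.seq h₂).mono (by ring_nf; omega)

/-! ### Atomic formulas -/

/-- Evaluate `mem i p`. -/
def readSet (i : Fin 7) (p : Fin 6) : Prog RegΓ :=
  .seq (shift (.ptr p) .tp (.set i) .ta) <|
  .seq (.case (.set i) fun
    | some a => .push .bs a
    | none => .skip)
  (shift .tp (.ptr p) .ta (.set i))

theorem go_readSet (i : Fin 7) (p : Fin 6) (hp : ρ p < n) :
    Go (readSet i p) (asm n A st ρ F) (pushB (st.set i (ρ p)) (asm n A st ρ F))
      (n * 14 + 4) := by
  set s := asm n A st ρ F with hs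
  set L : List (Option Bool) := (List.range n).map fun v => some (st.set i v) with hL
  have hLn : L.length = n := by simp [hL]
  set s₁ : Stk RegΓ := update (update (update (update s (.ptr p) []) .tp
    (List.replicate (ρ p) none)) (.set i) (L.drop (ρ p))) .ta (L.take (ρ p)).reverse with hs₁
  have e₁ : s (.ptr p) = List.replicate (ρ p) none := rfl
  have e₂ : s (.set i) = L := rfl
  have e₃ : s .tp = [] := rfl
  have e₄ : s .ta = [] := rfl
  have g₁ : Go (shift (.ptr p) .tp (.set i) .ta) s s₁ (ρ p * 7 + 1) := by
    have := @go_shift s s₁ (.ptr p) .tp (.set i) .ta (by simp) (by simp [hs₁])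
      (by simp [hs₁, e₁, e₃]) (by simp [hs₁, e₁, e₂]) (by simp [hs₁, e₁, e₂, e₄])
      (fun x h₁ h₂ h₃ h₄ => by simp [hs₁, h₁, h₂, h₃, h₄])
    simpa [e₁] using this
  have g₂ : Go (.case (.set i) fun
      | some a => .push .bs a
      | none => .skip) s₁ (pushB (st.set i (ρ p)) s₁) 2 := by
    refine Exec.case trivial ?_
    have : (s₁ (.set i)).head? = some (some (st.set i (ρ p))) := by
      simp [hs₁, hL, hp]
    rw [this]
    exact go_push _ _ _
  have g₃ : Go (shift .tp (.ptr p) .ta (.set i)) (pushB (st.set i (ρ p)) s₁)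
      (pushB (st.set i (ρ p)) s) (ρ p * 7 + 1) := by
    have := @go_shift (pushB (st.set i (ρ p)) s₁) (pushB (st.set i (ρ p)) s) .tp (.ptr p) .ta
      (.set i) (by simp) (by simp [pushB, e₃]) (by simp [pushB, hs₁, e₁])
      (by simp [pushB, hs₁, e₄])
      (by
        have : (L.take (ρ p)).reverse.length ≤ ρ p := by simp
        simp [pushB, hs₁, e₂, List.take_of_length_le this])
      (fun x h₁ h₂ h₃ h₄ => by
        by_cases h : x = .bs
        · subst h; simp [pushB, hs₁]
        · simp [pushB, hs₁, h₁, h₂, h₃, h₄, h])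
    simpa [pushB, hs₁] using this
  exact (g₁.seq (g₂.seq g₃)).mono (by omega)

/-- Evaluate `lt p q`. -/
def readLt (p q : Fin 6) : Prog RegΓ :=
  .seq (shift (.ptr p) .tp (.ptr q) .tq) <|
  .seq (.case (.ptr q) fun x => .push .bs (some x.isSome)) <|
  .seq (mvAll .tp (.ptr p)) (mvAll .tq (.ptr q))

theorem go_readLt (p q : Fin 6) (hpq : p ≠ q) (hp : ρ p < n) :
    Go (readLt p q) (asm n A st ρ F) (pushB (decide (ρ p < ρ q)) (asm n A st ρ F))
      (n * 15 + 5) := by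
  set s := asm n A st ρ F with hs
  have e₁ : s (.ptr p) = List.replicate (ρ p) none := rfl
  have e₂ : s (.ptr q) = List.replicate (ρ q) none := rfl
  have e₃ : s .tp = [] := rfl
  have e₄ : s .tq = [] := rfl
  set s₁ : Stk RegΓ := update (update (update (update s (.ptr p) []) .tp
    (List.replicate (ρ p) none)) (.ptr q) (List.replicate (ρ q - ρ p) none)) .tq
    (List.replicate (min (ρ p) (ρ q)) none) with hs₁
  have g₁ : Go (shift (.ptr p) .tp (.ptr q) .tq) s s₁ (ρ p * 7 + 1) := by
    have := @go_shift s s₁ (.ptr p) .tp (.ptr q) .tq (by simp [hpq]) (by simp [hs₁, hpq])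
      (by simp [hs₁, e₁, e₃]) (by simp [hs₁, e₁, e₂]) (by simp [hs₁, e₁, e₂, e₄])
      (fun x h₁ h₂ h₃ h₄ => by simp [hs₁, h₁, h₂, h₃, h₄])
    simpa [e₁] using this
  set b := decide (ρ p < ρ q) with hb
  -- Something is left on `ptr q` after removing `ρ p` letters exactly if `ρ p < ρ q`.
  have g₂ : Go (.case (.ptr q) fun x => .push .bs (some x.isSome)) s₁ (pushB b s₁) 2 := by
    refine Exec.case trivial ?_
    have : (s₁ (.ptr q)).head?.isSome = b := by
      by_cases h : ρ p < ρ q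
      · obtain ⟨m, hm⟩ : ∃ m, ρ q - ρ p = m + 1 := ⟨ρ q - ρ p - 1, by omega⟩
        simp [hs₁, hb, h, hm, List.replicate_succ]
      · simp [hs₁, hb, h, show ρ q - ρ p = 0 by omega]
    rw [this]
    exact go_push _ _ _
  set s₂ : Stk RegΓ := update (update (pushB b s₁) .tp []) (.ptr p) (List.replicate (ρ p) none)
    with hs₂
  have g₃ : Go (mvAll .tp (.ptr p)) (pushB b s₁) s₂ (ρ p * 4 + 1) := by
    have := @go_mvAll (pushB b s₁) s₂ .tp (.ptr p) (by simp) (by simp [hs₂])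
      (by simp [hs₂, hs₁, pushB, hpq]) (fun x h₁ h₂ => by simp [hs₂, h₁, h₂])
    simpa [pushB, hs₁] using this
  have g₄ : Go (mvAll .tq (.ptr q)) s₂ (pushB b s) (ρ p * 4 + 1) := by
    have := @go_mvAll s₂ (pushB b s) .tq (.ptr q) (by simp) (by simp [pushB, e₄])
      (by
        simp only [pushB, hs₂, hs₁]
        simp [hpq.symm, e₂]
        omega)
      (fun x h₁ h₂ => by
        by_cases h : x = .bs
        · subst h; simp [pushB, hs₂, hs₁]
        by_cases h₃ : x = .tp
        · subst h₃; simp [pushB, hs₂, e₃]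
        by_cases h₄ : x = .ptr p
        · subst h₄; simp [pushB, hs₂, e₁]
        simp [pushB, hs₁, hs₂, h₁, h₂, h₃, h₄, h])
    refine this.mono ?_
    simp [hs₂, hs₁, pushB]
  exact (g₁.seq (g₂.seq (g₃.seq g₄))).mono (by omega)

/-- Move the top row of the matrix to the stack `rev`. -/
def skipRow : Prog RegΓ :=
  .seq (mvWhile (fun x => x.any Option.isSome) .mat .rev) (mv .mat .rev)

theorem go_skipRow {s s' : Stk RegΓ} {r l : List (Option Bool)}
    (hs : s .mat = (r ++ [none]) ++ l) (hr : ∀ a ∈ r, a.isSome) (h₁ : s' .mat = l)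
    (h₂ : s' .rev = (r ++ [none]).reverse ++ s .rev)
    (h₃ : ∀ x, x ≠ .mat → x ≠ .rev → s' x = s x) : Go skipRow s s' (r.length * 4 + 4) := by
  set s₁ : Stk RegΓ := update (update s .mat (none :: l)) .rev (r.reverse ++ s .rev) with hs₁
  refine (Exec.seq (s' := s₁) (t := r.length * 4 + 1) (t' := 3) ?_ ?_).mono (by omega)
  · exact go_mvWhile (l := r) (r := none :: l) (by simp) (by rw [hs]; simp)
      (fun a ha => by simpa using hr a ha) (by simp) (by simp [hs₁]) (by simp [hs₁])
      (fun x hx hx' => by simp [hs₁, hx, hx'])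
  · refine go_mv_cons (a := none) (l := l) (by simp [hs₁]) (by simp) h₁ ?_ ?_
    · rw [h₂]; simp [hs₁]
    · intro x hx hx'; rw [h₃ x hx hx']; simp [hs₁, hx, hx']

/-- Evaluate `adj p q`. -/
def readAdj (p q : Fin 6) : Prog RegΓ :=
  .seq (.loop (.ptr p) Option.isSome (.seq (mv (.ptr p) .tp) skipRow)) <|
  .seq (shift (.ptr q) .tq .mat .rev) <|
  .seq (.case .mat fun
    | some a => .push .bs a
    | none => .skip) <|
  .seq (mvAll .tp (.ptr p)) <|
  .seq (mvAll .tq (.ptr q)) (mvAll .rev .mat)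

theorem length_flatMap_row (l : List ℕ) :
    (l.flatMap (row n A)).length = l.length * (n + 1) := by
  induction l with
  | nil => simp
  | cons a l ih => simp only [List.flatMap_cons, List.length_append, ih, row]; simp; ring

theorem go_readAdj (p q : Fin 6) (hpq : p ≠ q) (hp : ρ p < n) (hq : ρ q < n) :
    Go (readAdj p q) (asm n A st ρ F) (pushB (A (ρ p) (ρ q)) (asm n A st ρ F))
      (n * (n * 8 + 40) + 20) := by
  set s := asm n A st ρ F with hs
  set i := ρ p with hi
  set j := ρ q with hj
  have e₁ : s (.ptr p) = List.replicate i none := rfl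
  have e₂ : s (.ptr q) = List.replicate j none := rfl
  have e₃ : s .tp = [] := rfl
  have e₄ : s .tq = [] := rfl
  have e₅ : s .rev = [] := rfl
  have e₆ : s .mat = (List.range n).flatMap (row n A) := rfl
  -- `M i` collects the rows before row `i`, which move to `rev` in reversed order; `N i` collects
  -- the rows from `i` on, which stay on `mat`.
  set M : ℕ → List (Option Bool) := fun i => (List.range i).flatMap (row n A) with hM
  set N : ℕ → List (Option Bool) := fun i => (List.range' i (n - i)).flatMap (row n A) with hN
  have hMN : ∀ i ≤ n, M i ++ N i = (List.range n).flatMap (row n A) := by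
    intro i hi
    have := List.range'_append_1 (s := 0) (m := i) (n := n - i)
    rw [Nat.zero_add, Nat.add_sub_cancel' hi] at this
    rw [hM, hN, ← List.flatMap_append, List.range_eq_range', List.range_eq_range', this]
  have hNs : ∀ i < n, N i = row n A i ++ N (i + 1) := by
    intro i hi
    obtain ⟨m, hm⟩ : ∃ m, n - i = m + 1 := ⟨n - i - 1, by omega⟩
    simp only [hN]
    rw [hm, List.range'_succ, List.flatMap_cons, show n - (i + 1) = m by omega]
  have hMs : ∀ i, M (i + 1) = M i ++ row n A i := by
    intro i
    simp [hM, List.range_succ]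
  set f : ℕ → Stk RegΓ := fun a => update (update (update (update s (.ptr p)
    (List.replicate (i - a) none)) .tp (List.replicate a none)) .mat (N a)) .rev (M a).reverse
    with hf
  have f0 : f 0 = s := by
    funext x
    by_cases h₁ : x = .rev
    · subst h₁; simp [hf, hM, e₅]
    by_cases h₂ : x = .mat
    · subst h₂; simp [hf, hN, e₆, List.range_eq_range']
    by_cases h₃ : x = .tp
    · subst h₃; simp [hf, e₃]
    by_cases h₄ : x = .ptr p
    · subst h₄; simp [hf, e₁]
    simp [hf, h₁, h₂, h₃, h₄]
  have g₁ : Go (.loop (.ptr p) Option.isSome (.seq (mv (.ptr p) .tp) skipRow)) s (f i)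
      (i * (3 + (n * 4 + 4) + 1) + 1) := by
    rw [← f0]
    refine Exec.loop_count f i _ (fun _ _ => trivial) (fun a ha => ⟨?_, ?_⟩) ?_
    · obtain ⟨m, hm⟩ : ∃ m, i - a = m + 1 := ⟨i - a - 1, by omega⟩
      simp [hf, hm, List.replicate_succ]
    · obtain ⟨m, hm⟩ : ∃ m, i - a = m + 1 := ⟨i - a - 1, by omega⟩
      refine Exec.seq (s' := update (update (f a) (.ptr p) (List.replicate m none)) .tp
        (List.replicate (a + 1) none)) ?_ ?_
      · refine go_mv_cons (a := none) (l := List.replicate m none) ?_ (by simp) ?_ ?_ ?_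
        · simp [hf, hm, List.replicate_succ]
        · simp
        · simp [hf, List.replicate_succ]
        · intro x hx hx'; simp [hx, hx']
      · have := @go_skipRow (update (update (f a) (.ptr p) (List.replicate m none)) .tp
          (List.replicate (a + 1) none)) (f (a + 1)) ((List.range n).map fun j => some (A a j))
          (N (a + 1)) (by simp [hf, hNs a (by omega), row]) (by simp) (by simp [hf])
          (by simp [hf, hMs, row]) (fun x hx hx' => by
            by_cases h₃ : x = .tp
            · subst h₃; simp [hf]
            by_cases h₄ : x = .ptr p
            · subst h₄; simp [hf, show i - (a + 1) = m by omega]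
            simp [hf, hx, hx', h₃, h₄])
        simpa using this
    · simp [hf]
  set R : List (Option Bool) := (List.range n).map fun j => some (A i j) with hR
  have hRn : R.length = n := by simp [hR]
  have hNi : N i = R ++ none :: N (i + 1) := by rw [hNs i hp]; simp [row, hR]
  set s₁ : Stk RegΓ := update (update (update (update (f i) (.ptr q) []) .tq
    (List.replicate j none)) .mat ((N i).drop j)) .rev (((N i).take j).reverse ++ (M i).reverse)
    with hs₁
  have g₂ : Go (shift (.ptr q) .tq .mat .rev) (f i) s₁ (j * 7 + 1) := by
    have := @go_shift (f i) s₁ (.ptr q) .tq .mat .rev (by simp) (by simp [hs₁])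
      (by simp [hs₁, hf, hpq.symm, e₂, e₄]) (by simp [hs₁, hf, hpq.symm, e₂])
      (by simp [hs₁, hf, hpq.symm, e₂])
      (fun x h₁ h₂ h₃ h₄ => by simp [hs₁, h₁, h₂, h₃, h₄])
    simpa [hf, hpq.symm, e₂] using this
  set b := A i j with hb
  have g₃ : Go (.case .mat fun
      | some a => .push .bs a
      | none => .skip) s₁ (pushB b s₁) 2 := by
    refine Exec.case trivial ?_
    have : (s₁ .mat).head? = some (some b) := by
      have h1 : s₁ .mat = (N i).drop j := by simp [hs₁]
      rw [h1, hNi, List.drop_append_of_le_length (by omega), List.head?_append]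
      simp [hR, hq, hb]
    rw [this]
    exact go_push _ _ _
  set s₂ : Stk RegΓ := update (update (pushB b s₁) .tp []) (.ptr p) (List.replicate i none)
    with hs₂
  have g₄ : Go (mvAll .tp (.ptr p)) (pushB b s₁) s₂ (i * 4 + 1) := by
    have := @go_mvAll (pushB b s₁) s₂ .tp (.ptr p) (by simp) (by simp [hs₂])
      (by simp [hs₂, hs₁, hf, pushB, hpq]) (fun x h₁ h₂ => by simp [hs₂, h₁, h₂])
    simpa [pushB, hs₁, hf] using this
  set s₃ : Stk RegΓ := update (update s₂ .tq []) (.ptr q) (List.replicate j none)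
    with hs₃
  have g₅ : Go (mvAll .tq (.ptr q)) s₂ s₃ (j * 4 + 1) := by
    have := @go_mvAll s₂ s₃ .tq (.ptr q) (by simp) (by simp [hs₃])
      (by simp [hs₃, hs₂, hs₁, hf, pushB, hpq.symm])
      (fun x h₁ h₂ => by simp [hs₃, h₁, h₂])
    simpa [pushB, hs₁, hs₂, hf] using this
  have hlen : (s₃ .rev).length ≤ n * (n + 1) := by
    have : s₃ .rev = ((N i).take j).reverse ++ (M i).reverse := by
      simp [hs₃, hs₂, pushB, hs₁]
    rw [this]
    calc (((N i).take j).reverse ++ (M i).reverse).length ≤ (M i ++ N i).length := by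
          simp; omega
      _ = n * (n + 1) := by rw [hMN i hp.le, length_flatMap_row]; simp
  have g₆ : Go (mvAll .rev .mat) s₃ (pushB b s) (n * (n + 1) * 4 + 1) := by
    refine (@go_mvAll s₃ (pushB b s) .rev .mat (by simp) (by simp [pushB, e₅]) ?_ ?_).mono
      (by omega)
    · have h1 : s₃ .rev = ((N i).take j).reverse ++ (M i).reverse := by
        simp [hs₃, hs₂, pushB, hs₁]
      have h2 : s₃ .mat = (N i).drop j := by simp [hs₃, hs₂, pushB, hs₁]
      rw [h1, h2]
      simp [pushB, e₆, ← hMN i hp.le]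
    · intro x h₁ h₂
      by_cases h₃ : x = .ptr q
      · subst h₃; simp [pushB, hs₃, e₂]
      by_cases h₄ : x = .tq
      · subst h₄; simp [pushB, hs₃, e₄]
      by_cases h₅ : x = .ptr p
      · subst h₅; simp [pushB, hs₃, hs₂, h₃, e₁]
      by_cases h₆ : x = .tp
      · subst h₆; simp [pushB, hs₃, hs₂, e₃]
      by_cases h : x = .bs
      · subst h; simp [pushB, hs₃, hs₂, hs₁, hf]
      simp [pushB, hs₁, hs₂, hs₃, hf, h₁, h₂, h₃, h₄, h₅, h₆, h]
  refine (g₁.seq (g₂.seq (g₃.seq (g₄.seq (g₅.seq g₆))))).mono ?_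
  have : i * (3 + (n * 4 + 4) + 1) ≤ n * (3 + (n * 4 + 4) + 1) := Nat.mul_le_mul_right _ hp.le
  nlinarith

end

/-! ### Compilation of formulas and commands -/

/-- Pop a truth value and branch on it. -/
def popB (P Q : Prog RegΓ) : Prog RegΓ :=
  .case .bs fun
    | some (some true) => .seq (.pop .bs) P
    | _ => .seq (.pop .bs) Q

theorem go_popB {P Q : Prog RegΓ} {s s' : Stk RegΓ} {b : Bool} {t : ℕ}
    (h : Go (if b then P else Q) s s' t) : Go (popB P Q) (pushB b s) s' (t + 2) := by
  have hp : Go (.pop .bs) (pushB b s) s 1 := by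
    have := go_pop (pushB b s) .bs
    simpa [pushB] using this
  refine (Exec.case trivial (t := 1 + t) ?_).mono (by omega)
  rcases b with _ | _
  · simpa [pushB] using hp.seq h
  · simpa [pushB] using hp.seq h

/-- Replace the two topmost truth values by their combination. -/
def app2 (f : Bool → Bool → Bool) : Prog RegΓ :=
  popB (popB (.push .bs (some (f true true))) (.push .bs (some (f false true))))
    (popB (.push .bs (some (f true false))) (.push .bs (some (f false false))))

theorem go_app2 (f : Bool → Bool → Bool) (a b : Bool) (s : Stk RegΓ) :
    Go (app2 f) (pushB b (pushB a s)) (pushB (f a b) s) 5 := by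
  refine go_popB ?_
  cases b <;> refine go_popB ?_ <;> cases a <;> exact go_push _ _ _

/-- The program that evaluates a formula and pushes its truth value on the evaluation stack. -/
def Fm.comp : Fm → Prog RegΓ
  | .mem i p => readSet i p
  | .adj p q => readAdj p q
  | .lt p q => readLt p q
  | .nt φ => .seq φ.comp (popB (.push .bs (some false)) (.push .bs (some true)))
  | .bop f φ ψ => .seq φ.comp (.seq ψ.comp (app2 f))
  | .fold f b p φ => .seq (.push .bs (some b)) (forLoop p (.seq φ.comp (app2 f)))
  | .more p φ ψ =>
    .seq (.push .ct none) <|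
    .seq (forLoop p (.seq φ.comp (popB (.push .ct (some true)) .skip))) <|
    .seq (forLoop p (.seq ψ.comp (popB (.case .ct fun
      | some (some _) => .pop .ct
      | _ => .skip) .skip))) <|
    .seq (.case .ct fun
      | some (some _) => .push .bs (some true)
      | _ => .push .bs (some false)) <|
    .seq (.loop .ct (fun x => x.any Option.isSome) (.pop .ct)) (.pop .ct)

/-- The values of the pointers at a program point where exactly those in `B` are in use. -/
def Fits (n : ℕ) (B : Finset (Fin 6)) (ρ : Fin 6 → ℕ) : Prop :=
  ∀ p, if p ∈ B then ρ p < n else ρ p = 0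

theorem Fits.lt {n : ℕ} {B : Finset (Fin 6)} {ρ : Fin 6 → ℕ} (h : Fits n B ρ) {p : Fin 6}
    (hp : p ∈ B) : ρ p < n := by simpa [hp] using h p

theorem Fits.zero {n : ℕ} {B : Finset (Fin 6)} {ρ : Fin 6 → ℕ} (h : Fits n B ρ) {p : Fin 6}
    (hp : p ∉ B) : ρ p = 0 := by simpa [hp] using h p

theorem Fits.update {n : ℕ} {B : Finset (Fin 6)} {ρ : Fin 6 → ℕ} (h : Fits n B ρ) (p : Fin 6)
    {i : ℕ} (hi : i < n) : Fits n (insert p B) (update ρ p i) := by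
  intro q
  by_cases hq : q = p
  · subst hq; simpa using hi
  · simpa [hq] using h q

theorem countP_range_succ (p : ℕ → Bool) (i : ℕ) :
    (List.range (i + 1)).countP p = (List.range i).countP p + if p i then 1 else 0 := by
  simp [List.range_succ, List.countP_append, List.countP_singleton]

/-- A loop over all vertices whose body acts on the other stacks only. -/
theorem go_forLoop_frame {n : ℕ} {A : ℕ → ℕ → Bool} {ρ : Fin 6 → ℕ} {p : Fin 6} {P : Prog RegΓ}
    {T : ℕ} (hp : ρ p = 0) (st : ℕ → St) (F : ℕ → Stk RegΓ)
    (hb : ∀ i < n, Go P (asm n A (st i) (update ρ p i) (F i))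
      (asm n A (st (i + 1)) (update ρ p i) (F (i + 1))) T) :
    Go (forLoop p P) (asm n A (st 0) ρ (F 0)) (asm n A (st n) ρ (F n)) (n * (T + 8) + 2) := by
  have := go_forLoop (n := n) (p := p) (P := P) (T := T) (fun i => asm n A (st i) ρ (F i))
    (fun i hi => by simpa only [asm_atPtr] using hb i hi)
  simpa only [asm_atPtr_zero hp] using this

/-- Evaluation restores the memory up to one truth value on `bs`, which makes it compositional. The
bound depends on the formula and `n` only, since every quantifier runs through the `n` vertices. -/
theorem Fm.go_comp (φ : Fm) (B : Finset (Fin 6)) (hφ : φ.WF B) :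
    ∃ T, PolyB T ∧ ∀ (n : ℕ) (A : ℕ → ℕ → Bool) (st : St) (ρ : Fin 6 → ℕ) (F : Stk RegΓ),
      Fits n B ρ → Go φ.comp (asm n A st ρ F)
        (asm n A st ρ (pushB (φ.eval n A st.set ρ) F)) (T n) := by
  induction φ generalizing B with
  | mem i p =>
    refine ⟨fun n => n * 14 + 4, (PolyB.id.mul (.const 14)).add (.const 4), ?_⟩
    intro n A st ρ F hρ
    rw [asm_pushB]
    exact go_readSet i p (hρ.lt hφ)
  | adj p q =>
    refine ⟨fun n => n * (n * 8 + 40) + 20,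
      (PolyB.id.mul ((PolyB.id.mul (.const 8)).add (.const 40))).add (.const 20), ?_⟩
    intro n A st ρ F hρ
    rw [asm_pushB]
    exact go_readAdj p q hφ.2.2 (hρ.lt hφ.1) (hρ.lt hφ.2.1)
  | lt p q =>
    refine ⟨fun n => n * 15 + 5, (PolyB.id.mul (.const 15)).add (.const 5), ?_⟩
    intro n A st ρ F hρ
    rw [asm_pushB]
    exact go_readLt p q hφ.2.2 (hρ.lt hφ.1)
  | nt φ ih =>
    obtain ⟨T, hT, h⟩ := ih B hφ
    refine ⟨fun n => T n + 3, hT.add (.const 3), fun n A st ρ F hρ => ?_⟩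
    refine (h n A st ρ F hρ).seq ?_
    rw [asm_pushB, asm_pushB]
    refine go_popB ?_
    simp only [Fm.eval]
    cases φ.eval n A st.set ρ <;> exact go_push _ _ _
  | bop f φ ψ ih₁ ih₂ =>
    obtain ⟨T₁, hT₁, h₁⟩ := ih₁ B hφ.1
    obtain ⟨T₂, hT₂, h₂⟩ := ih₂ B hφ.2
    refine ⟨fun n => T₁ n + (T₂ n + 5), hT₁.add (hT₂.add (.const 5)), fun n A st ρ F hρ => ?_⟩
    refine (h₁ n A st ρ F hρ).seq ((h₂ n A st ρ _ hρ).seq ?_)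
    simp only [asm_pushB]
    exact go_app2 _ _ _ _
  | fold f b p φ ih =>
    obtain ⟨T, hT, h⟩ := ih _ hφ.2
    refine ⟨fun n => 1 + (n * (T n + 5 + 8) + 2), (PolyB.const 1).add
      ((PolyB.id.mul ((hT.add (.const 5)).add (.const 8))).add (.const 2)),
      fun n A st ρ F hρ => ?_⟩
    set c : ℕ → Bool := fun i =>
      (List.range i).foldl (fun c u => f c (φ.eval n A st.set (update ρ p u))) b with hc
    refine Exec.seq (s' := asm n A st ρ (pushB (c 0) F)) ?_ ?_
    · rw [asm_pushB]; exact go_push _ _ _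
    · refine go_forLoop_frame (hρ.zero hφ.1) (fun _ => st) (fun i => pushB (c i) F) fun i hi => ?_
      refine (h n A st _ _ (hρ.update p hi)).seq ?_
      have : c (i + 1) = f (c i) (φ.eval n A st.set (update ρ p i)) := by
        simp [hc, List.range_succ]
      rw [this]
      simp only [asm_pushB]
      exact go_app2 _ _ _ _
  | more p φ ψ ih₁ ih₂ =>
    obtain ⟨T₁, hT₁, h₁⟩ := ih₁ _ hφ.2.1
    obtain ⟨T₂, hT₂, h₂⟩ := ih₂ _ hφ.2.2
    refine ⟨fun n => 1 + ((n * (T₁ n + 3 + 8) + 2) + ((n * (T₂ n + 4 + 8) + 2) +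
      (2 + ((n * 2 + 1) + 1)))), ?_, fun n A st ρ F hρ => ?_⟩
    · exact (PolyB.const 1).add
        (((PolyB.id.mul ((hT₁.add (.const 3)).add (.const 8))).add (.const 2)).add
        (((PolyB.id.mul ((hT₂.add (.const 4)).add (.const 8))).add (.const 2)).add
        ((PolyB.const 2).add (((PolyB.id.mul (.const 2)).add (.const 1)).add (.const 1)))))
    have hp := hρ.zero hφ.1
    -- A unary counter on top of a marker `none`, which protects the counters of enclosing
    -- comparisons.
    set cnt : ℕ → Stk RegΓ := fun m =>
      update F .ct (List.replicate m (some true) ++ none :: F .ct) with hcnt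
    have cnt_ct : ∀ m, asm n A st ρ (cnt m) .ct =
      List.replicate m (some true) ++ none :: F .ct := by intro m; simp [asm, hcnt]
    set a : ℕ → ℕ := fun i =>
      (List.range i).countP (fun u => φ.eval n A st.set (update ρ p u)) with ha
    set b : ℕ → ℕ := fun i =>
      (List.range i).countP (fun u => ψ.eval n A st.set (update ρ p u)) with hb
    have han : a n ≤ n := by
      simpa [ha] using
        List.countP_le_length (p := fun u => φ.eval n A st.set (update ρ p u)) (l := List.range n)
    refine Exec.seq (s' := asm n A st ρ (cnt (a 0))) ?_ <|
      Exec.seq (s' := asm n A st ρ (cnt (a n))) ?_ <|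
      Exec.seq (s' := asm n A st ρ (cnt (a n - b n))) ?_ <|
      Exec.seq (s' := asm n A st ρ (pushB (decide (b n < a n)) (cnt (a n - b n)))) ?_ <|
      Exec.seq (s' := asm n A st ρ (pushB (decide (b n < a n)) (cnt 0))) ?_ ?_
    · simp only [ha, hcnt, asm_update_ct]
      exact go_push _ _ _
    · refine go_forLoop_frame hp (fun _ => st) (fun i => cnt (a i)) fun i hi => ?_
      refine (h₁ n A st _ _ (hρ.update p hi)).seq ?_
      rw [asm_pushB]
      refine go_popB (t := 1) ?_
      have hs := countP_range_succ (fun u => φ.eval n A st.set (update ρ p u)) i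
      have : a (i + 1) = a i + if φ.eval n A st.set (update ρ p i) then 1 else 0 := hs
      rw [this]
      rcases φ.eval n A st.set (update ρ p i) with _ | _
      · exact go_skip _
      · simp only [hcnt, asm_update_ct, if_true]
        have := go_push (update (asm n A st (update ρ p i) F) .ct
          (List.replicate (a i) (some true) ++ none :: F .ct)) .ct (some true)
        simpa [List.replicate_succ] using this
    -- Popping stops at the marker, so the counter follows truncated subtraction; what remains at
    -- the end is positive exactly if `b n < a n`.
    · refine go_forLoop_frame hp (fun _ => st) (fun i => cnt (a n - b i)) fun i hi => ?_
      refine (h₂ n A st _ _ (hρ.update p hi)).seq ?_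
      rw [asm_pushB]
      refine go_popB (t := 2) ?_
      have hs := countP_range_succ (fun u => ψ.eval n A st.set (update ρ p u)) i
      have : b (i + 1) = b i + if ψ.eval n A st.set (update ρ p i) then 1 else 0 := hs
      rw [this]
      rcases ψ.eval n A st.set (update ρ p i) with _ | _
      · exact (go_skip _).mono (by omega)
      · refine Exec.case trivial ?_
        simp only [hcnt, asm_update_ct, if_true]
        rcases hm : a n - b i with _ | m
        · rw [show a n - (b i + 1) = 0 by omega]
          simpa using go_skip _
        · rw [show a n - (b i + 1) = m by omega]
          have := go_pop (update (asm n A st (update ρ p i) F) .ct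
            (List.replicate (m + 1) (some true) ++ none :: F .ct)) .ct
          simpa [List.replicate_succ] using this
    · refine Exec.case trivial ?_
      rw [asm_pushB, cnt_ct]
      rcases hm : a n - b n with _ | m
      · rw [show decide (b n < a n) = false by simp; omega]
        exact go_push _ _ _
      · rw [show decide (b n < a n) = true by simp; omega]
        exact go_push _ _ _
    · simp only [asm_pushB]
      have : ∀ m, Go (.loop .ct (fun x => x.any Option.isSome) (.pop .ct))
          (pushB (decide (b n < a n)) (asm n A st ρ (cnt m)))
          (pushB (decide (b n < a n)) (asm n A st ρ (cnt 0))) (m * 2 + 1) := by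
        intro m
        induction m with
        | zero => exact (Exec.loop_done trivial (by simp [pushB, cnt_ct])).mono (by omega)
        | succ m ih =>
          refine (Exec.loop_step trivial (by simp [pushB, cnt_ct, List.replicate_succ])
            (t := 1) ?_ ih).mono (by omega)
          have := go_pop (pushB (decide (b n < a n)) (asm n A st ρ (cnt (m + 1)))) .ct
          convert this using 1
          simp only [pushB, hcnt, asm_update_ct]
          funext x
          by_cases h₁ : x = .bs
          · subst h₁; simp
          by_cases h₂ : x = .ct
          · subst h₂; simp [List.replicate_succ]
          simp [h₁, h₂]
      exact (this _).mono (by omega)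
    · simp only [asm_pushB]
      have := go_pop (pushB (decide (b n < a n)) (asm n A st ρ (cnt 0))) .ct
      convert this using 1
      simp only [pushB, hcnt, asm_update_ct]
      funext x
      by_cases h₁ : x = .bs
      · subst h₁; simp [hb, ha, Fm.eval]
      by_cases h₂ : x = .ct
      · subst h₂; simp; simp [asm]
      simp [h₁, h₂]

/-- The program of a command. -/
def Cmd.comp : Cmd → Prog RegΓ
  | .skip => .skip
  | .seq c d => .seq c.comp d.comp
  | .assign i p φ => .seq (forLoop p φ.comp) (.seq (clear (.set i)) (forLoop p (mv .bs (.set i))))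
  | .bit c d => .case .tape fun
    | some (some true) => .seq (.pop .tape) c.comp
    | _ => .seq (.pop .tape) d.comp
  | .cond φ c d => .seq φ.comp (popB c.comp d.comp)
  | .emit φ => .seq φ.comp (popB (.push .out (some true)) (.push .out (some false)))
  | .sep => .push .out none
  | .loop p c => forLoop p c.comp

/-- Only the tops of the tape and of the output are ever touched, so the bound is independent of
their lengths. -/
theorem Cmd.go_comp (c : Cmd) (B : Finset (Fin 6)) (hc : c.WF B) :
    ∃ T, PolyB T ∧ ∀ (n : ℕ) (A : ℕ → ℕ → Bool) (st : St) (ρ : Fin 6 → ℕ) (F : Stk RegΓ),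
      Fits n B ρ → Go c.comp (asm n A st ρ F) (asm n A (c.eval n A ρ st) ρ F) (T n) := by
  induction c generalizing B with
  | skip => exact ⟨_, .const 1, fun n A st ρ F _ => go_skip _⟩
  | seq c d ih₁ ih₂ =>
    obtain ⟨T₁, hT₁, h₁⟩ := ih₁ B hc.1
    obtain ⟨T₂, hT₂, h₂⟩ := ih₂ B hc.2
    exact ⟨_, hT₁.add hT₂, fun n A st ρ F hρ => (h₁ n A st ρ F hρ).seq (h₂ n A _ ρ F hρ)⟩
  | assign i p φ =>
    obtain ⟨T, hT, h⟩ := φ.go_comp _ hc.2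
    refine ⟨fun n => (n * (T n + 8) + 2) + ((n * 2 + 1) + (n * (3 + 8) + 2)),
      ((PolyB.id.mul (hT.add (.const 8))).add (.const 2)).add
        (((PolyB.id.mul (.const 2)).add (.const 1)).add
          ((PolyB.id.mul (.const 11)).add (.const 2))), fun n A st ρ F hρ => ?_⟩
    have hp := hρ.zero hc.1
    set v : ℕ → Bool := fun u => φ.eval n A st.set (update ρ p u) with hv
    -- All new values are collected on `bs` before the old set is cleared, since `φ` may refer to
    -- the set `i`. Moving them back from `bs` undoes their reversal.
    set G : ℕ → Stk RegΓ := fun m =>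
      update F .bs (((List.range m).map fun u => some (v u)).reverse ++ F .bs) with hG
    have hG0 : G 0 = F := by simp [hG]
    set L : ℕ → List (Option Bool) := fun m => (List.range' (n - m) m).map fun u => some (v u)
      with hL
    set s : ℕ → Stk RegΓ := fun m =>
      update (asm n A st ρ (G (n - m))) (.set i) (L m) with hs
    have hs0 : s 0 = update (asm n A st ρ (G n)) (.set i) [] := by simp [hs, hL]
    have hsn : s n = asm n A ((Cmd.assign i p φ).eval n A ρ st) ρ F := by
      simp only [hs, Nat.sub_self, hG0]
      symm
      refine eq_update_iff.2 ⟨?_, fun x hx => ?_⟩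
      · simp [asm, Cmd.eval, hL, List.range_eq_range', hv]
      · cases x with
        | set j => have : j ≠ i := fun e => hx (by rw [e]); simp [asm, Cmd.eval, this]
        | _ => rfl
    have hat : ∀ m, s m = atPtr n p 0 (s m) := by
      intro m
      have h₁ : s m (.ptr p) = List.replicate 0 none := by simp [hs, asm, hp]
      have h₂ : s m (.cop p) = List.replicate (n - 0) none := by simp [hs, asm, hp]
      rw [atPtr, ← h₁, update_eq_self, ← h₂, update_eq_self]
    refine Exec.seq (s' := asm n A st ρ (G n)) ?_ <| Exec.seq (s' := s 0) ?_ ?_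
    · rw [← hG0]
      nth_rw 1 [show G 0 = G 0 from rfl]
      refine go_forLoop_frame hp (fun _ => st) G fun m hm => ?_
      have := h n A st (update ρ p m) (G m) (hρ.update p hm)
      convert this using 2
      simp [pushB, hG, List.range_succ, hv]
    · rw [hs0]
      refine (go_clear _ _).mono ?_
      simp [asm]
    · rw [← hsn, hat 0, hat n]
      refine go_forLoop (n := n) (p := p) s fun m hm => ?_
      refine go_mv_cons (a := some (v (n - (m + 1))))
        (l := ((List.range (n - (m + 1))).map fun u => some (v u)).reverse ++ F .bs) ?_
        (by simp) ?_ ?_ ?_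
      · have : n - m = n - (m + 1) + 1 := by omega
        simp [atPtr, hs, asm, hG, this, List.range_succ]
      · simp [atPtr, hs, asm, hG]
      · simp only [atPtr, hs, hL]
        have : n - m = n - (m + 1) + 1 := by omega
        simp [this, List.range'_succ]
      · intro x hx hx'
        simp only [atPtr, hs]
        by_cases h₁ : x = .cop p
        · subst h₁; simp
        by_cases h₂ : x = .ptr p
        · subst h₂; simp
        simp only [ne_eq, h₁, h₂, hx', not_false_eq_true, update_of_ne]
        cases x <;> simp_all [asm]
  | bit c d ih₁ ih₂ =>
    obtain ⟨T₁, hT₁, h₁⟩ := ih₁ B hc.1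
    obtain ⟨T₂, hT₂, h₂⟩ := ih₂ B hc.2
    refine ⟨fun n => T₁ n + T₂ n + 2, (hT₁.add hT₂).add (.const 2), fun n A st ρ F hρ => ?_⟩
    have hpop : Go (.pop .tape) (asm n A st ρ F)
        (asm n A { st with tape := st.tape.tail } ρ F) 1 := by
      have := go_pop (asm n A st ρ F) .tape
      convert this using 1
      refine eq_update_iff.2 ⟨?_, fun x hx => ?_⟩
      · simp [asm]
      · cases x <;> first | rfl | exact absurd rfl hx
    refine (Exec.case trivial (t := 1 + (T₁ n + T₂ n)) ?_).mono (by dsimp only; omega)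
    have hh : (asm n A st ρ F .tape).head? = st.tape.head?.map some := by
      simp [asm]
    rw [hh, Cmd.eval]
    rcases st.tape.head? with _ | b
    · exact hpop.seq ((h₂ n A _ ρ F hρ).mono (by omega))
    · rcases b with _ | _
      · exact hpop.seq ((h₂ n A _ ρ F hρ).mono (by omega))
      · exact hpop.seq ((h₁ n A _ ρ F hρ).mono (by omega))
  | cond φ c d ih₁ ih₂ =>
    obtain ⟨T, hT, h⟩ := φ.go_comp B hc.1
    obtain ⟨T₁, hT₁, h₁⟩ := ih₁ B hc.2.1
    obtain ⟨T₂, hT₂, h₂⟩ := ih₂ B hc.2.2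
    refine ⟨fun n => T n + (T₁ n + T₂ n + 2), hT.add ((hT₁.add hT₂).add (.const 2)),
      fun n A st ρ F hρ => ?_⟩
    refine (h n A st ρ F hρ).seq ?_
    rw [asm_pushB]
    refine go_popB ?_
    rw [Cmd.eval]
    rcases φ.eval n A st.set ρ with _ | _
    · exact (h₂ n A _ ρ F hρ).mono (by omega)
    · exact (h₁ n A _ ρ F hρ).mono (by omega)
  | emit φ =>
    obtain ⟨T, hT, h⟩ := φ.go_comp B hc
    refine ⟨fun n => T n + 3, hT.add (.const 3), fun n A st ρ F hρ => ?_⟩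
    refine (h n A st ρ F hρ).seq ?_
    rw [asm_pushB]
    refine go_popB (t := 1) ?_
    have : asm n A ((Cmd.emit φ).eval n A ρ st) ρ F = update (asm n A st ρ F) .out
        (some (φ.eval n A st.set ρ) :: asm n A st ρ F .out) := by
      refine eq_update_iff.2 ⟨rfl, fun x hx => ?_⟩
      cases x <;> first | rfl | exact absurd rfl hx
    rw [this]
    cases φ.eval n A st.set ρ <;> exact go_push _ _ _
  | sep =>
    refine ⟨_, .const 1, fun n A st ρ F _ => ?_⟩
    have : asm n A (Cmd.sep.eval n A ρ st) ρ F = update (asm n A st ρ F) .out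
        (none :: asm n A st ρ F .out) := by
      refine eq_update_iff.2 ⟨rfl, fun x hx => ?_⟩
      cases x <;> first | rfl | exact absurd rfl hx
    rw [this]
    exact go_push _ _ _
  | loop p c ih =>
    obtain ⟨T, hT, h⟩ := ih _ hc.2
    refine ⟨fun n => n * (T n + 8) + 2, (PolyB.id.mul (hT.add (.const 8))).add (.const 2),
      fun n A st ρ F hρ => ?_⟩
    refine go_forLoop_frame (hρ.zero hc.1) (fun i =>
      (List.range i).foldl (fun st i => c.eval n A (update ρ p i) st) st) (fun _ => F)
      fun i hi => ?_
    have := h n A ((List.range i).foldl (fun st i => c.eval n A (update ρ p i) st) st)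
      (update ρ p i) F (hρ.update p hi)
    convert this using 2
    simp [List.range_succ]

/-! ### Split graphs and their forbidden subgraphs -/

section Graph

variable {V : Type*} {G : SimpleGraph V}

/-- The five vertices (not all of which need be distinct) span `2K₂`, `C₄` or `C₅`. -/
def Bad (G : SimpleGraph V) (a b c d e : V) : Prop :=
  (G.Adj a b ∧ G.Adj c d ∧ ¬ G.Adj a c ∧ ¬ G.Adj a d ∧ ¬ G.Adj b c ∧ ¬ G.Adj b d) ∨
  (G.Adj a b ∧ G.Adj b c ∧ G.Adj c d ∧ G.Adj d a ∧ ¬ G.Adj a c ∧ ¬ G.Adj b d ∧ a ≠ c ∧ b ≠ d) ∨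
  (G.Adj a b ∧ G.Adj b c ∧ G.Adj c d ∧ G.Adj d e ∧ G.Adj e a ∧ ¬ G.Adj a c ∧ ¬ G.Adj a d ∧
    ¬ G.Adj b d ∧ ¬ G.Adj b e ∧ ¬ G.Adj c e)

/-- A bad tuple is not covered by a clique and an independent set. -/
theorem Bad.not_covered {a b c d e : V} (h : Bad G a b c d e) {C I : Set V} (hC : G.IsClique C)
    (hI : G.IsIndepSet I) : ¬ ∀ x, x = a ∨ x = b ∨ x = c ∨ x = d ∨ x = e → x ∈ C ∨ x ∈ I := by
  intro hx
  have ha := hx a (by simp)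
  have hb := hx b (by simp)
  have hc := hx c (by simp)
  have hd := hx d (by simp)
  have he := hx e (by simp)
  have kC : ∀ {u v}, u ∈ C → v ∈ C → ¬ G.Adj u v → u = v := fun hu hv hn => by
    by_contra hne; exact hn (hC hu hv hne)
  have kI : ∀ {u v}, u ∈ I → v ∈ I → G.Adj u v → False := fun hu hv hn =>
    hI hu hv hn.ne hn
  have irr : ∀ u, ¬ G.Adj u u := fun u => G.irrefl
  rcases h with ⟨h₁, h₂, h₃, h₄, h₅, h₆⟩ | ⟨h₁, h₂, h₃, h₄, h₅, h₆, h₇, h₈⟩ |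
    ⟨h₁, h₂, h₃, h₄, h₅, h₆, h₇, h₈, h₉, h₁₀⟩
  · rcases ha with ha | ha <;> rcases hb with hb | hb
    · rcases hc with hc | hc
      · have := kC ha hc h₃; subst this; exact h₄ h₂
      · rcases hd with hd | hd
        · have := kC ha hd h₄; subst this; exact h₃ h₂.symm
        · exact kI hc hd h₂
    · rcases hc with hc | hc
      · have := kC ha hc h₃; subst this; exact h₄ h₂
      · rcases hd with hd | hd
        · have := kC ha hd h₄; subst this; exact h₃ h₂.symm
        · exact kI hc hd h₂
    · rcases hc with hc | hc
      · have := kC hb hc h₅; subst this; exact h₆ h₂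
      · rcases hd with hd | hd
        · have := kC hb hd h₆; subst this; exact h₅ h₂.symm
        · exact kI hc hd h₂
    · exact kI ha hb h₁
  · rcases ha with ha | ha
    · rcases hc with hc | hc
      · exact h₇ (kC ha hc h₅)
      · rcases hb with hb | hb
        · rcases hd with hd | hd
          · exact h₈ (kC hb hd h₆)
          · exact kI hc hd h₃
        · exact kI hb hc h₂
    · rcases hb with hb | hb
      · rcases hd with hd | hd
        · exact h₈ (kC hb hd h₆)
        · exact kI hd ha h₄
      · exact kI ha hb h₁
  · have nac : a ≠ c := fun h => by subst h; exact h₇ h₃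
    have nad : a ≠ d := fun h => by subst h; exact h₆ h₃.symm
    have nbe : b ≠ e := fun h => by subst h; exact h₈ h₄.symm
    -- For `C₅`: if `a` is in the clique, its non-neighbours `c` and `d` are both independent but
    -- adjacent; if `a` is in the independent set, its neighbours `b` and `e` are both in the clique
    -- but non-adjacent.
    rcases ha with ha | ha
    · exact kI (hc.resolve_left fun h => nac (kC ha h h₆))
        (hd.resolve_left fun h => nad (kC ha h h₇)) h₃
    · exact nbe (kC (hb.resolve_right fun h => kI ha h h₁) (he.resolve_right fun h => kI h ha h₅) h₉)

/-! ### Split partitions: absence of bad tuples and degree thresholds -/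

open Classical in
/-- The degree inside a set of vertices. -/
noncomputable def degIn (G : SimpleGraph V) (W : Finset V) (v : V) : ℕ :=
  (W.filter fun u => G.Adj v u).card

open Classical in
-- The exchange of `a` for `x`. It serves both to compare degree sums and to build a larger clique
-- out of an exchange by two vertices.
theorem clique_insert_erase {C : Finset V} (hC : G.IsClique (C : Set V)) {x a : V}
    (hx : ∀ c ∈ C, c ≠ a → G.Adj x c) : G.IsClique (insert x (C.erase a) : Finset V) := by
  rw [Finset.coe_insert, SimpleGraph.isClique_insert]
  refine ⟨hC.subset (by intro u hu; exact Finset.mem_of_mem_erase (Finset.mem_coe.1 hu)), fun c hc _ => ?_⟩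
  have hc' : c ≠ a ∧ c ∈ C := Finset.mem_erase.1 (Finset.mem_coe.1 hc)
  exact hx c hc'.2 hc'.1

/-- A graph without bad tuples is split, and the clique can be chosen maximal. -/
theorem exists_split_of_no_bad (W : Finset V)
    (hW : ∀ a ∈ W, ∀ b ∈ W, ∀ c ∈ W, ∀ d ∈ W, ∀ e ∈ W, ¬ Bad G a b c d e) :
    ∃ C ⊆ W, G.IsClique (C : Set V) ∧ (∀ u ∈ W, u ∉ C → ∀ v ∈ W, v ∉ C → ¬ G.Adj u v) ∧
      ∀ v ∈ W, v ∉ C → ∃ c ∈ C, ¬ G.Adj v c := by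
  classical
  -- A clique of maximum size and, among those, of maximum degree sum. The second criterion provides
  -- the vertex `z` in `core`.
  obtain ⟨C, hCm, hmin⟩ := Finset.exists_max_image
    (W.powerset.filter fun C : Finset V => G.IsClique (C : Set V))
    (fun C : Finset V => toLex (C.card, ∑ c ∈ C, degIn G W c)) ⟨∅, by simp⟩
  simp only [Finset.mem_filter, Finset.mem_powerset] at hCm hmin
  obtain ⟨hCW, hC⟩ := hCm
  have hcard : ∀ D ⊆ W, G.IsClique (D : Set V) → D.card ≤ C.card := by
    intro D hD hDc
    have := hmin D ⟨hD, hDc⟩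
    rw [Prod.Lex.le_iff] at this
    rcases this with h | h
    · exact h.le
    · exact h.1.le
  have hdeg : ∀ D ⊆ W, G.IsClique (D : Set V) → D.card = C.card →
      ∑ c ∈ D, degIn G W c ≤ ∑ c ∈ C, degIn G W c := by
    intro D hD hDc hDC
    have := hmin D ⟨hD, hDc⟩
    rw [Prod.Lex.le_iff] at this
    rcases this with h | h
    · exact absurd h (by simp [hDC])
    · exact h.2
  have hmax : ∀ v ∈ W, v ∉ C → ∃ c ∈ C, ¬ G.Adj v c := by
    intro v hv hvC
    by_contra! hcon
    have h₁ : G.IsClique (insert v C : Finset V) := by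
      rw [Finset.coe_insert, SimpleGraph.isClique_insert]
      exact ⟨hC, fun c hc _ => hcon c hc⟩
    have := hcard _ (Finset.insert_subset hv hCW) h₁
    rw [Finset.card_insert_of_notMem hvC] at this
    omega
  have adjC : ∀ u ∈ C, ∀ v ∈ C, u ≠ v → G.Adj u v := fun u hu v hv h => hC hu hv h
  -- First, `x` misses only `a` in `C`: another missed `c` gives the `C₄` on `x, y, c, b` or the
  -- `2K₂` on `xy, ac`. So exchanging `a` for `x` gives another maximum clique, and `x` has at most
  -- the degree of `a`. As `y` is adjacent to `x` but not to `a`, some neighbour `z` of `a` is not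
  -- adjacent to `x`. Now `yz` is an edge, for otherwise `xy, az` is a `2K₂`; and `z, b` adjacent or
  -- not gives `C₄` or `C₅`.
  have core : ∀ x ∈ W, x ∉ C → ∀ y ∈ W, y ∉ C → G.Adj x y → ∀ a ∈ C, ∀ b ∈ C, a ≠ b →
      ¬ G.Adj x a → ¬ G.Adj y b → G.Adj x b → ¬ G.Adj y a → False := by
    intro x hx hxC y hy hyC hxy a ha b hb hab hxa hyb hxb hya
    have haW := hCW ha
    have hbW := hCW hb
    have hN : ∀ c ∈ C, c ≠ a → G.Adj x c := by
      intro c hc hca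
      by_contra hxc
      have hcb : c ≠ b := fun h => hxc (h ▸ hxb)
      by_cases hyc : G.Adj y c
      · exact hW x hx y hy c (hCW hc) b hbW b hbW (Or.inr (Or.inl ⟨hxy, hyc, adjC c hc b hb hcb,
          hxb.symm, hxc, hyb, fun h => hxC (h ▸ hc), fun h => hyC (h ▸ hb)⟩))
      · exact hW x hx y hy a haW c (hCW hc) c (hCW hc) (Or.inl ⟨hxy, adjC a ha c hc hca.symm,
          hxa, hxc, hya, hyc⟩)
    have hxe : x ∉ C.erase a := fun h => hxC (Finset.mem_of_mem_erase h)
    have hle := hdeg (insert x (C.erase a))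
      (Finset.insert_subset hx ((Finset.erase_subset _ _).trans hCW))
      (clique_insert_erase hC hN)
      (by rw [Finset.card_insert_of_notMem hxe, Finset.card_erase_add_one ha])
    rw [Finset.sum_insert hxe, ← Finset.add_sum_erase _ _ ha] at hle
    have hle' : degIn G W x ≤ degIn G W a := by omega
    obtain ⟨z, hz, hzx⟩ : ∃ z ∈ W.filter (fun u => G.Adj a u), ¬ G.Adj x z := by
      by_contra! hcon
      have : (W.filter fun u => G.Adj a u) ⊂ W.filter fun u => G.Adj x u := by
        refine Finset.ssubset_iff_of_subset ?_ |>.2 ⟨y, by simp [hy, hxy], ?_⟩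
        · intro z hz
          have := hcon z hz
          simp only [Finset.mem_filter] at hz ⊢
          exact ⟨hz.1, this⟩
        · simp only [Finset.mem_filter, not_and]
          exact fun _ h => hya h.symm
      exact absurd (Finset.card_lt_card this) (by unfold degIn at hle'; omega)
    simp only [Finset.mem_filter] at hz
    obtain ⟨hzW, haz⟩ := hz
    have hzC : z ∉ C := fun h => hzx (hN z h haz.ne')
    have hyz : G.Adj y z := by
      by_contra hyz
      exact hW x hx y hy a haW z hzW z hzW (Or.inl ⟨hxy, haz, hxa, hzx, hya, hyz⟩)
    by_cases hbz : G.Adj z b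
    · exact hW x hx y hy z hzW b hbW b hbW (Or.inr (Or.inl ⟨hxy, hyz, hbz, hxb.symm, hzx, hyb,
        fun h => hxa (h ▸ haz.symm), fun h => hyC (h ▸ hb)⟩))
    · exact hW a haW z hzW y hy x hx b hbW (Or.inr (Or.inr ⟨haz, hyz.symm, hxy.symm, hxb,
        (adjC a ha b hb hab).symm, fun h => hya h.symm, fun h => hxa h.symm,
        fun h => hzx h.symm, hbz, hyb⟩))
  refine ⟨C, hCW, hC, fun x hx hxC y hy hyC hxy => ?_, hmax⟩
  -- If the missed vertices cannot be chosen distinct, then `x` and `y` both miss exactly one and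
  -- the same `a`, and replacing `a` by the edge `xy` enlarges the clique.
  obtain ⟨a, b, ha, hb, hxa, hyb, hab⟩ : ∃ a b, a ∈ C ∧ b ∈ C ∧ ¬ G.Adj x a ∧ ¬ G.Adj y b ∧
      a ≠ b := by
    obtain ⟨a, ha, hxa⟩ := hmax x hx hxC
    obtain ⟨b, hb, hyb⟩ := hmax y hy hyC
    by_contra! hcon
    have hab := hcon a b ha hb hxa hyb
    subst hab
    have hNx : ∀ c ∈ C, c ≠ a → G.Adj x c := fun c hc hca => by
      by_contra h
      exact hca (hcon c a hc ha h hyb)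
    have hNy : ∀ c ∈ C, c ≠ a → G.Adj y c := fun c hc hca => by
      by_contra h
      exact hca (hcon a c ha hc hxa h).symm
    have hxe : x ∉ C.erase a := fun h => hxC (Finset.mem_of_mem_erase h)
    have hye : y ∉ insert x (C.erase a) := by
      rw [Finset.mem_insert, not_or]
      exact ⟨hxy.ne', fun h => hyC (Finset.mem_of_mem_erase h)⟩
    have h₁ : G.IsClique (insert y (insert x (C.erase a)) : Finset V) := by
      rw [Finset.coe_insert, SimpleGraph.isClique_insert]
      refine ⟨clique_insert_erase hC hNx, fun c hc _ => ?_⟩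
      rw [Finset.mem_coe, Finset.mem_insert] at hc
      rcases hc with rfl | hc
      · exact hxy.symm
      · exact hNy c (Finset.mem_of_mem_erase hc) (Finset.ne_of_mem_erase hc)
    have := hcard _ (Finset.insert_subset hy (Finset.insert_subset hx
      ((Finset.erase_subset _ _).trans hCW))) h₁
    rw [Finset.card_insert_of_notMem hye, Finset.card_insert_of_notMem hxe,
      Finset.card_erase_add_one ha] at this
    omega
  have haW := hCW ha
  have hbW := hCW hb
  by_cases hxb : G.Adj x b <;> by_cases hya : G.Adj y a
  · exact hW x hx y hy a haW b hbW b hbW (Or.inr (Or.inl ⟨hxy, hya, adjC a ha b hb hab, hxb.symm,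
      hxa, hyb, fun h => hxC (h ▸ ha), fun h => hyC (h ▸ hb)⟩))
  · exact core x hx hxC y hy hyC hxy a ha b hb hab hxa hyb hxb hya
  · exact core y hy hyC x hx hxC hxy.symm b hb a ha hab.symm hyb hxa hya hxb
  · exact hW x hx y hy a haW b hbW b hbW (Or.inl ⟨hxy, adjC a ha b hb hab, hxa, hxb, hya, hyb⟩)

/-- The clique of a split graph is described by a degree threshold and at most one vertex. -/
theorem exists_threshold {W C : Finset V} (hCW : C ⊆ W) (hC : G.IsClique (C : Set V))
    (hI : ∀ u ∈ W, u ∉ C → ∀ v ∈ W, v ∉ C → ¬ G.Adj u v)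
    (hmax : ∀ v ∈ W, v ∉ C → ∃ c ∈ C, ¬ G.Adj v c) (hne : C.Nonempty) :
    ∃ z ∈ W, (∀ v ∈ W, v ∈ C ↔ degIn G W z ≤ degIn G W v) ∨
      (∀ v ∈ W, v ∈ C ↔ degIn G W z < degIn G W v ∨ v = z) := by
  classical
  -- Vertices of `C` have degree at least `|C| - 1`, the others at most `|C| - 1` since they miss a
  -- vertex of `C`. So only the degree `|C| - 1` is ambiguous.
  have hlow : ∀ v ∈ C, C.card ≤ degIn G W v + 1 := by
    intro v hv
    rw [← Finset.card_erase_add_one hv]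
    refine Nat.add_le_add_right (Finset.card_le_card fun u hu => ?_) 1
    have := Finset.ne_of_mem_erase hu
    have h2 := Finset.mem_of_mem_erase hu
    exact Finset.mem_filter.2 ⟨hCW h2, hC hv h2 this.symm⟩
  have hsub : ∀ v ∈ W, v ∉ C → (W.filter fun u => G.Adj v u) ⊆ C := by
    intro v hv hvC u hu
    rw [Finset.mem_filter] at hu
    by_contra huC
    exact hI v hv hvC u hu.1 huC hu.2
  have hhigh : ∀ v ∈ W, v ∉ C → degIn G W v + 1 ≤ C.card := by
    intro v hv hvC
    obtain ⟨c, hc, hvc⟩ := hmax v hv hvC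
    exact Finset.card_lt_card (Finset.ssubset_iff_of_subset (hsub v hv hvC) |>.2
      ⟨c, hc, fun h => hvc (Finset.mem_filter.1 h).2⟩)
  by_cases h : ∃ c ∈ C, degIn G W c + 1 = C.card
  · obtain ⟨c, hc, hdc⟩ := h
    -- A clique vertex of degree `|C| - 1` has no neighbours outside `C`. With two such vertices,
    -- the degrees outside `C` drop to at most `|C| - 2`, and a weak threshold works. If `c` is the
    -- only one, a strict threshold catches the rest of `C` and `c` is added by hand.
    by_cases h' : ∃ c' ∈ C, c' ≠ c ∧ degIn G W c' + 1 = C.card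
    · obtain ⟨c', hc', hne', hdc'⟩ := h'
      have key : ∀ a ∈ C, degIn G W a + 1 = C.card → ∀ v ∈ W, v ∉ C → ¬ G.Adj v a := by
        intro a ha hda v hv hvC hadj
        have : insert v (C.erase a) ⊆ W.filter fun u => G.Adj a u := by
          intro u hu
          rw [Finset.mem_insert] at hu
          rcases hu with rfl | hu
          · exact Finset.mem_filter.2 ⟨hv, hadj.symm⟩
          · have h2 := Finset.mem_of_mem_erase hu
            exact Finset.mem_filter.2 ⟨hCW h2, hC ha h2 (Finset.ne_of_mem_erase hu).symm⟩
        have h3 := Finset.card_le_card this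
        rw [Finset.card_insert_of_notMem (fun h => hvC (Finset.mem_of_mem_erase h)),
          Finset.card_erase_add_one ha] at h3
        unfold degIn at hda
        omega
      refine ⟨c, hCW hc, Or.inl fun v hv => ⟨fun hvC => ?_, fun hle => ?_⟩⟩
      · have := hlow v hvC; omega
      · by_contra hvC
        have hs : (W.filter fun u => G.Adj v u) ⊆ (C.erase c).erase c' := by
          intro u hu
          have h1 := hsub v hv hvC hu
          have h2 := (Finset.mem_filter.1 hu).2
          rw [Finset.mem_erase, Finset.mem_erase]
          exact ⟨fun e => key c' hc' hdc' v hv hvC (e ▸ h2),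
            fun e => key c hc hdc v hv hvC (e ▸ h2), h1⟩
        have h3 := Finset.card_le_card hs
        have h4 := Finset.card_erase_add_one (Finset.mem_erase.2 ⟨hne', hc'⟩)
        have h5 := Finset.card_erase_add_one hc
        unfold degIn at hle hdc
        omega
    · refine ⟨c, hCW hc, Or.inr fun v hv => ⟨fun hvC => ?_, fun hle => ?_⟩⟩
      · by_cases e : v = c
        · exact Or.inr e
        · left
          have h1 := hlow v hvC
          have h2 : degIn G W v + 1 ≠ C.card := fun h2 => h' ⟨v, hvC, e, h2⟩
          omega
      · rcases hle with hle | rfl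
        · by_contra hvC
          have := hhigh v hv hvC
          omega
        · exact hc
  · obtain ⟨z, hz, hmin⟩ := Finset.exists_min_image C (degIn G W) hne
    refine ⟨z, hCW hz, Or.inl fun v hv => ⟨fun hvC => hmin v hvC, fun hle => ?_⟩⟩
    by_contra hvC
    have h1 := hhigh v hv hvC
    have h2 := hlow z hz
    exact h ⟨z, hz, by omega⟩

end Graph

/-! ### Derived formulas -/

namespace Fm

/-- Conjunction. -/
def and (φ ψ : Fm) : Fm := .bop (· && ·) φ ψ

/-- Disjunction. -/
def or (φ ψ : Fm) : Fm := .bop (· || ·) φ ψ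

/-- Existential quantifier. -/
def ex (p : Fin 6) (φ : Fm) : Fm := .fold (· || ·) false p φ

/-- Equality. -/
def eq (p q : Fin 6) : Fm := .and (.nt (.lt p q)) (.nt (.lt q p))

/-- A constant; the variable `0` must be bound. -/
def const (b : Bool) : Fm := .bop (fun _ _ => b) (.mem 0 0) (.mem 0 0)

variable {n : ℕ} {A : ℕ → ℕ → Bool} {X : Fin 7 → ℕ → Bool} {ρ : Fin 6 → ℕ}

@[simp] theorem eval_mem (i : Fin 7) (p : Fin 6) : (mem i p).eval n A X ρ = X i (ρ p) := rfl

@[simp] theorem eval_adj (p q : Fin 6) : (adj p q).eval n A X ρ = A (ρ p) (ρ q) := rfl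

@[simp] theorem eval_lt (p q : Fin 6) : (lt p q).eval n A X ρ = decide (ρ p < ρ q) := rfl

@[simp] theorem eval_nt (φ : Fm) : (nt φ).eval n A X ρ = !φ.eval n A X ρ := rfl

@[simp] theorem eval_and (φ ψ : Fm) :
    (and φ ψ).eval n A X ρ = (φ.eval n A X ρ && ψ.eval n A X ρ) := rfl

@[simp] theorem eval_or (φ ψ : Fm) :
    (or φ ψ).eval n A X ρ = (φ.eval n A X ρ || ψ.eval n A X ρ) := rfl

@[simp] theorem eval_const (b : Bool) : (const b).eval n A X ρ = b := rfl

@[simp] theorem eval_more (p : Fin 6) (φ ψ : Fm) : (more p φ ψ).eval n A X ρ =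
    decide ((List.range n).countP (fun u => ψ.eval n A X (update ρ p u)) <
      (List.range n).countP (fun u => φ.eval n A X (update ρ p u))) := rfl

@[simp] theorem eval_eq (p q : Fin 6) : (eq p q).eval n A X ρ = decide (ρ p = ρ q) := by
  simp only [eq, eval_and, eval_nt, eval_lt]
  rcases lt_trichotomy (ρ p) (ρ q) with h | h | h
  · simp [h, h.ne]
  · simp [h]
  · simp [h, h.ne']

theorem foldl_or (p : ℕ → Bool) (b : Bool) (l : List ℕ) :
    l.foldl (fun c u => c || p u) b = (b || l.any p) := by
  induction l generalizing b with
  | nil => simp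
  | cons a l ih => simp [ih, Bool.or_assoc]

@[simp] theorem eval_ex (p : Fin 6) (φ : Fm) : (ex p φ).eval n A X ρ =
    decide (∃ u < n, φ.eval n A X (update ρ p u) = true) := by
  simp only [ex, eval, foldl_or]
  rw [Bool.eq_iff_iff]
  simp

end Fm

/-! ### Frame properties of commands -/

/-- The command does not assign the set `i`. -/
def Cmd.Avoids (i : Fin 7) : Cmd → Prop
  | .skip => True
  | .seq c d => c.Avoids i ∧ d.Avoids i
  | .assign j _ _ => i ≠ j
  | .bit c d => c.Avoids i ∧ d.Avoids i
  | .cond _ c d => c.Avoids i ∧ d.Avoids i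
  | .emit _ => True
  | .sep => True
  | .loop _ c => c.Avoids i

/-- The command has no output. -/
def Cmd.Silent : Cmd → Prop
  | .skip => True
  | .seq c d => c.Silent ∧ d.Silent
  | .assign _ _ _ => True
  | .bit c d => c.Silent ∧ d.Silent
  | .cond _ c d => c.Silent ∧ d.Silent
  | .emit _ => False
  | .sep => False
  | .loop _ c => c.Silent

section

variable {n : ℕ} {A : ℕ → ℕ → Bool}

theorem foldl_inv {α β : Type*} {P : α → Prop} {f : α → β → α} {l : List β}
    (h : ∀ b ∈ l, ∀ a, P a → P (f a b)) {a : α} (ha : P a) : P (l.foldl f a) := by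
  induction l generalizing a with
  | nil => exact ha
  | cons b l ih => exact ih (fun b hb => h b (by simp [hb])) (h b (by simp) a ha)

theorem Cmd.Avoids.eval {i : Fin 7} {c : Cmd} (hc : c.Avoids i) (ρ : Fin 6 → ℕ) (st : St) :
    (c.eval n A ρ st).set i = st.set i := by
  induction c generalizing ρ st with
  | skip => rfl
  | seq c d ih₁ ih₂ => simp only [Cmd.eval]; rw [ih₂ hc.2, ih₁ hc.1]
  | assign j p φ => exact update_of_ne hc _ _
  | bit c d ih₁ ih₂ =>
    simp only [Cmd.eval]
    split_ifs
    · rw [ih₁ hc.1]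
    · rw [ih₂ hc.2]
  | cond φ c d ih₁ ih₂ =>
    simp only [Cmd.eval]
    split_ifs
    · rw [ih₁ hc.1]
    · rw [ih₂ hc.2]
  | emit => rfl
  | sep => rfl
  | loop p c ih =>
    exact foldl_inv (P := fun s => s.set i = st.set i) (fun b _ a ha => (ih hc _ a).trans ha) rfl

theorem Cmd.Silent.eval {c : Cmd} (hc : c.Silent) (ρ : Fin 6 → ℕ) (st : St) :
    (c.eval n A ρ st).out = st.out := by
  induction c generalizing ρ st with
  | skip => rfl
  | seq c d ih₁ ih₂ => simp only [Cmd.eval]; rw [ih₂ hc.2, ih₁ hc.1]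
  | assign j p φ => rfl
  | bit c d ih₁ ih₂ =>
    simp only [Cmd.eval]
    split_ifs
    · rw [ih₁ hc.1]
    · rw [ih₂ hc.2]
  | cond φ c d ih₁ ih₂ =>
    simp only [Cmd.eval]
    split_ifs
    · rw [ih₁ hc.1]
    · rw [ih₂ hc.2]
  | emit => exact hc.elim
  | sep => exact hc.elim
  | loop p c ih =>
    exact foldl_inv (P := fun s => s.out = st.out) (fun b _ a ha => (ih hc _ a).trans ha) rfl

/-! ### Halving a set -/

/-- The members of a Boolean set below `n`. -/
def fs (n : ℕ) (Y : ℕ → Bool) : Finset ℕ := (Finset.range n).filter fun v => Y v = true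

@[simp] theorem mem_fs {Y : ℕ → Bool} {v : ℕ} : v ∈ fs n Y ↔ v < n ∧ Y v = true := by simp [fs]

theorem countP_range_eq_card (p : ℕ → Bool) : (List.range n).countP p = (fs n p).card := by
  induction n with
  | zero => simp [fs]
  | succ n ih =>
    rw [List.range_succ, List.countP_append, ih, List.countP_singleton]
    simp only [fs, Finset.range_add_one, Finset.filter_insert]
    split_ifs with h
    · rw [Finset.card_insert_of_notMem (by simp)]
    · rfl

/-- The elements of even rank (for `b = true`) or odd rank (for `b = false`) of a set. -/
def halfSet (n : ℕ) (b : Bool) (Y : ℕ → Bool) (v : ℕ) : Bool :=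
  Y v && (List.range n).foldl (fun c u => xor c (Y u && decide (u < v))) b

/-- Keep the elements of even or of odd rank of the set `1`. -/
def Cmd.halve (b : Bool) : Cmd :=
  .assign 1 0 (.and (.mem 1 0) (.fold xor b 1 (.and (.mem 1 1) (.lt 1 0))))

theorem Cmd.eval_halve (b : Bool) (ρ : Fin 6 → ℕ) (st : St) : (Cmd.halve b).eval n A ρ st =
    { st with set := update st.set 1 (halfSet n b (st.set 1)) } := by
  simp [Cmd.halve, Cmd.eval, Fm.eval, Fm.and]
  rfl

theorem foldl_xor (p : ℕ → Bool) (b : Bool) (l : List ℕ) :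
    l.foldl (fun c u => xor c (p u)) b = xor b (decide (l.countP p % 2 = 1)) := by
  induction l generalizing b with
  | nil => simp
  | cons a l ih =>
    rw [List.foldl_cons, ih, List.countP_cons]
    cases p a
    · simp
    · rcases Nat.mod_two_eq_zero_or_one (l.countP p) with h | h
      · have : (l.countP p + 1) % 2 = 1 := by omega
        simp [h, this]
      · have : (l.countP p + 1) % 2 = 0 := by omega
        simp [h, this]

/-- The number of smaller elements of a set. -/
def rank (n : ℕ) (Y : ℕ → Bool) (v : ℕ) : ℕ := ((fs n Y).filter fun u => u < v).card

theorem halfSet_eq (b : Bool) (Y : ℕ → Bool) (v : ℕ) :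
    halfSet n b Y v = (Y v && xor b (decide (rank n Y v % 2 = 1))) := by
  rw [halfSet, foldl_xor, countP_range_eq_card, rank]
  congr 6
  ext u
  simp [and_assoc]

theorem rank_lt_card {Y : ℕ → Bool} {v : ℕ} (hv : v ∈ fs n Y) : rank n Y v < (fs n Y).card :=
  Finset.card_lt_card (Finset.filter_ssubset.2 ⟨v, hv, by simp⟩)

theorem rank_injOn (Y : ℕ → Bool) : Set.InjOn (rank n Y) (fs n Y) := by
  have key : ∀ u ∈ fs n Y, ∀ v, u < v → rank n Y u < rank n Y v := by
    intro u hu v huv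
    refine Finset.card_lt_card ?_
    refine Finset.ssubset_iff_of_subset (fun x hx => ?_) |>.2 ⟨u, ?_, by simp⟩
    · simp only [Finset.mem_filter] at hx ⊢
      exact ⟨hx.1, hx.2.trans huv⟩
    · exact Finset.mem_filter.2 ⟨hu, huv⟩
  intro u hu v hv h
  rcases lt_trichotomy u v with hlt | heq | hlt
  · exact absurd h (key u hu v hlt).ne
  · exact heq
  · exact absurd h (key v hv u hlt).ne'

/-- On elements whose ranks have the same parity, halving the rank is injective. -/
theorem card_halfSet_le (b : Bool) (Y : ℕ → Bool) :
    (fs n (halfSet n b Y)).card ≤ if b then ((fs n Y).card + 1) / 2 else (fs n Y).card / 2 := by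
  have hsub : ∀ v ∈ fs n (halfSet n b Y), v ∈ fs n Y := by
    intro v hv
    rw [mem_fs, halfSet_eq] at hv
    simp only [Bool.and_eq_true] at hv
    exact mem_fs.2 ⟨hv.1, hv.2.1⟩
  have hpar : ∀ v ∈ fs n (halfSet n b Y), rank n Y v % 2 = if b then 0 else 1 := by
    intro v hv
    rw [mem_fs, halfSet_eq] at hv
    cases b
    · simp at hv; simpa using hv.2.2
    · simp at hv; simpa using hv.2.2
  rw [← Finset.card_range (if b then ((fs n Y).card + 1) / 2 else (fs n Y).card / 2)]
  refine Finset.card_le_card_of_injOn (fun v => rank n Y v / 2) (fun v hv => ?_) ?_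
  · have h₁ := rank_lt_card (hsub v hv)
    have h₂ := hpar v hv
    rw [Finset.coe_range, Set.mem_Iio]
    cases b
    · simp at h₂ ⊢; omega
    · simp at h₂ ⊢; omega
  · intro u hu v hv h
    have h₁ := hpar u hu
    have h₂ := hpar v hv
    simp only at h
    exact rank_injOn Y (hsub u hu) (hsub v hv) (by omega)

theorem exists_halfSet {Y : ℕ → Bool} {v : ℕ} (hv : Y v = true) : ∃ b, halfSet n b Y v = true := by
  by_cases h : rank n Y v % 2 = 1
  · exact ⟨false, by simp [halfSet_eq, h, hv]⟩
  · exact ⟨true, by simp [halfSet_eq, h, hv]⟩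

/-! ### Reading a vertex from the tape -/

/-- The set `1` has at least two elements. -/
def Fm.big : Fm := .ex 0 (.ex 1 (.and (.and (.mem 1 0) (.mem 1 1)) (.lt 0 1)))

theorem Fm.eval_big (X : Fin 7 → ℕ → Bool) (ρ : Fin 6 → ℕ) :
    Fm.big.eval n A X ρ = decide (1 < (fs n (X 1)).card) := by
  rw [Fm.big, eval_ex, decide_eq_decide, Finset.one_lt_card]
  simp only [eval_ex, decide_eq_true_eq, eval_and, eval_mem, eval_lt, Bool.and_eq_true, mem_fs]
  constructor
  · rintro ⟨u, hu, v, hv, ⟨h₁, h₂⟩, h₃⟩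
    simp at h₁ h₂ h₃
    exact ⟨u, ⟨hu, h₁⟩, v, ⟨hv, h₂⟩, h₃.ne⟩
  · rintro ⟨u, ⟨hu, h₁⟩, v, ⟨hv, h₂⟩, h₃⟩
    rcases lt_or_gt_of_ne h₃ with h | h
    · exact ⟨u, hu, v, hv, by simp [h₁, h₂, h]⟩
    · exact ⟨v, hv, u, hu, by simp [h₁, h₂, h]⟩

/-- One step of the reduction of the set `1` to a singleton. -/
def Cmd.shrinkStep : Cmd := .cond Fm.big (.bit (.halve false) (.halve true)) .skip

/-- Reduce the set `1` to a singleton, as directed by the tape. -/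
def Cmd.shrink : Cmd := .loop 5 .shrinkStep

theorem clog_half {m : ℕ} (hm : 1 < m) : Nat.clog 2 m = Nat.clog 2 ((m + 1) / 2) + 1 :=
  Nat.clog_of_two_le (by norm_num) hm

/-- The tape always points to the half that contains `y`, so the cardinality `s` becomes at most `⌈s
/ 2⌉`, in accordance with the recursion of `Nat.clog`. Once the set is a singleton the guard
`Fm.big` fails and no further bits are consumed, so that exactly `w` is read. -/
theorem shrink_list (ρ : Fin 6 → ℕ) {y : ℕ} (hy : y < n) (l : List ℕ) (X : Fin 7 → ℕ → Bool)
    (hX : X 1 y = true) (hl : (fs n (X 1)).card ≤ l.length + 1) :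
    ∃ w : List Bool, w.length ≤ Nat.clog 2 (fs n (X 1)).card ∧ ∃ Y' : ℕ → Bool,
      (∀ v < n, Y' v = decide (v = y)) ∧ ∀ tape out,
        l.foldl (fun st i => Cmd.shrinkStep.eval n A (update ρ 5 i) st) ⟨X, w ++ tape, out⟩ =
          ⟨update X 1 Y', tape, out⟩ := by
  by_cases h : 1 < (fs n (X 1)).card
  · induction l generalizing X with
    | nil => simp at hl; omega
    | cons a l ih =>
      obtain ⟨b, hb⟩ := exists_halfSet (n := n) hX
      have hcard : (fs n (halfSet n b (X 1))).card ≤ ((fs n (X 1)).card + 1) / 2 := by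
        have := card_halfSet_le (n := n) b (X 1)
        cases b
        · simp at this; omega
        · simpa using this
      -- The letter is `!b` because a tape bit `true` selects `Cmd.halve false`.
      have step : ∀ w tape out, Cmd.shrinkStep.eval n A (update ρ 5 a)
          ⟨X, (!b) :: w ++ tape, out⟩ = ⟨update X 1 (halfSet n b (X 1)), w ++ tape, out⟩ := by
        intro w tape out
        simp only [Cmd.shrinkStep, Cmd.eval, Fm.eval_big, h, decide_true, if_true]
        cases b
        · simp [Cmd.eval_halve]
        · simp [Cmd.eval_halve]
      by_cases h' : 1 < (fs n (halfSet n b (X 1))).card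
      · obtain ⟨w, hw, Y', hY', hev⟩ := ih (update X 1 (halfSet n b (X 1))) (by simpa using hb)
          (by simp only [update_self]; simp at hl; omega) (by simpa using h')
        refine ⟨(!b) :: w, ?_, Y', hY', fun tape out => ?_⟩
        · rw [clog_half h, List.length_cons]
          refine Nat.add_le_add_right (hw.trans ?_) 1
          simpa using Nat.clog_mono_right 2 hcard
        · rw [List.foldl_cons, step, hev]
          simp
      · refine ⟨[!b], ?_, halfSet n b (X 1), fun v hv => ?_, fun tape out => ?_⟩
        · rw [clog_half h]; simp
        · rw [Bool.eq_iff_iff, decide_eq_true_eq]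
          refine ⟨fun hv' => ?_, fun e => e ▸ hb⟩
          exact Finset.card_le_one.1 (by omega) v (mem_fs.2 ⟨hv, hv'⟩) y (mem_fs.2 ⟨hy, hb⟩)
        · have := step [] tape out
          rw [List.foldl_cons]
          simp only [List.cons_append, List.nil_append] at this ⊢
          rw [this]
          clear ih hl
          induction l with
          | nil => rfl
          | cons c l ih =>
            rw [List.foldl_cons]
            have : Cmd.shrinkStep.eval n A (update ρ 5 c)
                ⟨update X 1 (halfSet n b (X 1)), tape, out⟩ =
                ⟨update X 1 (halfSet n b (X 1)), tape, out⟩ := by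
              simp [Cmd.shrinkStep, Cmd.eval, Fm.eval_big, h']
            rw [this, ih]
  · refine ⟨[], by simp, X 1, fun v hv => ?_, fun tape out => ?_⟩
    · rw [Bool.eq_iff_iff, decide_eq_true_eq]
      refine ⟨fun hv' => ?_, fun e => e ▸ hX⟩
      exact Finset.card_le_one.1 (by omega) v (mem_fs.2 ⟨hv, hv'⟩) y (mem_fs.2 ⟨hy, hX⟩)
    · rw [update_eq_self]
      exact foldl_inv (P := fun s : St => s = ⟨X, tape, out⟩)
        (fun c _ s hs => by rw [hs]; simp [Cmd.shrinkStep, Cmd.eval, Fm.eval_big, h]) rfl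

theorem card_fs_le (Y : ℕ → Bool) : (fs n Y).card ≤ n := by
  exact (Finset.card_filter_le _ _).trans (Finset.card_range n).le

theorem eval_shrink (ρ : Fin 6 → ℕ) {y : ℕ} (hy : y < n) (X : Fin 7 → ℕ → Bool)
    (hX : X 1 y = true) :
    ∃ w : List Bool, w.length ≤ Nat.clog 2 (fs n (X 1)).card ∧ ∃ Y' : ℕ → Bool,
      (∀ v < n, Y' v = decide (v = y)) ∧ ∀ tape out,
        Cmd.shrink.eval n A ρ ⟨X, w ++ tape, out⟩ = ⟨update X 1 Y', tape, out⟩ :=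
  shrink_list ρ hy (List.range n) X hX (by have := card_fs_le (n := n) (X 1); simp; omega)

end

/-! ### Separating a clique from an independent set -/

/-- The strict majority of the set `5` is adjacent to the vertex `0`. -/
def Fm.maj : Fm := .more 1 (.and (.mem 5 1) (.adj 0 1)) (.and (.mem 5 1) (.nt (.adj 0 1)))

/-- The vertex in the set `1` belongs to the clique. -/
def Cmd.sideC : Cmd :=
  .seq (.assign 6 0 (.or (.mem 6 0) (.mem 1 0)))
    (.assign 5 0 (.and (.mem 5 0) (.nt (.ex 1 (.and (.mem 1 1) (.nt (.adj 1 0)))))))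

/-- The vertex in the set `1` belongs to the independent set. -/
def Cmd.sideI : Cmd :=
  .seq (.assign 6 0 (.or (.mem 6 0) (.and (.mem 5 0) (.ex 1 (.and (.mem 1 1) (.adj 1 0))))))
    (.assign 5 0 (.and (.mem 5 0) (.and (.nt (.mem 1 0)) (.nt (.ex 1 (.and (.mem 1 1) (.adj 1 0)))))))

/-- If the tape says so, choose a vertex of the set `0` and its side, and restrict the set `5` of
undecided vertices accordingly. -/
def Cmd.round : Cmd :=
  .bit (.seq (.assign 1 0 (.mem 0 0)) (.seq .shrink (.bit .sideC .sideI))) .skip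

section

variable {n : ℕ} {A : ℕ → ℕ → Bool}

/-- The set `6` separates `C` from `I`, except for undecided vertices in the set `5`. -/
def Sep (n : ℕ) (C I : Finset ℕ) (X : Fin 7 → ℕ → Bool) : Prop :=
  ∀ v < n, (v ∈ C → X 6 v = true ∨ X 5 v = true) ∧ (v ∈ I → X 6 v = false) ∧
    (X 5 v = true → X 0 v = true)

/-- The undecided vertices of `C` have a majority of neighbours, those of `I` do not. -/
def Term (n : ℕ) (A : ℕ → ℕ → Bool) (C I : Finset ℕ) (X : Fin 7 → ℕ → Bool) : Prop :=
  ∀ v < n, X 5 v = true → (v ∈ C → (fs n fun u => X 5 u && !A v u).card <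
    (fs n fun u => X 5 u && A v u).card) ∧ (v ∈ I → ¬ (fs n fun u => X 5 u && !A v u).card <
    (fs n fun u => X 5 u && A v u).card)

/-- Hence the smaller of the two classes has at most half of the elements; this is what makes a
round of the protocol halve the undecided set. -/
theorem card_adj_add (X : ℕ → Bool) (a : ℕ → Bool) :
    (fs n fun u => X u && a u).card + (fs n fun u => X u && !a u).card = (fs n X).card := by
  rw [← Finset.card_filter_add_card_filter_not (s := fs n X) (fun u => a u = true)]
  congr 2
  · ext u; simp [and_assoc]
  · ext u; simp [and_assoc]

/-- A round that reads `false`, or finds the tape exhausted, leaves the sets alone. So surplus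
rounds and surplus zeros are harmless. -/
theorem round_skip_list (ρ : Fin 6 → ℕ) (X : Fin 7 → ℕ → Bool) (out : List (Option Bool)) (j : ℕ)
    (l : List ℕ) : ∃ j', l.foldl (fun st i => Cmd.round.eval n A (update ρ 4 i) st)
      ⟨X, List.replicate j false, out⟩ = ⟨X, List.replicate j' false, out⟩ := by
  induction l generalizing j with
  | nil => exact ⟨j, rfl⟩
  | cons a l ih =>
    obtain ⟨j', h⟩ := ih (j - 1)
    refine ⟨j', ?_⟩
    rw [List.foldl_cons, ← h]
    congr 1
    rcases j with _ | j <;> simp [Cmd.round, Cmd.eval, List.replicate_succ]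

/-- As long as `Term` fails, some undecided `y` is misjudged by the majority rule: `y ∈ C` with at
most half of the undecided vertices as neighbours, or `y ∈ I` with more than half. The tape names
`y` and its side. In the first case all non-neighbours of `y` become decided, in the second all
neighbours, so at most half remain, and `r` rounds suffice for fewer than `2 ^ r` vertices. A round
costs one bit to start it, one for the side, and `clog` bits to pick `y` from the set `0`. -/
theorem round_list (ρ : Fin 6 → ℕ) {C I : Finset ℕ}
    (hC : ∀ u ∈ C, ∀ v ∈ C, u ≠ v → A u v = true) (hI : ∀ u ∈ I, ∀ v ∈ I, A u v = false)
    (hCI : Disjoint C I) (l : List ℕ) (X : Fin 7 → ℕ → Bool) (hX : Sep n C I X) (r : ℕ)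
    (hr : (fs n (X 5)).card < 2 ^ r) (hrl : r ≤ l.length) :
    ∃ w : List Bool, w.length ≤ r * (2 + Nat.clog 2 (fs n (X 0)).card) ∧ ∀ j out, ∃ X' j',
      l.foldl (fun st i => Cmd.round.eval n A (update ρ 4 i) st)
        ⟨X, w ++ List.replicate j false, out⟩ = ⟨X', List.replicate j' false, out⟩ ∧
      Sep n C I X' ∧ Term n A C I X' := by
  by_cases hT : Term n A C I X
  · refine ⟨[], by simp, fun j out => ?_⟩
    obtain ⟨j', h⟩ := round_skip_list (n := n) (A := A) ρ X out j l
    exact ⟨X, j', h, hX, hT⟩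
  induction l generalizing X r with
  | nil =>
    have : r = 0 := by simpa using hrl
    subst this
    have h0 : fs n (X 5) = ∅ := by simpa using hr
    refine absurd (fun v hv hv5 => ?_) hT
    have : v ∈ fs n (X 5) := by simp [hv, hv5]
    rw [h0] at this
    simp at this
  | cons a l ih =>
    rcases r with _ | r
    · have h0 : fs n (X 5) = ∅ := by simpa using hr
      refine absurd (fun v hv hv5 => ?_) hT
      have : v ∈ fs n (X 5) := by simp [hv, hv5]
      rw [h0] at this
      simp at this
    obtain ⟨X₁, hsep, hcard, w₁, hw₁, h0₁, hstep⟩ : ∃ X₁ : Fin 7 → ℕ → Bool, Sep n C I X₁ ∧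
        2 * (fs n (X₁ 5)).card ≤ (fs n (X 5)).card ∧ ∃ w₁ : List Bool,
        w₁.length ≤ 2 + Nat.clog 2 (fs n (X 0)).card ∧ X₁ 0 = X 0 ∧ ∀ tape out,
        Cmd.round.eval n A (update ρ 4 a) ⟨X, w₁ ++ tape, out⟩ = ⟨X₁, tape, out⟩ := by
      obtain ⟨y, hy, hy5, b, hb⟩ : ∃ y < n, X 5 y = true ∧ ∃ b : Bool,
          if b then y ∈ C ∧ ¬ (fs n fun u => X 5 u && !A y u).card <
              (fs n fun u => X 5 u && A y u).card
          else y ∈ I ∧ (fs n fun u => X 5 u && !A y u).card <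
              (fs n fun u => X 5 u && A y u).card := by
        unfold Term at hT
        push Not at hT
        obtain ⟨y, hy, hy5, h⟩ := hT
        refine ⟨y, hy, hy5, ?_⟩
        by_cases hyC : y ∈ C ∧ ¬ (fs n fun u => X 5 u && !A y u).card <
              (fs n fun u => X 5 u && A y u).card
        · exact ⟨true, by simpa using hyC⟩
        · refine ⟨false, ?_⟩
          have := h (fun hc => by by_contra hcon; exact hyC ⟨hc, hcon⟩)
          simpa using this
      obtain ⟨w, hw, Y', hY', hev⟩ := eval_shrink (n := n) (A := A) (update ρ 4 a) hy
        (update X 1 (X 0)) (by simpa using (hX y hy).2.2 hy5)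
      simp only [update_self, update_idem] at hw hev
      have hsum := card_adj_add (n := n) (X 5) (A y)
      have hex : ∀ p : ℕ → Bool, (∃ u < n, Y' u = true ∧ p u = true) ↔ p y = true := by
        intro p
        constructor
        · rintro ⟨u, hu, h₁, h₂⟩
          rw [hY' u hu, decide_eq_true_eq] at h₁
          exact h₁ ▸ h₂
        · exact fun h => ⟨y, hy, by simp [hY' y hy], h⟩
      have hstep : ∀ tape out, Cmd.round.eval n A (update ρ 4 a)
          ⟨X, true :: w ++ b :: tape, out⟩ = (if b then Cmd.sideC else Cmd.sideI).eval n A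
            (update ρ 4 a) ⟨update X 1 Y', tape, out⟩ := by
        intro tape out
        have := hev (b :: tape) out
        have e : (fun v => (Fm.mem 0 0).eval n A X (update (update ρ 4 a) 0 v)) = X 0 := by
          funext v; simp
        simp only [Cmd.round, Cmd.eval, List.cons_append, List.head?_cons, if_true,
          List.tail_cons, e, this]
        cases b <;> simp
      have hlen : (true :: w ++ [b]).length ≤ 2 + Nat.clog 2 (fs n (X 0)).card := by
        simp; omega
      cases b
      · simp only [Bool.false_eq_true, if_false] at hb
        -- Here `y ∈ I`. Its neighbours are not in `I`, so they may join the clique side. The vertex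
        -- `y` leaves the undecided set without joining, which puts it on the independent side.
        set X₁ : Fin 7 → ℕ → Bool := update (update (update X 1 Y') 6 fun v =>
          X 6 v || X 5 v && decide (∃ u < n, Y' u = true ∧ A u v = true)) 5 fun v =>
          X 5 v && (!Y' v && !decide (∃ u < n, Y' u = true ∧ A u v = true)) with hX₁
        refine ⟨X₁, ?_, ?_, true :: w ++ [false], hlen, by simp [hX₁], ?_⟩
        · intro v hv
          obtain ⟨h₁, h₂, h₃⟩ := hX v hv
          have e := hex (fun u => A u v)
          simp only [hX₁, update_self, ne_eq, Fin.reduceEq, not_false_eq_true, update_of_ne, e,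
            hY' v hv]
          refine ⟨fun hvC => ?_, fun hvI => ?_, fun h => ?_⟩
          · have hvy : v ≠ y := fun e => Finset.disjoint_left.1 hCI hvC (e ▸ hb.1)
            rcases h₁ hvC with h | h
            · simp [h]
            · cases hA : A y v <;> simp [h, hvy]
          · simp [h₂ hvI, hI y hb.1 v hvI]
          · simp only [Bool.and_eq_true] at h
            exact h₃ h.1
        · have : (fs n (X₁ 5)).card ≤ (fs n fun u => X 5 u && !A y u).card := by
            refine Finset.card_le_card fun v hv => ?_
            rw [mem_fs] at hv ⊢
            obtain ⟨hv, h⟩ := hv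
            have e := hex (fun u => A u v)
            simp only [hX₁, update_self, e, Bool.and_eq_true] at h
            refine ⟨hv, ?_⟩
            simp only [Bool.and_eq_true]
            refine ⟨h.1, ?_⟩
            simpa using h.2.2
          omega
        · intro tape out
          have := hstep tape out
          simp only [List.cons_append, List.append_assoc, List.nil_append] at this ⊢
          rw [this]
          simp [Cmd.sideI, Cmd.eval, hX₁]
      · simp only [if_true] at hb
        -- Here `y ∈ C`, and `y` joins the clique side. Its other non-neighbours are not in `C`;
        -- they leave the undecided set and so fall to the independent side.
        set X₁ : Fin 7 → ℕ → Bool := update (update (update X 1 Y') 6 fun v =>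
          X 6 v || Y' v) 5 fun v =>
          X 5 v && !decide (∃ u < n, Y' u = true ∧ A u v = false) with hX₁
        have hex' : ∀ v, (∃ u < n, Y' u = true ∧ A u v = false) ↔ A y v = false := by
          intro v
          simpa using hex (fun u => !A u v)
        refine ⟨X₁, ?_, ?_, true :: w ++ [true], hlen, by simp [hX₁], ?_⟩
        · intro v hv
          obtain ⟨h₁, h₂, h₃⟩ := hX v hv
          simp only [hX₁, update_self, ne_eq, Fin.reduceEq, not_false_eq_true, update_of_ne,
            hex', hY' v hv]
          refine ⟨fun hvC => ?_, fun hvI => ?_, fun h => ?_⟩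
          · rcases h₁ hvC with h | h
            · simp [h]
            · by_cases hvy : v = y
              · simp [hvy]
              · simp [h, hC y hb.1 v hvC (Ne.symm hvy)]
          · have hvy : v ≠ y := fun e => Finset.disjoint_left.1 hCI hb.1 (e ▸ hvI)
            simp [h₂ hvI, hvy]
          · simp only [Bool.and_eq_true] at h
            exact h₃ h.1
        · have : (fs n (X₁ 5)).card ≤ (fs n fun u => X 5 u && A y u).card := by
            refine Finset.card_le_card fun v hv => ?_
            rw [mem_fs] at hv ⊢
            obtain ⟨hv, h⟩ := hv
            simp only [hX₁, update_self, hex', Bool.and_eq_true] at h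
            refine ⟨hv, ?_⟩
            simp only [Bool.and_eq_true]
            refine ⟨h.1, ?_⟩
            simpa using h.2
          omega
        · intro tape out
          have := hstep tape out
          simp only [List.cons_append, List.append_assoc, List.nil_append] at this ⊢
          rw [this]
          simp [Cmd.sideC, Cmd.eval, hX₁]
    by_cases hT₁ : Term n A C I X₁
    · refine ⟨w₁, by nlinarith, fun j out => ?_⟩
      obtain ⟨j', h⟩ := round_skip_list (n := n) (A := A) ρ X₁ out j l
      refine ⟨X₁, j', ?_, hsep, hT₁⟩
      rw [List.foldl_cons, hstep, h]
    · obtain ⟨w₂, hw₂, h₂⟩ := ih X₁ hsep r (by rw [pow_succ] at hr; omega) (by simpa using hrl) hT₁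
      refine ⟨w₁ ++ w₂, ?_, fun j out => ?_⟩
      · rw [h0₁] at hw₂
        rw [List.length_append]
        nlinarith
      · obtain ⟨X', j', h⟩ := h₂ j out
        refine ⟨X', j', ?_, h.2⟩
        rw [List.foldl_cons, List.append_assoc, hstep, h.1]

end

section

variable {n : ℕ} {A : ℕ → ℕ → Bool}

/-! ### Loops -/

theorem eval_loop (p : Fin 6) (c : Cmd) (ρ : Fin 6 → ℕ) (st : St) : (Cmd.loop p c).eval n A ρ st =
    (List.range n).foldl (fun st i => c.eval n A (update ρ p i) st) st := rfl

theorem loop_inv {P : St → Prop} {p : Fin 6} {c : Cmd} {ρ : Fin 6 → ℕ}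
    (h : ∀ i < n, ∀ st, P st → P (c.eval n A (update ρ p i) st)) {st : St} (hst : P st) :
    P ((Cmd.loop p c).eval n A ρ st) :=
  foldl_inv (fun i hi st => h i (List.mem_range.1 hi) st) hst

/-- The set `0` only grows. -/
def Grows (n : ℕ) (A : ℕ → ℕ → Bool) (c : Cmd) : Prop :=
  ∀ ρ st v, st.set 0 v = true → (c.eval n A ρ st).set 0 v = true

theorem Grows.loop {c : Cmd} (hc : Grows n A c) (p : Fin 6) : Grows n A (.loop p c) :=
  fun ρ _ v hv => loop_inv (P := fun s : St => s.set 0 v = true)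
    (fun i _ s hs => hc (update ρ p i) s v hs) hv

/-- Later iterations only enlarge the set `0`, so what iteration `i` achieves, from whatever state
it starts, survives to the end. -/
theorem loop_reach {R : ℕ → (ℕ → Bool) → Prop} {p : Fin 6} {c : Cmd} {ρ : Fin 6 → ℕ}
    (hR : ∀ i S S', (∀ v, S v = true → S' v = true) → R i S → R i S') (hc : Grows n A c)
    (h : ∀ i < n, ∀ st, R i ((c.eval n A (update ρ p i) st).set 0)) {i : ℕ} (hi : i < n) (st : St) :
    R i (((Cmd.loop p c).eval n A ρ st).set 0) := by
  rw [eval_loop]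
  have : ∀ l : List ℕ, (∀ j ∈ l, j < n) → i ∈ l → ∀ st,
      R i ((l.foldl (fun st i => c.eval n A (update ρ p i) st) st).set 0) := by
    intro l hl hil
    induction l with
    | nil => simp at hil
    | cons a l ih =>
      intro st
      rw [List.foldl_cons]
      by_cases hil' : i ∈ l
      · exact ih (fun j hj => hl j (by simp [hj])) hil' _
      · have hia : i = a := by simpa [hil'] using hil
        subst hia
        exact foldl_inv (P := fun s : St => R i (s.set 0))
          (fun b _ s hs => hR i _ _ (fun v hv => hc _ _ v hv) hs) (h i hi st)
  exact this _ (fun j hj => List.mem_range.1 hj) (List.mem_range.2 hi) st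

/-! ### A packing of forbidden subgraphs -/

/-- None of the vertices `0, …, 4` lies in the set `0`. -/
def Fm.fresh : Fm :=
  .and (.nt (.mem 0 0)) <| .and (.nt (.mem 0 1)) <| .and (.nt (.mem 0 2)) <|
  .and (.nt (.mem 0 3)) (.nt (.mem 0 4))

/-- The vertices `0, …, 4` form a bad tuple. -/
def Fm.bad : Fm :=
  .or (.and (.adj 0 1) <| .and (.adj 2 3) <| .and (.nt (.adj 0 2)) <| .and (.nt (.adj 0 3)) <|
    .and (.nt (.adj 1 2)) (.nt (.adj 1 3))) <|
  .or (.and (.adj 0 1) <| .and (.adj 1 2) <| .and (.adj 2 3) <| .and (.adj 3 0) <|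
    .and (.nt (.adj 0 2)) <| .and (.nt (.adj 1 3)) <| .and (.nt (.eq 0 2)) (.nt (.eq 1 3))) <|
  .and (.adj 0 1) <| .and (.adj 1 2) <| .and (.adj 2 3) <| .and (.adj 3 4) <| .and (.adj 4 0) <|
    .and (.nt (.adj 0 2)) <| .and (.nt (.adj 0 3)) <| .and (.nt (.adj 1 3)) <|
    .and (.nt (.adj 1 4)) (.nt (.adj 2 4))

/-- If the vertices `0, …, 4` form a bad tuple outside the set `0`, add them to it. -/
def Cmd.packStep : Cmd :=
  .cond (.and .fresh .bad) (.assign 0 5 <| .or (.mem 0 5) <| .or (.eq 5 0) <| .or (.eq 5 1) <|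
    .or (.eq 5 2) <| .or (.eq 5 3) (.eq 5 4)) .skip

/-- Compute a maximal packing of bad tuples in the set `0`. -/
def Cmd.pack : Cmd := .loop 0 (.loop 1 (.loop 2 (.loop 3 (.loop 4 .packStep))))

theorem eval_packStep (ρ : Fin 6 → ℕ) (st : St) : Cmd.packStep.eval n A ρ st =
    if Fm.fresh.eval n A st.set ρ && Fm.bad.eval n A st.set ρ then
      ⟨update st.set 0 fun v => st.set 0 v || (decide (v = ρ 0) || (decide (v = ρ 1) ||
        (decide (v = ρ 2) || (decide (v = ρ 3) || decide (v = ρ 4))))), st.tape, st.out⟩ else st := by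
  simp only [Cmd.packStep, Cmd.eval, Fm.eval_and]
  refine if_congr Iff.rfl ?_ rfl
  simp

theorem grows_packStep : Grows n A .packStep := by
  intro ρ st v hv
  rw [eval_packStep]
  split_ifs
  · simp [hv]
  · exact hv

variable {G : SimpleGraph ℕ} (hA : ∀ i j, A i j = true ↔ G.Adj i j)
include hA

theorem eval_bad (X : Fin 7 → ℕ → Bool) (ρ : Fin 6 → ℕ) :
    Fm.bad.eval n A X ρ = true ↔ Bad G (ρ 0) (ρ 1) (ρ 2) (ρ 3) (ρ 4) := by
  have hA' : ∀ i j, A i j = false ↔ ¬ G.Adj i j := fun i j => by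
    rw [← hA, Bool.not_eq_true]
  simp [Fm.bad, Bad, hA, hA']

/-- The vertices of a bad tuple below `n` are met by the set. -/
theorem pack_maximal (ρ : Fin 6 → ℕ) (st : St) {a b c d e : ℕ} (ha : a < n) (hb : b < n)
    (hc : c < n) (hd : d < n) (he : e < n) (h : Bad G a b c d e) :
    ∃ x, (x = a ∨ x = b ∨ x = c ∨ x = d ∨ x = e) ∧ (Cmd.pack.eval n A ρ st).set 0 x = true := by
  have mono : ∀ a b c d e : ℕ, ∀ S S' : ℕ → Bool, (∀ v, S v = true → S' v = true) →
      (Bad G a b c d e → ∃ x, (x = a ∨ x = b ∨ x = c ∨ x = d ∨ x = e) ∧ S x = true) →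
      Bad G a b c d e → ∃ x, (x = a ∨ x = b ∨ x = c ∨ x = d ∨ x = e) ∧ S' x = true := by
    intro a b c d e S S' hS h hbad
    obtain ⟨x, hx, hSx⟩ := h hbad
    exact ⟨x, hx, hS x hSx⟩
  have g := grows_packStep (n := n) (A := A)
  refine loop_reach (R := fun a S => Bad G a b c d e →
    ∃ x, (x = a ∨ x = b ∨ x = c ∨ x = d ∨ x = e) ∧ S x = true) (fun a => mono a b c d e)
    ((((g.loop 4).loop 3).loop 2).loop 1) (fun a _ st => ?_) ha st h
  refine loop_reach (R := fun b S => Bad G a b c d e →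
    ∃ x, (x = a ∨ x = b ∨ x = c ∨ x = d ∨ x = e) ∧ S x = true) (fun b => mono a b c d e)
    (((g.loop 4).loop 3).loop 2) (fun b _ st => ?_) hb st
  refine loop_reach (R := fun c S => Bad G a b c d e →
    ∃ x, (x = a ∨ x = b ∨ x = c ∨ x = d ∨ x = e) ∧ S x = true) (fun c => mono a b c d e)
    ((g.loop 4).loop 3) (fun c _ st => ?_) hc st
  refine loop_reach (R := fun d S => Bad G a b c d e →
    ∃ x, (x = a ∨ x = b ∨ x = c ∨ x = d ∨ x = e) ∧ S x = true) (fun d => mono a b c d e)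
    (g.loop 4) (fun d _ st => ?_) hd st
  refine loop_reach (R := fun e S => Bad G a b c d e →
    ∃ x, (x = a ∨ x = b ∨ x = c ∨ x = d ∨ x = e) ∧ S x = true) (fun e => mono a b c d e)
    g (fun e _ st => ?_) he st
  intro hbad
  rw [eval_packStep]
  have hbad' : Fm.bad.eval n A st.set
      (update (update (update (update (update ρ 0 a) 1 b) 2 c) 3 d) 4 e) = true := by
    rw [eval_bad hA]
    simpa using hbad
  rw [hbad', Bool.and_true]
  split_ifs with hf
  · exact ⟨a, by simp, by simp⟩
  · by_contra! hcon
    apply hf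
    simp only [Fm.fresh, Fm.eval_and, Fm.eval_nt, Fm.eval_mem]
    simp [hcon]

/-- A set that meets all bad tuples contains a fifth of the packing. -/
theorem pack_card_le (T : Finset ℕ) (hT : ∀ a < n, ∀ b < n, ∀ c < n, ∀ d < n, ∀ e < n,
      Bad G a b c d e → ∃ x ∈ T, x = a ∨ x = b ∨ x = c ∨ x = d ∨ x = e)
    (ρ : Fin 6 → ℕ) (st : St) (hst : ∀ v, st.set 0 v = false) :
    (fs n ((Cmd.pack.eval n A ρ st).set 0)).card ≤ 5 * T.card := by
  -- Every tuple that is added contributes at most five vertices and, being disjoint from the set so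
  -- far, at least one new element of `T`.
  have key : (fs n ((Cmd.pack.eval n A ρ st).set 0)).card ≤
      5 * (fs n ((Cmd.pack.eval n A ρ st).set 0) ∩ T).card := by
    refine loop_inv (P := fun s => (fs n (s.set 0)).card ≤ 5 * (fs n (s.set 0) ∩ T).card)
      (fun a ha st hs => ?_) ?_
    swap
    · have : fs n (st.set 0) = ∅ := by ext v; simp [hst]
      simp [this]
    refine loop_inv (P := fun s => (fs n (s.set 0)).card ≤ 5 * (fs n (s.set 0) ∩ T).card)
      (fun b hb st hs => ?_) hs
    refine loop_inv (P := fun s => (fs n (s.set 0)).card ≤ 5 * (fs n (s.set 0) ∩ T).card)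
      (fun c hc st hs => ?_) hs
    refine loop_inv (P := fun s => (fs n (s.set 0)).card ≤ 5 * (fs n (s.set 0) ∩ T).card)
      (fun d hd st hs => ?_) hs
    refine loop_inv (P := fun s => (fs n (s.set 0)).card ≤ 5 * (fs n (s.set 0) ∩ T).card)
      (fun e he st hs => ?_) hs
    obtain ⟨ρ', hρ', e₀, e₁, e₂, e₃, e₄⟩ : ∃ ρ', ρ' = update (update (update (update (update
        ρ 0 a) 1 b) 2 c) 3 d) 4 e ∧ ρ' 0 = a ∧ ρ' 1 = b ∧ ρ' 2 = c ∧ ρ' 3 = d ∧ ρ' 4 = e :=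
      ⟨_, rfl, by simp, by simp, by simp, by simp, by simp⟩
    rw [← hρ', eval_packStep, e₀, e₁, e₂, e₃, e₄]
    split_ifs with hif
    · rw [Bool.and_eq_true, eval_bad hA, e₀, e₁, e₂, e₃, e₄] at hif
      obtain ⟨hf, hbad⟩ := hif
      simp only [Fm.fresh, Fm.eval_and, Fm.eval_nt, Fm.eval_mem, e₀, e₁, e₂, e₃, e₄] at hf
      simp at hf
      obtain ⟨x, hxT, hx⟩ := hT a ha b hb c hc d hd e he hbad
      have hxn : x < n := by rcases hx with rfl | rfl | rfl | rfl | rfl <;> assumption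
      have hxS : st.set 0 x = false := by
        rcases hx with rfl | rfl | rfl | rfl | rfl <;> simp [hf]
      simp only [update_self]
      set S' : ℕ → Bool := fun v => st.set 0 v || (decide (v = a) || (decide (v = b) ||
        (decide (v = c) || (decide (v = d) || decide (v = e))))) with hS'
      have h₁ : fs n S' ⊆ fs n (st.set 0) ∪ {a, b, c, d, e} := by
        intro v hv
        rw [mem_fs] at hv
        simp [hS'] at hv
        simp only [Finset.mem_union, mem_fs, Finset.mem_insert, Finset.mem_singleton]
        tauto
      have h₂ : insert x (fs n (st.set 0) ∩ T) ⊆ fs n S' ∩ T := by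
        intro v hv
        rw [Finset.mem_insert, Finset.mem_inter, mem_fs] at hv
        rw [Finset.mem_inter, mem_fs]
        rcases hv with rfl | hv
        · refine ⟨⟨hxn, ?_⟩, hxT⟩
          simp [hS']
          tauto
        · exact ⟨⟨hv.1.1, by simp [hS', hv.1.2]⟩, hv.2⟩
      have h₃ := Finset.card_le_card h₁
      have h₄ := Finset.card_le_card h₂
      rw [Finset.card_insert_of_notMem (by simp [hxS])] at h₄
      have h₅ := (Finset.card_union_le (fs n (st.set 0)) {a, b, c, d, e})
      have h₆ : ({a, b, c, d, e} : Finset ℕ).card ≤ 5 := Finset.card_le_five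
      omega
    · exact hs
  exact key.trans (Nat.mul_le_mul_left _ (Finset.card_le_card Finset.inter_subset_right))

end

section

variable {n : ℕ} {A : ℕ → ℕ → Bool}

/-! ### The Vertex Cover instance -/

/-- Adjacency of the vertices `5` and `4` in the Vertex Cover instance. -/
def Fm.inst : Fm :=
  .and (.nt (.eq 5 4)) <| .or (.and (.mem 6 5) <| .and (.mem 6 4) (.nt (.adj 5 4)))
    (.and (.nt (.mem 6 5)) <| .and (.nt (.mem 6 4)) (.adj 5 4))

/-- Print the adjacency matrix of the Vertex Cover instance. -/
def Cmd.print : Cmd := .loop 5 (.seq (.loop 4 (.emit .inst)) .sep)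

/-- The adjacency matrix of the Vertex Cover instance for the clique side `K`. -/
def instA (A : ℕ → ℕ → Bool) (K : ℕ → Bool) (i j : ℕ) : Bool :=
  !decide (i = j) && ((K i && (K j && !A i j)) || (!K i && (!K j && A i j)))

/-- The output is built by pushing and is therefore reversed; the later transfer to the input stack
of the subroutine reverses it again. -/
theorem eval_print (ρ : Fin 6 → ℕ) (st : St) : Cmd.print.eval n A ρ st =
    { st with out := ((List.range n).flatMap (row n (instA A (st.set 6)))).reverse ++ st.out } := by
  have inner : ∀ i (l : List ℕ) (st : St),
      l.foldl (fun st j => (Cmd.emit .inst).eval n A (update (update ρ 5 i) 4 j) st) st =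
      { st with out := (l.map fun j => some (instA A (st.set 6) i j)).reverse ++ st.out } := by
    intro i l
    induction l with
    | nil => intro st; rfl
    | cons a l ih =>
      intro st
      rw [List.foldl_cons, ih]
      simp [Cmd.eval, Fm.inst, instA]
  have outer : ∀ (l : List ℕ) (st : St),
      l.foldl (fun st i => (Cmd.seq (.loop 4 (.emit .inst)) .sep).eval n A (update ρ 5 i) st) st =
      { st with out := (l.flatMap (row n (instA A (st.set 6)))).reverse ++ st.out } := by
    intro l
    induction l with
    | nil => intro st; rfl
    | cons a l ih =>
      intro st
      rw [List.foldl_cons]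
      have : (Cmd.seq (.loop 4 (.emit .inst)) .sep).eval n A (update ρ 5 a) st =
          { st with out := (row n (instA A (st.set 6)) a).reverse ++ st.out } := by
        have h := inner a (List.range n) st
        have e : (Cmd.seq (.loop 4 (.emit .inst)) .sep).eval n A (update ρ 5 a) st =
          Cmd.sep.eval n A (update ρ 5 a) ((List.range n).foldl
            (fun st j => (Cmd.emit .inst).eval n A (update (update ρ 5 a) 4 j) st) st) := rfl
        rw [e, h]
        simp [Cmd.eval, row]
      rw [this, ih]
      simp
  exact outer _ st

end

/-! ### Solutions in normal form -/

/-- A clique `D true` and an independent set `D false` that cover all but `k` vertices. -/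
structure Sol (n : ℕ) (A : ℕ → ℕ → Bool) (k : ℕ) (D : Bool → Finset ℕ) : Prop where
  lt : ∀ b, ∀ v ∈ D b, v < n
  -- `xor b (A u v)` means that `u` and `v` conflict on the side `b`: they are non-adjacent if `b =
  -- true` and adjacent if `b = false`.
  homog : ∀ b, ∀ u ∈ D b, ∀ v ∈ D b, u ≠ v → xor b (A u v) = false
  disj : ∀ b, ∀ v ∈ D b, v ∉ D !b
  card : (Finset.range n \ (D true ∪ D false)).card ≤ k

section

variable {n : ℕ} {A : ℕ → ℕ → Bool} {k : ℕ}

/-- Vertices of `P b` that are not in `D b` without a reason can be moved to `D b`. -/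
theorem Sol.exists_justified {D : Bool → Finset ℕ} (hD : Sol n A k D) (hA : ∀ u v, A u v = A v u)
    {P : Bool → Finset ℕ} (hP : ∀ b, ∀ v ∈ P b, v ∉ P !b) : ∃ D', Sol n A k D' ∧
      ∀ b, ∀ v ∈ P b, v ∈ D' (!b) → ∃ u ∈ D' b, xor b (A u v) = true ∧ u ≠ v := by
  classical
  induction hN : (P true ∩ D false).card + (P false ∩ D true).card using Nat.strong_induction_on
    generalizing D with
  | _ N ih =>
    by_cases hj : ∀ b, ∀ v ∈ P b, v ∈ D (!b) → ∃ u ∈ D b, xor b (A u v) = true ∧ u ≠ v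
    · exact ⟨D, hD, hj⟩
    push Not at hj
    -- Nothing in `D b` conflicts with `v`, so `v` can change sides. The covered vertices remain the
    -- same and the number of misplaced ones drops.
    obtain ⟨b, v, hvP, hvD, hv⟩ := hj
    set D' : Bool → Finset ℕ := fun c => if c = b then insert v (D b) else (D c).erase v with hD'
    have hb : D' b = insert v (D b) := by simp [hD']
    have hb' : D' (!b) = (D (!b)).erase v := by simp [hD']
    have hun : D' true ∪ D' false = D true ∪ D false := by
      ext x
      by_cases hx : x = v
      · subst hx
        cases b <;> simp_all
      · cases b <;> simp [hD', hx]
    have hvb : v ∉ D b := by simpa using hD.disj (!b) v hvD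
    refine ih ((P true ∩ D' false).card + (P false ∩ D' true).card) ?_ (D := D') ⟨?_, ?_, ?_, ?_⟩ rfl
    · have h₁ : (P b ∩ D' (!b)).card < (P b ∩ D (!b)).card := by
        refine Finset.card_lt_card ?_
        refine Finset.ssubset_iff_of_subset ?_ |>.2 ⟨v, by simp [hvP, hvD], by simp [hb']⟩
        rw [hb']
        exact Finset.inter_subset_inter_left (Finset.erase_subset _ _)
      have h₂ : P (!b) ∩ D' b = P (!b) ∩ D b := by
        rw [hb]
        ext x
        have := hP b v hvP
        simp only [Finset.mem_inter, Finset.mem_insert]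
        constructor
        · rintro ⟨hx, rfl | h⟩
          · exact absurd hx this
          · exact ⟨hx, h⟩
        · exact fun h => ⟨h.1, Or.inr h.2⟩
      rw [← hN]
      cases b
      · simp only [Bool.not_false] at h₁ h₂
        rw [h₂]; omega
      · simp only [Bool.not_true] at h₁ h₂
        rw [h₂]; omega
    · intro c x hx
      have : x ∈ D true ∪ D false := by
        rw [← hun]; cases c <;> simp [hx]
      rcases Finset.mem_union.1 this with h | h
      · exact hD.lt _ x h
      · exact hD.lt _ x h
    · intro c x hx y hy hxy
      by_cases hc : c = b
      · subst hc
        rw [hb, Finset.mem_insert] at hx hy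
        rcases hx with rfl | hx
        · rcases hy with rfl | hy
          · exact absurd rfl hxy
          · rw [hA]
            by_contra hcon
            exact hxy (hv y hy (by simpa using hcon)).symm
        · rcases hy with rfl | hy
          · by_contra hcon
            exact hxy (hv x hx (by simpa using hcon))
          · exact hD.homog c x hx y hy hxy
      · simp only [hD', hc, if_false] at hx hy
        exact hD.homog c x (Finset.mem_of_mem_erase hx) y (Finset.mem_of_mem_erase hy) hxy
    · intro c x hx
      by_cases hc : c = b
      · subst hc
        rw [hb, Finset.mem_insert] at hx
        rw [hb', Finset.mem_erase, not_and]
        intro hxv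
        exact hD.disj c x (hx.resolve_left hxv)
      · have hc' : c = !b := by cases c <;> cases b <;> simp_all
        subst hc'
        rw [hb', Finset.mem_erase] at hx
        rw [Bool.not_not, hb, Finset.mem_insert, not_or]
        refine ⟨hx.1, ?_⟩
        simpa using hD.disj (!b) x hx.2
    · rw [hun]; exact hD.card

/-! ### Few candidates for exceptional vertices -/

/-- The two parts of the split graph outside `X` with clique `C`. -/
def part (X C : ℕ → Bool) (b : Bool) (v : ℕ) : Bool := !X v && xor (!b) (C v)

theorem part_iff {X C : ℕ → Bool} {b : Bool} {v : ℕ} :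
    part X C b v = true ↔ X v = false ∧ C v = b := by
  rw [part, Bool.and_eq_true, Bool.not_eq_true']
  cases b <;> cases C v <;> simp

/-- The vertices of a part that are related to a vertex in `S` with at most `|X|` relatives. -/
def near (n : ℕ) (A : ℕ → ℕ → Bool) (X C : ℕ → Bool) (b : Bool) (S : ℕ → Bool) (v : ℕ) : Bool :=
  part X C b v && decide (∃ u < n, S u = true ∧ xor b (A u v) = true ∧
    (fs n fun w => part X C b w && xor b (A u w)).card ≤ (fs n X).card)

/-- A union over the elements of `S`; those with more than `|X|` relatives are left out, so each
contributes at most `|X|`. -/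
theorem card_near_le (X C : ℕ → Bool) (b : Bool) (S : ℕ → Bool) :
    (fs n (near n A X C b S)).card ≤ (fs n S).card * (fs n X).card := by
  classical
  have : fs n (near n A X C b S) ⊆ ((fs n S).filter fun u =>
      (fs n fun w => part X C b w && xor b (A u w)).card ≤ (fs n X).card).biUnion
      fun u => fs n fun w => part X C b w && xor b (A u w) := by
    intro v hv
    rw [mem_fs, near, Bool.and_eq_true, decide_eq_true_eq] at hv
    obtain ⟨hvn, hv, u, hu, hS, hr, hc⟩ := hv
    rw [Finset.mem_biUnion]
    refine ⟨u, Finset.mem_filter.2 ⟨mem_fs.2 ⟨hu, hS⟩, hc⟩, mem_fs.2 ⟨hvn, by rw [hv, hr]; rfl⟩⟩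
  refine (Finset.card_le_card this).trans ((Finset.card_biUnion_le_card_mul _ _ _ fun u hu =>
    (Finset.mem_filter.1 hu).2).trans (Nat.mul_le_mul_right _ (Finset.card_filter_le _ _)))

/-- Outside `X`, the set `C` is a clique and its complement is independent. -/
def Valid (n : ℕ) (A : ℕ → ℕ → Bool) (X C : ℕ → Bool) : Prop :=
  ∀ u < n, X u = false → ∀ v < n, X v = false → u ≠ v → C u = C v → xor (C u) (A u v) = false

theorem Valid.part {X C : ℕ → Bool} (h : Valid n A X C) {b : Bool} {u v : ℕ} (hu : u < n)
    (hv : v < n) (hu' : part X C b u = true) (hv' : SplitVD.part X C b v = true) (huv : u ≠ v) :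
    xor b (A u v) = false := by
  rw [part_iff] at hu' hv'
  have := h u hu hu'.1 v hv hv'.1 huv (by rw [hu'.2, hv'.2])
  rwa [hu'.2] at this

/-- The set `X` with all candidates for exceptional vertices. -/
def extended (n : ℕ) (A : ℕ → ℕ → Bool) (X C : ℕ → Bool) (v : ℕ) : Bool :=
  X v || (near n A X C false X v || (near n A X C true X v ||
    (near n A X C true (near n A X C false X) v || near n A X C false (near n A X C true X) v)))

/-- With `m = |X|`, the two sets `near … X` have at most `m²` elements, and the two iterated ones at
most `m² * m`. -/
theorem card_extended_le (X C : ℕ → Bool) : (fs n (extended n A X C)).card ≤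
    (fs n X).card + 2 * (fs n X).card ^ 2 + 2 * (fs n X).card ^ 3 := by
  set m := (fs n X).card with hm
  have h₁ := card_near_le (n := n) (A := A) X C false X
  have h₂ := card_near_le (n := n) (A := A) X C true X
  have h₃ := card_near_le (n := n) (A := A) X C true (near n A X C false X)
  have h₄ := card_near_le (n := n) (A := A) X C false (near n A X C true X)
  rw [← hm] at h₁ h₂ h₃ h₄
  have h₃' := h₃.trans (Nat.mul_le_mul_right m h₁)
  have h₄' := h₄.trans (Nat.mul_le_mul_right m h₂)
  have hsub : fs n (extended n A X C) ⊆ fs n X ∪ (fs n (near n A X C false X) ∪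
      (fs n (near n A X C true X) ∪ (fs n (near n A X C true (near n A X C false X)) ∪
        fs n (near n A X C false (near n A X C true X))))) := by
    intro v hv
    simp only [mem_fs, extended, Bool.or_eq_true, Finset.mem_union] at hv ⊢
    tauto
  have c := Finset.card_le_card hsub
  have c₁ := Finset.card_union_le (fs n X) (fs n (near n A X C false X) ∪
      (fs n (near n A X C true X) ∪ (fs n (near n A X C true (near n A X C false X)) ∪
        fs n (near n A X C false (near n A X C true X)))))
  have c₂ := Finset.card_union_le (fs n (near n A X C false X))
      (fs n (near n A X C true X) ∪ (fs n (near n A X C true (near n A X C false X)) ∪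
        fs n (near n A X C false (near n A X C true X))))
  have c₃ := Finset.card_union_le (fs n (near n A X C true X))
      (fs n (near n A X C true (near n A X C false X)) ∪
        fs n (near n A X C false (near n A X C true X)))
  have c₄ := Finset.card_union_le (fs n (near n A X C true (near n A X C false X)))
        (fs n (near n A X C false (near n A X C true X)))
  have e₂ : m ^ 2 = m * m := sq m
  have e₃ : m ^ 3 = m * m * m := by ring
  omega

/-- If there is a solution, then there is one whose sides extend the parts, up to candidates for
exceptional vertices. -/
theorem Sol.exists_extended {D : Bool → Finset ℕ} (hD : Sol n A k D) (hA : ∀ u v, A u v = A v u)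
    {X C : ℕ → Bool} (hv : Valid n A X C) : ∃ D', Sol n A k D' ∧
      ∀ v < n, extended n A X C v = false → ∀ b, v ∈ D' b → C v = b := by
  classical
  -- If `X` is small enough to be deleted, the given partition itself is a solution. Otherwise `|X|
  -- ≥ k + 1`, which is what `few` uses.
  by_cases hk : (fs n X).card ≤ k
  · refine ⟨fun b => fs n (SplitVD.part X C b), ⟨fun b v h => (mem_fs.1 h).1, ?_, ?_, ?_⟩, ?_⟩
    · intro b u hu v hv' huv
      rw [mem_fs] at hu hv'
      exact hv.part hu.1 hv'.1 hu.2 hv'.2 huv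
    · intro b v h₁ h₂
      rw [mem_fs, part_iff] at h₁ h₂
      exact absurd (h₁.2.2.symm.trans h₂.2.2) (by cases b <;> simp)
    · refine (Finset.card_le_card fun v hv => ?_).trans hk
      simp only [Finset.mem_sdiff, Finset.mem_range, Finset.mem_union, mem_fs, part_iff] at hv ⊢
      refine ⟨hv.1, ?_⟩
      by_contra hX
      rw [Bool.not_eq_true] at hX
      refine hv.2 ?_
      cases hc : C v <;> simp [hv.1, hX]
    · intro v _ _ b hb
      exact (part_iff.1 (mem_fs.1 hb).2).2
  push Not at hk
  obtain ⟨D', hD', hj⟩ := hD.exists_justified hA (P := fun b => fs n (SplitVD.part X C b)) (by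
    intro b v h₁ h₂
    rw [mem_fs, part_iff] at h₁ h₂
    exact absurd (h₁.2.2.symm.trans h₂.2.2) (by cases b <;> simp))
  have opp : ∀ {b : Bool} {u v : ℕ}, xor b (A u v) = false → xor (!b) (A u v) = false → False := by
    intro b u v
    cases b <;> cases A u v <;> simp
  -- Two misplaced vertices of the same part would conflict neither on the side `b` nor on the side
  -- `!b`, that is, be both adjacent and non-adjacent.
  have uniq : ∀ b, ∀ x < n, part X C b x = true → x ∈ D' (!b) → ∀ y < n, part X C b y = true →
      y ∈ D' (!b) → x = y := by
    intro b x hx hxP hxD y hy hyP hyD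
    by_contra hne
    exact opp (hv.part hx hy hxP hyP hne) (hD'.homog (!b) x hxD y hyD hne)
  -- Vertices of the part `b` that conflict with `u` cannot be in `D' b`, so they are deleted, at
  -- most `k` of them, or misplaced, at most one by `uniq`. If `u` lies in the part `b` itself, only
  -- `u` can be counted.
  have few : ∀ b, ∀ u ∈ D' b,
      (fs n fun w => SplitVD.part X C b w && xor b (A u w)).card ≤ (fs n X).card := by
    intro b u hu
    by_cases hbu : SplitVD.part X C b u = true
    · have : (fs n fun w => SplitVD.part X C b w && xor b (A u w)) ⊆ {u} := by
        intro w hw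
        rw [mem_fs, Bool.and_eq_true] at hw
        rw [Finset.mem_singleton]
        by_contra hne
        have := hv.part (hD'.lt b u hu) hw.1 hbu hw.2.1 (Ne.symm hne)
        exact absurd (this.symm.trans hw.2.2) (by simp)
      refine (Finset.card_le_card this).trans ?_
      rw [Finset.card_singleton]
      omega
    have hsub : (fs n fun w => SplitVD.part X C b w && xor b (A u w)) ⊆
        (Finset.range n \ (D' true ∪ D' false)) ∪ (fs n (SplitVD.part X C b) ∩ D' (!b)) := by
      intro w hw
      rw [mem_fs, Bool.and_eq_true] at hw
      rw [Finset.mem_union, Finset.mem_inter, mem_fs, Finset.mem_sdiff, Finset.mem_range]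
      by_cases hwb : w ∈ D' b
      · have := hD'.homog b u hu w hwb (by rintro rfl; exact hbu hw.2.1)
        exact absurd (this.symm.trans hw.2.2) (by simp)
      · by_cases hwb' : w ∈ D' (!b)
        · exact Or.inr ⟨⟨hw.1, hw.2.1⟩, hwb'⟩
        · left
          refine ⟨hw.1, ?_⟩
          cases b
          · simp [hwb, show w ∉ D' true from hwb']
          · simp [hwb, show w ∉ D' false from hwb']
    have h1 : (fs n (SplitVD.part X C b) ∩ D' (!b)).card ≤ 1 := by
      rw [Finset.card_le_one]
      intro x hx y hy
      rw [Finset.mem_inter, mem_fs] at hx hy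
      exact uniq b x hx.1.1 hx.1.2 hx.2 y hy.1.1 hy.1.2 hy.2
    have := (Finset.card_le_card hsub).trans (Finset.card_union_le _ _)
    have := hD'.card
    omega
  refine ⟨D', hD', ?_⟩
  -- A misplaced vertex is justified by `X` or by the misplaced vertex of the other part.
  have key : ∀ b, ∀ v < n, part X C b v = true → v ∈ D' (!b) → near n A X C b X v = true ∨
      ∃ u ∈ D' b, u < n ∧ part X C (!b) u = true ∧ xor b (A u v) = true := by
    intro b v hvn hvP hvD
    obtain ⟨u, hu, hr, hne⟩ := hj b v (mem_fs.2 ⟨hvn, hvP⟩) hvD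
    have hun := hD'.lt b u hu
    by_cases hX : X u = true
    · left
      rw [near, hvP, Bool.true_and, decide_eq_true_eq]
      exact ⟨u, hun, hX, hr, few b u hu⟩
    · right
      rw [Bool.not_eq_true] at hX
      refine ⟨u, hu, hun, part_iff.2 ⟨hX, ?_⟩, hr⟩
      by_contra hcon
      have := hv.part hun hvn (part_iff.2 ⟨hX, by cases b <;> simpa using hcon⟩) hvP hne
      exact absurd (this.symm.trans hr) (by simp)
  have main : ∀ b, ∀ v < n, part X C b v = true → v ∈ D' (!b) →
      near n A X C b X v = true ∨ near n A X C b (near n A X C (!b) X) v = true := by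
    intro b v hvn hvP hvD
    rcases key b v hvn hvP hvD with h | ⟨u, hu, hun, huP, hr⟩
    · exact Or.inl h
    rcases key (!b) u hun huP (by simpa using hu) with h | ⟨x, hx, hxn, hxP, hr'⟩
    · right
      rw [near, hvP, Bool.true_and, decide_eq_true_eq]
      exact ⟨u, hun, h, hr, few b u hu⟩
    -- The justification of `v` leads to a misplaced `u` of the other part and from there to a
    -- misplaced `x` of the part of `v`, so `x = v`. But then `u` and `v` conflict on both sides.
    · exfalso
      rw [Bool.not_not] at hxP
      obtain rfl := uniq b x hxn hxP hx v hvn hvP hvD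
      rw [hA] at hr'
      revert hr hr'
      cases b <;> cases A u x <;> simp
  intro v hvn hext b hb
  by_contra hne
  simp only [extended, Bool.or_eq_false_iff] at hext
  obtain ⟨e₀, e₁, e₂, e₃, e₄⟩ := hext
  have hP : part X C (!b) v = true := part_iff.2 ⟨e₀, by cases b <;> simpa using hne⟩
  have := main (!b) v hvn hP (by simpa using hb)
  cases b
  · simp [e₂, e₃] at this
  · simp [e₁, e₄] at this

end

/-! ### Computing the split partition and the candidates -/

/-- The set `3` is a clique outside the set `0`, its complement is independent. -/
def Fm.valid : Fm := .nt <| .ex 0 <| .and (.nt (.mem 0 0)) <| .ex 1 <| .and (.nt (.mem 0 1)) <|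
  .and (.nt (.eq 0 1)) <| .and (.bop (· == ·) (.mem 3 0) (.mem 3 1)) (.bop xor (.mem 3 0) (.adj 0 1))

/-- The vertex `1` is a neighbour of the vertex `p` outside the set `0`. -/
def Fm.nbr (p : Fin 6) : Fm := .and (.nt (.mem 0 1)) (.adj p 1)

/-- Copy the set defined by `φ` to the set `2` if it is a valid clique. -/
def Cmd.attempt (φ : Fm) : Cmd :=
  .seq (.assign 3 0 φ) (.cond .valid (.assign 2 0 (.mem 3 0)) .skip)

/-- Compute a valid clique in the set `2`, by trying all degrees. -/
def Cmd.split : Cmd := .loop 5 <| .seq (.attempt (.nt (.more 1 (.nbr 5) (.nbr 0))))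
  (.attempt (.or (.more 1 (.nbr 0) (.nbr 5)) (.eq 0 5)))

/-- Membership in a part of the split partition. -/
def Fm.part (b : Bool) (p : Fin 6) : Fm := .and (.nt (.mem 0 p)) (if b then .mem 2 p else .nt (.mem 2 p))

/-- Adjacency or its negation. -/
def Fm.rel (b : Bool) (p q : Fin 6) : Fm := if b then .nt (.adj p q) else .adj p q

/-- Relatives of the set `i` with few relatives. -/
def Fm.near (b : Bool) (i : Fin 7) : Fm := .and (.part b 0) <| .ex 1 <| .and (.mem i 1) <|
  .and (.rel b 1 0) (.nt (.more 2 (.and (.part b 2) (.rel b 1 2)) (.mem 0 2)))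

/-- Add the candidates for exceptional vertices to the set `0`. -/
def Cmd.extend : Cmd := .seq (.assign 3 0 (.near false 0)) <| .seq (.assign 4 0 (.near true 0)) <|
  .seq (.assign 5 0 (.near true 3)) <| .seq (.assign 6 0 (.near false 4)) <|
  .assign 0 0 (.or (.mem 0 0) <| .or (.mem 3 0) <| .or (.mem 4 0) <| .or (.mem 5 0) (.mem 6 0))

/-- The computations that do not depend on the tape. -/
def Cmd.setup : Cmd := .seq .pack (.seq .split .extend)

/-- Compute a clique side in the set `6` from the tape. -/
def Cmd.prep : Cmd := .seq (.assign 1 0 (.const false)) <|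
  .seq (.assign 6 0 (.and (.mem 2 0) (.nt (.mem 0 0)))) <| .seq (.assign 5 0 (.mem 0 0)) <|
  .seq (.loop 4 .round) (.assign 6 0 (.or (.mem 6 0) (.and (.mem 5 0) .maj)))

/-- Print a Vertex Cover instance whose clique side is read from the tape. -/
def Cmd.decode : Cmd := .seq .prep .print

section

variable {n : ℕ} {A : ℕ → ℕ → Bool}

/-- The analogue of `loop_reach` for an arbitrary property that later iterations preserve under an
invariant `J`. -/
theorem loop_reach_of {J P : St → Prop} {p : Fin 6} {c : Cmd} {ρ : Fin 6 → ℕ}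
    (hJ : ∀ j < n, ∀ st, J st → J (c.eval n A (update ρ p j) st))
    (hP : ∀ j < n, ∀ st, J st → P st → P (c.eval n A (update ρ p j) st)) {i : ℕ} (hi : i < n)
    (h : ∀ st, J st → P (c.eval n A (update ρ p i) st)) {st : St} (hst : J st) :
    P ((Cmd.loop p c).eval n A ρ st) := by
  rw [eval_loop]
  have : ∀ l : List ℕ, (∀ j ∈ l, j < n) → i ∈ l → ∀ st, J st →
      P (l.foldl (fun st i => c.eval n A (update ρ p i) st) st) := by
    intro l hl hil
    induction l with
    | nil => simp at hil
    | cons a l ih =>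
      intro st hst
      rw [List.foldl_cons]
      by_cases hil' : i ∈ l
      · exact ih (fun j hj => hl j (by simp [hj])) hil' _ (hJ a (hl a (by simp)) st hst)
      · have hia : i = a := by simpa [hil'] using hil
        subst hia
        refine (foldl_inv (P := fun s : St => J s ∧ P s) (fun b hb s hs => ?_)
          ⟨hJ i hi st hst, h st hst⟩).2
        have hbn := hl b (by simp [hb])
        exact ⟨hJ b hbn s hs.1, hP b hbn s hs.1 hs.2⟩
  exact this _ (fun j hj => List.mem_range.1 hj) (List.mem_range.2 hi) st hst

theorem eval_valid (X : Fin 7 → ℕ → Bool) (ρ : Fin 6 → ℕ) :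
    Fm.valid.eval n A X ρ = true ↔ Valid n A (X 0) (X 3) := by
  simp only [Fm.valid, Fm.eval_nt, Fm.eval_ex, Fm.eval_and, Fm.eval_eq, Fm.eval,
    Valid]
  simp only [Bool.not_eq_true', decide_eq_false_iff_not, not_exists, not_and, Bool.and_eq_true,
    decide_eq_true_eq]
  simp only [update_self, ne_eq, not_false_eq_true, update_of_ne, zero_ne_one,
    beq_iff_eq, Bool.not_eq_true]

/-- The set `2` is overwritten by valid candidates only, so a success is never lost in later
attempts. -/
theorem eval_attempt (φ : Fm) (ρ : Fin 6 → ℕ) (st : St) :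
    ((Cmd.attempt φ).eval n A ρ st).set 0 = st.set 0 ∧
    (((Valid n A (st.set 0) fun v => φ.eval n A st.set (update ρ 0 v)) ∨
      Valid n A (st.set 0) (st.set 2)) →
      Valid n A (st.set 0) (((Cmd.attempt φ).eval n A ρ st).set 2)) := by
  have e : (Cmd.attempt φ).eval n A ρ st =
      if Fm.valid.eval n A (update st.set 3 fun v => φ.eval n A st.set (update ρ 0 v)) ρ = true then
        ⟨update (update st.set 3 fun v => φ.eval n A st.set (update ρ 0 v)) 2 fun v =>
          φ.eval n A st.set (update ρ 0 v), st.tape, st.out⟩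
      else ⟨update st.set 3 fun v => φ.eval n A st.set (update ρ 0 v), st.tape, st.out⟩ := by
    simp [Cmd.attempt, Cmd.eval]
  by_cases h : Fm.valid.eval n A (update st.set 3 fun v => φ.eval n A st.set (update ρ 0 v)) ρ = true
  · rw [e, if_pos h]
    rw [eval_valid] at h
    simp only [update_self, ne_eq, Fin.reduceEq, not_false_eq_true, update_of_ne] at h
    refine ⟨by simp, fun _ => ?_⟩
    simpa using h
  · rw [e, if_neg h]
    rw [eval_valid] at h
    simp only [update_self, ne_eq, Fin.reduceEq, not_false_eq_true, update_of_ne] at h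
    refine ⟨by simp, fun h' => ?_⟩
    simpa using h'.resolve_left h

theorem eval_near (b : Bool) (i : Fin 7) (X : Fin 7 → ℕ → Bool) (ρ : Fin 6 → ℕ) (v : ℕ) :
    (Fm.near b i).eval n A X (update ρ 0 v) = near n A (X 0) (X 2) b (X i) v := by
  have hp : ∀ (p : Fin 6) (ρ : Fin 6 → ℕ), (Fm.part b p).eval n A X ρ =
      part (X 0) (X 2) b (ρ p) := by
    intro p ρ
    cases b <;> simp [Fm.part, SplitVD.part]
  have hr : ∀ (p q : Fin 6) (ρ : Fin 6 → ℕ), (Fm.rel b p q).eval n A X ρ = xor b (A (ρ p) (ρ q)) := by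
    intro p q ρ
    cases b <;> simp [Fm.rel]
  simp only [Fm.near, Fm.eval_and, Fm.eval_ex, Fm.eval_more, Fm.eval_nt, Fm.eval_mem, hp, hr,
    countP_range_eq_card, SplitVD.near]
  simp

theorem eval_extend (ρ : Fin 6 → ℕ) (st : St) :
    (Cmd.extend.eval n A ρ st).set 0 = extended n A (st.set 0) (st.set 2) ∧
    (Cmd.extend.eval n A ρ st).set 2 = st.set 2 := by
  simp only [Cmd.extend, Cmd.eval, eval_near]
  refine ⟨?_, by simp⟩
  funext v
  simp [extended]

/-- No command writes on the tape. This bounds what is left of the word after a round, and shows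
that the initial computations leave an empty tape empty. -/
theorem eval_tape_length (c : Cmd) (ρ : Fin 6 → ℕ) (st : St) :
    (c.eval n A ρ st).tape.length ≤ st.tape.length := by
  induction c generalizing ρ st with
  | skip => exact le_rfl
  | seq c d ih₁ ih₂ => exact (ih₂ _ _).trans (ih₁ _ _)
  | assign => exact le_rfl
  | bit c d ih₁ ih₂ =>
    simp only [Cmd.eval]
    split_ifs
    · exact (ih₁ _ _).trans (by simp)
    · exact (ih₂ _ _).trans (by simp)
  | cond φ c d ih₁ ih₂ =>
    simp only [Cmd.eval]
    split_ifs
    · exact ih₁ _ _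
    · exact ih₂ _ _
  | emit => exact le_rfl
  | sep => exact le_rfl
  | loop p c ih =>
    exact foldl_inv (P := fun s : St => s.tape.length ≤ st.tape.length)
      (fun b _ a ha => (ih _ a).trans ha) le_rfl

theorem silent_setup : Cmd.setup.Silent := by
  simp [Cmd.setup, Cmd.pack, Cmd.packStep, Cmd.split, Cmd.attempt, Cmd.extend, Cmd.Silent]

theorem silent_prep : Cmd.prep.Silent := by
  simp [Cmd.prep, Cmd.Silent, Cmd.shrink, Cmd.shrinkStep,
    Cmd.halve, Cmd.round, Cmd.sideC, Cmd.sideI]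

theorem avoids_prep {i : Fin 7} (h₁ : i ≠ 1) (h₅ : i ≠ 5) (h₆ : i ≠ 6) : Cmd.prep.Avoids i := by
  simp [Cmd.prep, Cmd.Avoids, Cmd.shrink, Cmd.shrinkStep,
    Cmd.halve, Cmd.round, Cmd.sideC, Cmd.sideI, h₁, h₅, h₆]

theorem wf_setup : Cmd.setup.WF ∅ := by
  simp [Cmd.setup, Cmd.pack, Cmd.packStep, Cmd.split, Cmd.attempt, Cmd.extend, Cmd.WF, Fm.WF,
    Fm.fresh, Fm.bad, Fm.and, Fm.or, Fm.eq, Fm.valid, Fm.nbr, Fm.near, Fm.part, Fm.rel, Fm.ex]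

theorem wf_decode : Cmd.decode.WF ∅ := by
  simp [Cmd.decode, Cmd.print, Fm.inst, Cmd.prep, Cmd.shrink,
    Cmd.shrinkStep, Cmd.halve, Cmd.round, Cmd.sideC, Cmd.sideI, Cmd.WF, Fm.WF, Fm.and, Fm.or, Fm.eq,
    Fm.const, Fm.big, Fm.ex, Fm.maj]

theorem eval_decode (ρ : Fin 6 → ℕ) (st : St) : Cmd.decode.eval n A ρ st =
    { Cmd.prep.eval n A ρ st with out := ((List.range n).flatMap
      (row n (instA A ((Cmd.prep.eval n A ρ st).set 6)))).reverse ++ st.out } := by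
  have e : Cmd.decode.eval n A ρ st = Cmd.print.eval n A ρ (Cmd.prep.eval n A ρ st) := rfl
  rw [e, eval_print, silent_prep.eval]

/-- The preparation depends on the sets `0, 2, 3, 4` only. -/
theorem eval_prep_congr (ρ : Fin 6 → ℕ) (X : Fin 7 → ℕ → Bool) (st : St)
    (h : ∀ i, i ≠ 1 → i ≠ 5 → i ≠ 6 → st.set i = X i) :
    Cmd.prep.eval n A ρ st = Cmd.prep.eval n A ρ ⟨X, st.tape, st.out⟩ := by
  have h0 := h 0 (by decide) (by decide) (by decide)
  have h2 := h 2 (by decide) (by decide) (by decide)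
  have h3 := h 3 (by decide) (by decide) (by decide)
  have h4 := h 4 (by decide) (by decide) (by decide)
  have e : ∀ st : St, Cmd.prep.eval n A ρ st =
      (Cmd.seq (.loop 4 .round) (.assign 6 0 (.or (.mem 6 0) (.and (.mem 5 0) .maj)))).eval n A ρ
      ⟨update (update (update st.set 1 fun _ => false) 6 fun v => st.set 2 v && !st.set 0 v) 5
        (st.set 0), st.tape, st.out⟩ := by
    intro st
    simp [Cmd.prep, Cmd.eval]
  rw [e st, e ⟨X, st.tape, st.out⟩]
  congr 2
  funext i
  fin_cases i <;> simp [h0, h2, h3, h4]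

variable {G : SimpleGraph ℕ} (hA : ∀ i j, A i j = true ↔ G.Adj i j)
include hA

theorem card_nbr (S : ℕ → Bool) (v : ℕ) : (fs n fun u => !S u && A v u).card =
    degIn G (Finset.range n \ fs n S) v := by
  classical
  unfold degIn
  congr 1
  ext u
  simp only [mem_fs, Bool.and_eq_true, Bool.not_eq_true', hA, Finset.mem_filter, Finset.mem_sdiff,
    Finset.mem_range, not_and, Bool.not_eq_true]
  tauto

/-- The graph outside the set `0` has no bad tuple, hence is split, and `exists_threshold` gives a
vertex `z` for which one of the two candidates tried in the iteration of `z` is a valid clique. -/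
theorem valid_split (ρ : Fin 6 → ℕ) (st : St)
    (hS : ∀ a < n, ∀ b < n, ∀ c < n, ∀ d < n, ∀ e < n, Bad G a b c d e →
      ∃ x, (x = a ∨ x = b ∨ x = c ∨ x = d ∨ x = e) ∧ st.set 0 x = true) :
    (Cmd.split.eval n A ρ st).set 0 = st.set 0 ∧
    Valid n A (st.set 0) ((Cmd.split.eval n A ρ st).set 2) := by
  classical
  have hstep : ∀ ρ (s : St), s.set 0 = st.set 0 →
      ((Cmd.seq (.attempt (.nt (.more 1 (.nbr 5) (.nbr 0))))
        (.attempt (.or (.more 1 (.nbr 0) (.nbr 5)) (.eq 0 5)))).eval n A ρ s).set 0 = st.set 0 :=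
    fun ρ s hs => ((eval_attempt _ ρ _).1.trans (eval_attempt _ ρ s).1).trans hs
  refine ⟨loop_inv (P := fun s => s.set 0 = st.set 0) (fun i _ s => hstep _ s) rfl, ?_⟩
  set W := Finset.range n \ fs n (st.set 0) with hW
  have hmW : ∀ v, v ∈ W ↔ v < n ∧ st.set 0 v = false := by
    intro v
    rw [hW, Finset.mem_sdiff, mem_fs, Finset.mem_range]
    constructor
    · rintro ⟨h₁, h₂⟩; exact ⟨h₁, by simpa [h₁] using h₂⟩
    · rintro ⟨h₁, h₂⟩; exact ⟨h₁, by simp [h₂]⟩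
  obtain ⟨C₀, hCW, hcl, hin, hmax⟩ := exists_split_of_no_bad (G := G) W (by
    intro a ha b hb c hc d hd e he hbad
    rw [hmW] at ha hb hc hd he
    obtain ⟨x, hx, hSx⟩ := hS a ha.1 b hb.1 c hc.1 d hd.1 e he.1 hbad
    rcases hx with rfl | rfl | rfl | rfl | rfl <;> simp_all)
  have hval : ∀ S : ℕ → Bool, (∀ v ∈ W, S v = true ↔ v ∈ C₀) → Valid n A (st.set 0) S := by
    intro S hS u hu hu0 v hv hv0 huv h
    have huW := (hmW u).2 ⟨hu, hu0⟩
    have hvW := (hmW v).2 ⟨hv, hv0⟩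
    cases hb : S u
    · rw [hb] at h
      rw [Bool.false_xor, ← Bool.not_eq_true, hA]
      exact hin u huW (by rw [← hS u huW, hb]; simp) v hvW (by rw [← hS v hvW, ← h]; simp)
    · rw [hb] at h
      rw [Bool.true_xor, Bool.not_eq_false', hA]
      exact hcl ((hS u huW).1 hb) ((hS v hvW).1 h.symm) huv
  by_cases hne : C₀.Nonempty
  swap
  -- A maximal clique is empty only if there are no vertices outside the set `0`, and then every set
  -- is valid.
  · rw [Finset.not_nonempty_iff_eq_empty] at hne
    refine hval _ fun v hv => ?_
    obtain ⟨c, hc, _⟩ := hmax v hv (by simp [hne])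
    simp [hne] at hc
  obtain ⟨z, hz, hzC⟩ := exists_threshold hCW hcl hin hmax hne
  have deg : ∀ (p : Fin 6), p ≠ 1 → ∀ (X : Fin 7 → ℕ → Bool) (ρ : Fin 6 → ℕ), X 0 = st.set 0 →
      (List.range n).countP (fun u => (Fm.nbr p).eval n A X (update ρ 1 u)) = degIn G W (ρ p) := by
    intro p hp X ρ hX
    rw [countP_range_eq_card, ← card_nbr hA]
    congr 2
    funext u
    simp [Fm.nbr, hX, hp]
  refine loop_reach_of (J := fun s => s.set 0 = st.set 0)
    (P := fun s => Valid n A (st.set 0) (s.set 2)) (fun i _ s => hstep _ s) ?_ ((hmW z).1 hz).1 ?_ rfl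
  · intro j _ s hs hP
    have h₁ := eval_attempt (n := n) (A := A) (.nt (.more 1 (.nbr 5) (.nbr 0))) (update ρ 5 j) s
    have h₂ := eval_attempt (n := n) (A := A) (.or (.more 1 (.nbr 0) (.nbr 5)) (.eq 0 5))
      (update ρ 5 j) ((Cmd.attempt (.nt (.more 1 (.nbr 5) (.nbr 0)))).eval n A (update ρ 5 j) s)
    rw [h₁.1, hs] at h₂
    rw [hs] at h₁
    exact h₂.2 (Or.inr (h₁.2 (Or.inr hP)))
  · intro s hs
    have h₁ := eval_attempt (n := n) (A := A) (.nt (.more 1 (.nbr 5) (.nbr 0))) (update ρ 5 z) s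
    have h₂ := eval_attempt (n := n) (A := A) (.or (.more 1 (.nbr 0) (.nbr 5)) (.eq 0 5))
      (update ρ 5 z) ((Cmd.attempt (.nt (.more 1 (.nbr 5) (.nbr 0)))).eval n A (update ρ 5 z) s)
    rw [h₁.1, hs] at h₂
    rw [hs] at h₁
    rcases hzC with h | h
    · refine h₂.2 (Or.inr (h₁.2 (Or.inl (hval _ fun v hv => ?_))))
      rw [h v hv, Fm.eval_nt, Fm.eval_more, deg 5 (by decide) _ _ hs, deg 0 (by decide) _ _ hs]
      simp
    · refine h₂.2 (Or.inl (hval _ fun v hv => ?_))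
      have hs' := (eval_attempt (n := n) (A := A) (.nt (.more 1 (.nbr 5) (.nbr 0)))
        (update ρ 5 z) s).1.trans hs
      rw [h v hv, Fm.eval_or, Fm.eval_more, deg 5 (by decide) _ _ hs', deg 0 (by decide) _ _ hs']
      simp

theorem symm_of_adj (u v : ℕ) : A u v = A v u := by
  rw [Bool.eq_iff_iff, hA, hA, SimpleGraph.adj_comm]

/-- The result of the tape-independent computations. -/
theorem setup_spec {k : ℕ} {D : Bool → Finset ℕ} (hD : Sol n A k D) (ρ : Fin 6 → ℕ) (st : St)
    (hst : ∀ v, st.set 0 v = false) : (∃ m ≤ 5 * k,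
      (fs n ((Cmd.setup.eval n A ρ st).set 0)).card ≤ m + 2 * m ^ 2 + 2 * m ^ 3) ∧
    ∃ D', Sol n A k D' ∧ ∀ v < n, (Cmd.setup.eval n A ρ st).set 0 v = false →
      ∀ b, v ∈ D' b → (Cmd.setup.eval n A ρ st).set 2 v = b := by
  -- The deleted vertices meet all bad tuples, since a clique and an independent set do not cover
  -- one.
  have hcard := pack_card_le hA (Finset.range n \ (D true ∪ D false)) (by
    intro a ha b hb c hc d hd e he hbad
    by_contra! hcon
    refine hbad.not_covered (C := D true) (I := D false) (fun u hu v hv huv => ?_)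
      (fun u hu v hv huv => ?_) fun x hx => ?_
    · rw [← hA]
      simpa using hD.homog true u hu v hv huv
    · show ¬ G.Adj u v
      rw [← hA]
      simpa using hD.homog false u hu v hv huv
    · have hxn : x < n := by rcases hx with rfl | rfl | rfl | rfl | rfl <;> assumption
      by_contra hx'
      have := hcon x (by simpa [hxn] using hx')
      tauto) ρ st hst
  set s₁ := Cmd.pack.eval n A ρ st with hs₁
  obtain ⟨h0, hv⟩ := valid_split hA ρ s₁ fun a ha b hb c hc d hd e he hbad =>
    pack_maximal hA ρ st ha hb hc hd he hbad
  set s₂ := Cmd.split.eval n A ρ s₁ with hs₂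
  have e : Cmd.setup.eval n A ρ st = Cmd.extend.eval n A ρ s₂ := rfl
  obtain ⟨h0', h2⟩ := eval_extend (n := n) (A := A) ρ s₂
  rw [h0] at h0'
  rw [e, h0', h2]
  refine ⟨⟨_, ?_, card_extended_le _ _⟩, hD.exists_extended (symm_of_adj hA) hv⟩
  exact hcard.trans (Nat.mul_le_mul_left _ hD.card)

omit hA in
/-- Some tape leads to a clique side that separates the two sides of a solution. -/
theorem exists_tape {k : ℕ} {D : Bool → Finset ℕ} (hD : Sol n A k D) (hirr : ∀ v, A v v = false)
    (X : Fin 7 → ℕ → Bool) (hX : ∀ v < n, X 0 v = false → ∀ b, v ∈ D b → X 2 v = b) :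
    ∃ w : List Bool, w.length ≤ Nat.size (fs n (X 0)).card * (2 + Nat.clog 2 (fs n (X 0)).card) ∧
      ∀ j out, ∀ v < n, ∀ b, v ∈ D b → (Cmd.prep.eval n A (fun _ => 0)
        ⟨X, w ++ List.replicate j false, out⟩).set 6 v = b := by
  set X₁ : Fin 7 → ℕ → Bool := update (update (update X 1 fun _ => false) 6
    fun v => X 2 v && !X 0 v) 5 (X 0) with hX₁
  have e₀ : X₁ 0 = X 0 := by simp [hX₁]
  have e₅ : X₁ 5 = X 0 := by simp [hX₁]
  have e₆ : ∀ v, X₁ 6 v = (X 2 v && !X 0 v) := by simp [hX₁]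
  -- Outside the set `0` the sides are known from the set `2`; all of the set `0` starts undecided.
  have hsep : Sep n (D true) (D false) X₁ := by
    intro v hv
    rw [e₀, e₅, e₆]
    cases h0 : X 0 v
    · exact ⟨fun h => by simp [hX v hv h0 _ h], fun h => by simp [hX v hv h0 _ h], by simp⟩
    · exact ⟨by simp, by simp, by simp⟩
  have hn : (fs n (X 0)).card ≤ n := card_fs_le _
  obtain ⟨w, hw, h⟩ := round_list (A := A) (fun _ => 0)
    (fun u hu v hv huv => by simpa using hD.homog true u hu v hv huv)
    (fun u hu v hv => by
      by_cases huv : u = v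
      · rw [huv, hirr]
      · simpa using hD.homog false u hu v hv huv)
    (Finset.disjoint_left.2 fun v hv => hD.disj true v hv) (List.range n) X₁ hsep
    -- `Nat.size m` is the least `r` with `m < 2 ^ r`. It is at most `n` for `m ≤ n < 2 ^ n`, so the
    -- `n` iterations of the loop offer enough rounds.
    (Nat.size (fs n (X 0)).card) (by rw [e₅]; exact Nat.lt_size_self _) (by
      rw [List.length_range, Nat.size_le]
      exact hn.trans_lt Nat.lt_two_pow_self)
  rw [e₀] at hw
  refine ⟨w, hw, fun j out v hv b hb => ?_⟩
  obtain ⟨X₂, j', hev, hsep', hterm⟩ := h j out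
  have hfin : (Cmd.prep.eval n A (fun _ => 0) ⟨X, w ++ List.replicate j false, out⟩).set 6 =
      fun v => X₂ 6 v || (X₂ 5 v && decide ((fs n fun u => X₂ 5 u && !A v u).card <
        (fs n fun u => X₂ 5 u && A v u).card)) := by
    have e : Cmd.prep.eval n A (fun _ => 0) ⟨X, w ++ List.replicate j false, out⟩ =
        (Cmd.assign 6 0 (.or (.mem 6 0) (.and (.mem 5 0) .maj))).eval n A (fun _ => 0)
        ((List.range n).foldl (fun st i => Cmd.round.eval n A (update (fun _ => 0) 4 i) st)
        ⟨X₁, w ++ List.replicate j false, out⟩) := by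
      simp [Cmd.prep, Cmd.eval, hX₁]
    rw [e, hev]
    funext v
    simp only [Cmd.eval, Fm.maj, update_self, Fm.eval_or, Fm.eval_and, Fm.eval_mem, Fm.eval_more,
      countP_range_eq_card, Fm.eval_adj, Fm.eval_nt]
    simp
  rw [hfin]
  obtain ⟨a, b', c⟩ := hsep' v hv
  cases b
  · cases h : X₂ 5 v
    · simp [b' hb, h]
    · have := (hterm v hv h).2 hb
      simp only [b' hb, Bool.false_or, h, Bool.true_and]
      simpa using this
  · rcases a hb with h | h
    · simp [h]
    · have := (hterm v hv h).1 hb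
      simp [h, this]

end

section

variable {n : ℕ}

/-! ### Graphs on initial segments of the natural numbers -/

/-- The graph as a graph on the natural numbers. -/
def natGraph (G : SimpleGraph (Fin n)) : SimpleGraph ℕ := G.map Fin.valEmbedding

open Classical in
/-- The adjacency matrix, extended by zeros. -/
noncomputable def adjB (G : SimpleGraph (Fin n)) (i j : ℕ) : Bool := decide ((natGraph G).Adj i j)

theorem adjB_iff (G : SimpleGraph (Fin n)) (i j : ℕ) :
    adjB G i j = true ↔ (natGraph G).Adj i j := by simp [adjB]

theorem natGraph_adj (G : SimpleGraph (Fin n)) (i j : Fin n) :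
    (natGraph G).Adj i j ↔ G.Adj i j :=
  SimpleGraph.map_adj_apply (f := Fin.valEmbedding)

theorem flatMap_finRange {α : Type*} (f : ℕ → List α) :
    (List.finRange n).flatMap (fun i : Fin n => f i) = (List.range n).flatMap f := by
  rw [← List.map_coe_finRange_eq_range, List.flatMap_map]

theorem map_finRange {α : Type*} (f : ℕ → α) :
    (List.finRange n).map (fun i : Fin n => f i) = (List.range n).map f := by
  rw [← List.map_coe_finRange_eq_range, List.map_map]; rfl

theorem encode_eq (G : SimpleGraph (Fin n)) (k : ℕ) (A : ℕ → ℕ → Bool)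
    (hA : ∀ i j : Fin n, A i j = true ↔ G.Adj i j) :
    encode G k = k.bits.map some ++ none :: (List.range n).flatMap (row n A) := by
  rw [encode, ← flatMap_finRange]
  congr 2
  refine List.flatMap_congr fun i _ => ?_
  rw [row, ← map_finRange]
  congr 1
  refine List.map_congr_left fun j _ => ?_
  congr 1
  rw [Bool.eq_iff_iff, hA i j]
  simp

theorem encode_adjB (G : SimpleGraph (Fin n)) (k : ℕ) :
    encode G k = k.bits.map some ++ none :: (List.range n).flatMap (row n (adjB G)) :=
  encode_eq G k _ fun i j => by rw [adjB_iff, natGraph_adj]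

theorem length_rows (A : ℕ → ℕ → Bool) :
    ((List.range n).flatMap (row n A)).length = n * (n + 1) := by
  simp [row, List.length_flatMap]

/-- The Vertex Cover instance for the clique side `K`. -/
def inst (G : SimpleGraph (Fin n)) (K : ℕ → Bool) : SimpleGraph (Fin n) where
  Adj i j := instA (adjB G) K i j = true
  symm := ⟨fun i j h => by
    have e : adjB G i j = adjB G j i := by
      rw [Bool.eq_iff_iff, adjB_iff, adjB_iff, SimpleGraph.adj_comm]
    have e' : decide ((i : ℕ) = j) = decide ((j : ℕ) = i) := by simp [eq_comm]
    simp only [instA, e, e'] at h ⊢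
    rw [← h]
    cases K i <;> cases K j <;> rfl⟩
  loopless := ⟨fun i h => by simp [instA] at h⟩

theorem encode_inst (G : SimpleGraph (Fin n)) (K : ℕ → Bool) (k : ℕ) : encode (inst G K) k =
    k.bits.map some ++ none :: (List.range n).flatMap (row n (instA (adjB G) K)) :=
  encode_eq _ k _ fun _ _ => Iff.rfl

theorem inst_adj {G : SimpleGraph (Fin n)} {K : ℕ → Bool} {i j : Fin n} : (inst G K).Adj i j ↔
    i ≠ j ∧ ((K i = true ∧ K j = true ∧ ¬ G.Adj i j) ∨ (K i = false ∧ K j = false ∧ G.Adj i j)) := by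
  have h : adjB G i j = true ↔ G.Adj i j := by rw [adjB_iff, natGraph_adj]
  show instA (adjB G) K i j = true ↔ _
  rw [← h]
  simp [instA, Fin.val_inj]

/-- A vertex cover of the instance leaves a split graph. -/
theorem svd_of_vertexCover {G : SimpleGraph (Fin n)} {K : ℕ → Bool} {k : ℕ}
    (h : VertexCover n (inst G K) k) : SplitVertexDeletion n G k := by
  obtain ⟨S, hS, hc⟩ := h
  have hno : ∀ u v : Fin n, u ∉ S → v ∉ S → ¬ (inst G K).Adj u v := by
    intro u v hu hv huv
    rcases hc huv with h | h
    · exact hu h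
    · exact hv h
  refine ⟨S, hS, {v | K v.1 = true}, {v | K v.1 = false}, ?_, ?_, ?_, ?_⟩
  · ext v
    simp
  · rw [Set.disjoint_left]
    intro v h₁ h₂
    simp only [Set.mem_ofPred_eq] at h₁ h₂
    simp [h₁] at h₂
  · intro u hu v hv huv
    by_contra hcon
    refine hno u.1 v.1 u.2 v.2 (inst_adj.2 ⟨fun e => huv (Subtype.ext e), Or.inl ⟨hu, hv, ?_⟩⟩)
    simpa using hcon
  · intro u hu v hv huv hadj
    refine hno u.1 v.1 u.2 v.2 (inst_adj.2 ⟨fun e => huv (Subtype.ext e), Or.inr ⟨hu, hv, ?_⟩⟩)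
    simpa using hadj

/-- The partition of the split graph that remains after a deletion. -/
theorem exists_sol {G : SimpleGraph (Fin n)} {k : ℕ} (h : SplitVertexDeletion n G k) :
    ∃ D, Sol n (adjB G) k D := by
  classical
  obtain ⟨S, hS, C, I, hun, hdisj, hC, hI⟩ := h
  set P : Bool → Set ((S : Set (Fin n))ᶜ : Set (Fin n)) := fun b => if b then C else I with hP
  set D : Bool → Finset ℕ := fun b => (Finset.univ.filter fun v : Fin n =>
    ∃ h : v ∈ ((S : Set (Fin n))ᶜ), ⟨v, h⟩ ∈ P b).map Fin.valEmbedding with hD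
  have mD : ∀ b x, x ∈ D b ↔ ∃ (v : Fin n) (h : v ∈ ((S : Set (Fin n))ᶜ)), ⟨v, h⟩ ∈ P b ∧ x = v := by
    intro b x
    simp only [hD, Finset.mem_map, Finset.mem_filter, Finset.mem_univ, true_and,
      Fin.valEmbedding_apply]
    constructor
    · rintro ⟨v, ⟨h, hv⟩, rfl⟩; exact ⟨v, h, hv, rfl⟩
    · rintro ⟨v, h, hv, rfl⟩; exact ⟨v, ⟨h, hv⟩, rfl⟩
  have hadj : ∀ u v : Fin n, adjB G u v = true ↔ G.Adj u v := fun u v => by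
    rw [adjB_iff, natGraph_adj]
  refine ⟨D, fun b x hx => ?_, fun b x hx y hy hxy => ?_, fun b x hx hx' => ?_, ?_⟩
  · obtain ⟨v, _, _, rfl⟩ := (mD b x).1 hx
    exact v.2
  · obtain ⟨u, hu, hu', rfl⟩ := (mD b x).1 hx
    obtain ⟨v, hv, hv', rfl⟩ := (mD b y).1 hy
    have hne : (⟨u, hu⟩ : ((S : Set (Fin n))ᶜ : Set (Fin n))) ≠ ⟨v, hv⟩ := fun e =>
      hxy (congrArg (fun w => (w.1 : ℕ)) e)
    cases b
    · rw [Bool.false_xor, ← Bool.not_eq_true, hadj]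
      simpa using hI (by simpa [hP] using hu') (by simpa [hP] using hv') hne
    · rw [Bool.true_xor, Bool.not_eq_false', hadj]
      simpa using hC (by simpa [hP] using hu') (by simpa [hP] using hv') hne
  · obtain ⟨u, hu, hu', rfl⟩ := (mD b x).1 hx
    obtain ⟨v, hv, hv', e⟩ := (mD _ _).1 hx'
    obtain rfl := Fin.val_injective e
    cases b
    · exact Set.disjoint_left.1 hdisj (by simpa [hP] using hv') (by simpa [hP] using hu')
    · exact Set.disjoint_left.1 hdisj (by simpa [hP] using hu') (by simpa [hP] using hv')
  · refine le_trans ?_ hS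
    rw [← Finset.card_map Fin.valEmbedding]
    refine Finset.card_le_card fun x hx => ?_
    simp only [Finset.mem_sdiff, Finset.mem_range, Finset.mem_union, not_or, mD] at hx
    obtain ⟨hxn, h₁, h₂⟩ := hx
    by_contra hcon
    have hxS : (⟨x, hxn⟩ : Fin n) ∉ S := fun h =>
      hcon (Finset.mem_map.2 ⟨⟨x, hxn⟩, h, rfl⟩)
    have : (⟨⟨x, hxn⟩, hxS⟩ : ((S : Set (Fin n))ᶜ : Set (Fin n))) ∈ C ∪ I := hun ▸ Set.mem_univ _
    rcases this with h | h
    · exact h₁ ⟨⟨x, hxn⟩, hxS, by simpa [hP] using h, rfl⟩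
    · exact h₂ ⟨⟨x, hxn⟩, hxS, by simpa [hP] using h, rfl⟩

/-- A solution is a vertex cover of the instance if the clique side separates its two sides. -/
theorem vertexCover_of_sol {G : SimpleGraph (Fin n)} {k : ℕ} {D : Bool → Finset ℕ}
    (hD : Sol n (adjB G) k D) {K : ℕ → Bool} (hK : ∀ v < n, ∀ b, v ∈ D b → K v = b) :
    VertexCover n (inst G K) k := by
  classical
  have hadj : ∀ u v : Fin n, adjB G u v = true ↔ G.Adj u v := fun u v => by
    rw [adjB_iff, natGraph_adj]
  refine ⟨Finset.univ.filter fun v : Fin n => ∀ b, (v : ℕ) ∉ D b, ?_, fun u v huv => ?_⟩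
  · refine le_trans ?_ hD.card
    rw [← Finset.card_map Fin.valEmbedding]
    refine Finset.card_le_card fun x hx => ?_
    obtain ⟨v, hv, rfl⟩ := Finset.mem_map.1 hx
    have := (Finset.mem_filter.1 hv).2
    simp [this]
  · by_contra! hcon
    simp only [Finset.coe_filter, Finset.mem_univ, true_and, Set.mem_ofPred_eq, not_forall,
      not_not] at hcon
    obtain ⟨⟨b, hb⟩, c, hc⟩ := hcon
    have hu := hK u u.2 b hb
    have hv := hK v v.2 c hc
    obtain ⟨hne, h⟩ := inst_adj.1 huv
    rw [← hadj, hu, hv] at h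
    have hbc : c = b := by cases b <;> cases c <;> simp at h ⊢
    subst hbc
    have := hD.homog c u hb v hc fun e => hne (Fin.val_injective e)
    clear hadj hK
    cases c <;> simp_all

/-! ### The reduction -/

/-- The clique side that is read from the tape `w`. -/
def side (n : ℕ) (A : ℕ → ℕ → Bool) (X : Fin 7 → ℕ → Bool) (out : List (Option Bool))
    (w : List Bool) : ℕ → Bool :=
  (Cmd.prep.eval n A (fun _ => 0) ⟨X, w, out⟩).set 6

/-- The number of tape bits that suffice. -/
def tapeLen (k : ℕ) : ℕ := 120 + k.bits.length * (72 + 9 * k.bits.length)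

/-- Split Vertex Deletion reduces to a disjunction of Vertex Cover instances. -/
theorem svd_iff (G : SimpleGraph (Fin n)) (k : ℕ) (ρ : Fin 6 → ℕ) (st : St)
    (hst : ∀ v, st.set 0 v = false) (out : List (Option Bool)) : SplitVertexDeletion n G k ↔
    ∃ w : List Bool, w.length = tapeLen k ∧ VertexCover n
      (inst G (side n (adjB G) (Cmd.setup.eval n (adjB G) ρ st).set out w)) k := by
  -- Soundness holds for every tape, so nothing has to be checked about the packing when no solution
  -- exists; size bounds matter for completeness only.
  refine ⟨fun h => ?_, fun ⟨w, _, hw⟩ => svd_of_vertexCover hw⟩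
  obtain ⟨D₀, hD₀⟩ := exists_sol h
  obtain ⟨⟨m, hm, hcard⟩, D, hD, hsep⟩ := setup_spec (adjB_iff G) hD₀ ρ st hst
  set X := (Cmd.setup.eval n (adjB G) ρ st).set with hX
  obtain ⟨w, hw, hside⟩ := exists_tape hD (fun v => by
    rw [← Bool.not_eq_true, adjB_iff]; exact (natGraph G).irrefl) X hsep
  set l := k.bits.length with hl
  have hkl : k < 2 ^ l := by rw [hl, Nat.size_eq_bits_len]; exact Nat.lt_size_self k
  -- As `m ≤ 5 * 2 ^ l`, the bound is at most `(5 + 50 + 250) * 8 ^ l`, which is less than `2 ^ 10 *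
  -- 8 ^ l`.
  have hpow : (fs n (X 0)).card < 2 ^ (3 * l + 10) := by
    have h₁ : m ≤ 5 * 2 ^ l := by omega
    have h₂ : m ^ 2 ≤ (5 * 2 ^ l) ^ 2 := Nat.pow_le_pow_left h₁ 2
    have h₃ : m ^ 3 ≤ (5 * 2 ^ l) ^ 3 := Nat.pow_le_pow_left h₁ 3
    have h₄ : 1 ≤ 2 ^ l := Nat.one_le_two_pow
    have h₅ : (2 ^ l) ^ 2 ≤ (2 ^ l) ^ 3 := Nat.pow_le_pow_right h₄ (by norm_num)
    have h₆ : 2 ^ l ≤ (2 ^ l) ^ 3 := Nat.le_self_pow (by norm_num) _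
    have h₇ : 2 ^ (3 * l + 10) = 1024 * (2 ^ l) ^ 3 := by ring
    have h₈ : (5 * 2 ^ l) ^ 2 = 25 * (2 ^ l) ^ 2 := by ring
    have h₉ : (5 * 2 ^ l) ^ 3 = 125 * (2 ^ l) ^ 3 := by ring
    omega
  have h₁ : Nat.size (fs n (X 0)).card ≤ 3 * l + 10 := Nat.size_le.2 hpow
  have h₂ : Nat.clog 2 (fs n (X 0)).card ≤ 3 * l + 10 := Nat.clog_le_of_le_pow hpow.le
  -- `(3l + 10)(2 + 3l + 10) = 120 + 66l + 9l²`, which `tapeLen` rounds up to `120 + 72l + 9l²`.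
  have hB : w.length ≤ tapeLen k := by
    refine hw.trans ((Nat.mul_le_mul h₁ (Nat.add_le_add_left h₂ 2)).trans ?_)
    unfold tapeLen
    rw [← hl]
    nlinarith
  exact ⟨w ++ List.replicate (tapeLen k - w.length) false, by simp; omega,
    vertexCover_of_sol hD fun v hv b hb => hside _ out v hv b hb⟩

end

/-! ### Simulation of a machine by a program -/

section Simulation

variable {K Λ σ : Type} {Γ : K → Type}

/-- The stacks of the simulation: the stacks of the machine, and one for its control state. -/
abbrev SimΓ (Γ : K → Type) (Λ σ : Type) : Option K → Type
  | none => Option Λ × σ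
  | some k => Γ k

/-- The stacks that represent a configuration. -/
def simStk (c : Turing.TM2.Cfg Γ Λ σ) : Stk (SimΓ Γ Λ σ)
  | none => [(c.l, c.var)]
  | some k => c.stk k

/-- The stacks that represent a configuration whose control state has been removed. -/
def openStk (s : ∀ k, List (Γ k)) : Stk (SimΓ Γ Λ σ)
  | none => []
  | some k => s k

/-- The working stacks next to those of the simulated machine. -/
abbrev AllΓ (Γ : K → Type) (Λ σ : Type) : Reg ⊕ Option K → Type := Sum.elim RegΓ (SimΓ Γ Λ σ)

/-- The simulation of a statement with known internal state. -/
def simStmt : Turing.TM2.Stmt Γ Λ σ → σ → Prog (AllΓ Γ Λ σ)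
  | .push k f q, v => .seq (.push (Sum.inr (some k)) (f v)) (simStmt q v)
  | .peek k f q, v => .case (Sum.inr (some k)) fun x => simStmt q (f v x)
  | .pop k f q, v => .case (Sum.inr (some k)) fun x =>
    .seq (.pop (Sum.inr (some k))) (simStmt q (f v x))
  | .load a q, v => simStmt q (a v)
  | .branch f q₁ q₂, v => if f v then simStmt q₁ v else simStmt q₂ v
  | .goto f, v => .push (Sum.inr none) (some (f v), v)
  | .halt, v => .push (Sum.inr none) (none, v)

/-- A bound for the number of steps of the simulation of a statement. -/
def simTime : Turing.TM2.Stmt Γ Λ σ → ℕ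
  | .push _ _ q => simTime q + 2
  | .peek _ _ q => simTime q + 2
  | .pop _ _ q => simTime q + 2
  | .load _ q => simTime q
  | .branch _ q₁ q₂ => simTime q₁ + simTime q₂
  | .goto _ => 1
  | .halt => 1

/-- The control state is not that of a halted machine. -/
def running : Option (Option Λ × σ) → Bool
  | some (some _, _) => true
  | _ => false

/-- The simulation of one step. -/
def simStep (m : Λ → Turing.TM2.Stmt Γ Λ σ) : Prog (AllΓ Γ Λ σ) :=
  .case (Sum.inr none) fun (x : Option (Option Λ × σ)) => match x with
    | some (some l, v) => .seq (.pop (Sum.inr none)) (simStmt (m l) v)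
    | _ => .skip

/-- The simulation until the machine halts. -/
def simLoop (m : Λ → Turing.TM2.Stmt Γ Λ σ) : Prog (AllΓ Γ Λ σ) :=
  .loop (Sum.inr none) running (simStep m)

theorem size_simStk [Fintype K] (c : Turing.TM2.Cfg Γ Λ σ) :
    size (simStk c) = 1 + ∑ k, (c.stk k).length := by
  rw [size, Fintype.sum_option]
  rfl

variable [DecidableEq K]

theorem openStk_update (s : ∀ k, List (Γ k)) (k : K) (l : List (Γ k)) :
    (openStk (update s k l) : Stk (SimΓ Γ Λ σ)) = update (openStk s) (some k) l := by
  refine eq_update_iff.2 ⟨update_self (β := fun k => List (Γ k)) k l s, fun x hx => ?_⟩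
  rcases x with _ | x
  · rfl
  · exact update_of_ne (fun h => hx (congrArg some h)) l s

theorem simStk_eq (c : Turing.TM2.Cfg Γ Λ σ) :
    simStk c = update (openStk c.stk) none [(c.l, c.var)] := by
  refine eq_update_iff.2 ⟨rfl, fun x hx => ?_⟩
  rcases x with _ | x
  · exact absurd rfl hx
  · rfl

/-- The internal state is a parameter of the program instead of data: reading a letter branches into
copies of the program, one for each resulting state. Only the final state is written to the control
stack. -/
theorem simStmt_exec (q : Turing.TM2.Stmt Γ Λ σ) (v : σ) (s : ∀ k, List (Γ k)) (r : Stk RegΓ) :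
    Exec (fun _ => True) (simStmt q v) (join r (openStk s))
      (join r (simStk (Turing.TM2.stepAux q v s))) (simTime q) := by
  induction q generalizing v s with
  | push k f q ih =>
    have h := ih v (update s k (f v :: s k))
    rw [openStk_update, join_update_right] at h
    exact (Exec.seq (.push trivial) h).mono (by simp only [simTime]; omega)
  | peek k f q ih =>
    exact (Exec.case trivial (ih (f v (s k).head?) s)).mono (by simp only [simTime]; omega)
  | pop k f q ih =>
    have h := ih (f v (s k).head?) (update s k (s k).tail)
    rw [openStk_update, join_update_right] at h
    exact (Exec.case trivial (Exec.seq (.pop trivial) h)).mono (by simp only [simTime]; omega)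
  | load a q ih => exact ih (a v) s
  | branch f q₁ q₂ ih₁ ih₂ =>
    simp only [simStmt, simTime, Turing.TM2.stepAux]
    cases f v
    · exact (ih₂ v s).mono (by omega)
    · exact (ih₁ v s).mono (by omega)
  | goto f =>
    simp only [simStmt, simTime, Turing.TM2.stepAux, simStk_eq, join_update_right]
    exact .push trivial
  | halt =>
    simp only [simStmt, simTime, Turing.TM2.stepAux, simStk_eq, join_update_right]
    exact .push trivial

theorem simStep_exec {m : Λ → Turing.TM2.Stmt Γ Λ σ} {D : ℕ} (hD : ∀ l, simTime (m l) + 2 ≤ D)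
    {c d : Turing.TM2.Cfg Γ Λ σ} (h : Turing.TM2.step m c = some d) (r : Stk RegΓ) :
    running (simStk c none).head? = true ∧
      Exec (fun _ => True) (simStep m) (join r (simStk c)) (join r (simStk d)) D := by
  obtain ⟨_ | l, v, s⟩ := c
  · cases h
  simp only [Turing.TM2.step, Option.some.injEq] at h
  subst h
  refine ⟨rfl, ?_⟩
  have e := simStmt_exec (m l) v s r
  have hpop : Exec (fun _ => True) (.pop (Sum.inr none)) (join r (simStk ⟨some l, v, s⟩))
      (join r (openStk s)) 1 := by
    have h : join r (openStk s) = join r (update (simStk ⟨some l, v, s⟩) none []) := by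
      rw [simStk_eq, update_idem]
      exact congrArg _ (update_eq_self none (openStk s : Stk (SimΓ Γ Λ σ))).symm
    rw [h, join_update_right]
    exact Exec.pop trivial
  exact (Exec.case trivial (hpop.seq e)).mono (by have := hD l; omega)

end Simulation

theorem Machine.exists_simTime (M : Machine) : ∃ D, ∀ l, simTime (M.tm.m l) + 2 ≤ D := by
  have := M.tm.ΛFin
  obtain ⟨D, hD⟩ := (Set.finite_range fun l => simTime (M.tm.m l) + 2).bddAbove
  exact ⟨D, fun l => hD ⟨l, rfl⟩⟩

/-- The initial configuration. -/
def Machine.start (M : Machine) (w : List (Option Bool)) :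
    Turing.TM2.Cfg M.tm.Γ M.tm.Λ M.tm.σ :=
  letI := M.tm.kDecidableEq
  ⟨some M.tm.main, M.tm.initialState, update (fun _ => []) M.tm.k₀ (w.map M.inputAlphabet.symm)⟩

theorem Machine.init_eq (M : Machine) (w : List (Option Bool)) : M.init w = M.start w :=
  letI := M.tm.kDecidableEq
  congrArg (Turing.TM2.Cfg.mk _ _) (eq_update_iff.2 ⟨dif_pos rfl, fun _ hk => dif_neg hk⟩)

/-- The simulation of a complete run. -/
theorem Machine.simLoop_exec (M : Machine) {D : ℕ} (hD : ∀ l, simTime (M.tm.m l) + 2 ≤ D)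
    {w : List (Option Bool)} {b : Bool} {T S : ℝ} (h : M.Answers w b T S) (r : Stk RegΓ) :
    letI := M.tm.kDecidableEq
    letI := M.tm.kFin
    ∃ c : Turing.TM2.Cfg M.tm.Γ M.tm.Λ M.tm.σ, (c.stk M.tm.k₁).head? = some (M.outputAlphabet.symm b) ∧
      M.size c ≤ ⌊S⌋₊ ∧ w.length ≤ ⌊S⌋₊ ∧ 1 ≤ ⌊T⌋₊ ∧
      Exec (fun x => SplitVD.size x ≤ SplitVD.size r + 1 + ⌊S⌋₊ + D) (simLoop M.tm.m) (join r (simStk (M.start w)))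
        (join r (simStk c)) (⌊T⌋₊ * (D + 1) + 1) := by
  let _ := M.tm.kDecidableEq
  let _ := M.tm.kFin
  have hrun0 : M.run w 0 = some (M.start w) := congrArg some (M.init_eq w)
  obtain ⟨⟨t, (c : Turing.TM2.Cfg M.tm.Γ M.tm.Λ M.tm.σ), ht, hrun, hl, hout⟩, hsize⟩ := h
  have hdef : ∀ i ≤ t, ∃ d, M.run w i = some d := by
    intro i hi
    induction hi using Nat.decreasingInduction with
    | of_succ i hi ih =>
      obtain ⟨d, hd⟩ := ih
      rw [Machine.run_succ] at hd
      cases hr : M.run w i with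
      | none => rw [hr] at hd; cases hd
      | some e => exact ⟨e, rfl⟩
    | self => exact ⟨c, hrun⟩
  set f : ℕ → Turing.TM2.Cfg M.tm.Γ M.tm.Λ M.tm.σ := fun i => (M.run w i).getD c with hf
  have hfi : ∀ i ≤ t, M.run w i = some (f i) := by
    intro i hi
    obtain ⟨d, hd⟩ := hdef i hi
    show _ = some ((M.run w i).getD c)
    rw [hd]
    rfl
  have hfl : ∀ i ≤ t, SplitVD.size (simStk (f i)) ≤ 1 + ⌊S⌋₊ := by
    intro i hi
    rw [size_simStk]
    exact Nat.add_le_add_left (Nat.le_floor (hsize i _ (hfi i hi))) 1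
  have hf0 : f 0 = M.start w := by
    have := hfi 0 (Nat.zero_le _)
    rw [hrun0] at this
    exact (Option.some.inj this).symm
  have hft : f t = c := by
    have := hfi t le_rfl
    rw [hrun] at this
    exact (Option.some.inj this).symm
  have hsc : M.size c ≤ ⌊S⌋₊ := Nat.le_floor (hsize t c hrun)
  have hs0 : M.size (M.start w) ≤ ⌊S⌋₊ := Nat.le_floor (hsize 0 _ hrun0)
  have hlen : w.length ≤ M.size (M.start w) := by
    have h1 : w.length = ((M.start w).stk M.tm.k₀).length := by
      simp [Machine.start]
    rw [h1]
    exact Finset.single_le_sum (f := fun k => ((M.start w).stk k).length) (fun _ _ => Nat.zero_le _)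
      (Finset.mem_univ M.tm.k₀)
  -- The initial configuration is not a halted one, so every admissible time bound is at least 1.
  have ht1 : 1 ≤ t := by
    by_contra hcon
    have h0 : t = 0 := by omega
    rw [h0] at hft
    rw [hf0] at hft
    rw [← hft] at hl
    cases hl
  have htT : t ≤ ⌊T⌋₊ := Nat.le_floor ht
  refine ⟨c, hout, hsc, hlen.trans hs0, ht1.trans htT, ?_⟩
  -- Between two simulated configurations the memory grows by at most `D` beyond that of the
  -- machine, so the space bound does not involve the running time.
  have key := Exec.loop_count (B := fun x => SplitVD.size x ≤ SplitVD.size r + 1 + ⌊S⌋₊ + D) (k := Sum.inr none)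
    (p := running) (P := simStep M.tm.m) (fun i => join r (simStk (f i))) t D
    (fun i hi => by
      have := hfl i hi
      show SplitVD.size (join r (simStk (f i))) ≤ _
      rw [size_join]; omega)
    (fun i hi => by
      have hstep : Turing.TM2.step M.tm.m (f i) = some (f (i + 1)) := by
        have h1 := hfi (i + 1) hi
        rw [Machine.run_succ, hfi i hi.le] at h1
        exact h1
      obtain ⟨h1, h2⟩ := simStep_exec hD hstep r
      refine ⟨h1, h2.bounded ?_⟩
      have := hfl i hi.le
      rw [size_join]; omega)
    (by
      show running (simStk (f t) none).head? = false
      rw [hft]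
      obtain ⟨l, v, s⟩ := c
      cases hl
      rfl)
  rw [hf0, hft] at key
  exact key.mono (by gcongr)

/-! ### Loops over the letters of a stack -/

section

variable {K : Type} {Γ : K → Type} [DecidableEq K]

/-- Remove the letters of a stack one by one, and run a program for each. -/
def each (k : K) (P : Γ k → Prog Γ) : Prog Γ :=
  .loop k Option.isSome (.case k fun
    | none => .skip
    | some x => .seq (.pop k) (P x))

/-- The relation `R` is built from the end of the loop: one step is prefixed to whatever relation
holds between the state after it and the final state. No closed form of the intermediate states is
needed. -/
theorem each_exec {k : K} {P : Γ k → Prog Γ} {T : ℕ} (R : Stk Γ → Stk Γ → Prop)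
    (hnil : ∀ s, s k = [] → R s s)
    (hcons : ∀ s x l, s k = x :: l → ∃ s₁, Exec (fun _ => True) (P x) (update s k l) s₁ T ∧
      s₁ k = l ∧ ∀ s₂, R s₁ s₂ → R s s₂) (s : Stk Γ) :
    ∃ s', Exec (fun _ => True) (each k P) s s' ((s k).length * (T + 3) + 1) ∧ R s s' := by
  generalize hl : s k = l
  induction l generalizing s with
  | nil => exact ⟨s, (Exec.loop_done trivial (by rw [hl]; rfl)).mono (by omega), hnil s hl⟩
  | cons x l ih =>
    obtain ⟨s₁, h₁, hk, hR⟩ := hcons s x l hl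
    obtain ⟨s₂, h₂, hR'⟩ := ih s₁ hk
    have hpop : Exec (fun _ => True) (.pop k) s (update s k l) 1 := by
      have h := Exec.pop (B := fun _ => True) (k := k) (s := s) trivial
      rwa [hl, List.tail_cons] at h
    refine ⟨s₂, (Exec.loop_step trivial (by rw [hl]; rfl) (.case trivial ?_) h₂).mono
      (t := (1 + T) + 1 + (l.length * (T + 3) + 1) + 1) ?_, hR s₂ hR'⟩
    · rw [hl]
      exact hpop.seq h₁
    · rw [List.length_cons]
      ring_nf
      omega

/-- Push copies of a letter. -/
def pushN (k : K) (a : Γ k) : ℕ → Prog Γ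
  | 0 => .skip
  | N + 1 => .seq (.push k a) (pushN k a N)

theorem pushN_exec (k : K) (a : Γ k) (N : ℕ) (s : Stk Γ) : Exec (fun _ => True) (pushN k a N) s
    (update s k (List.replicate N a ++ s k)) (N + 1) := by
  induction N generalizing s with
  | zero =>
    show Exec _ Prog.skip s (update s k (s k)) 1
    rw [update_eq_self]
    exact .skip trivial
  | succ N ih =>
    have h := ih (update s k (a :: s k))
    rw [update_idem, update_self] at h
    have e : List.replicate N a ++ a :: s k = List.replicate (N + 1) a ++ s k := by
      rw [List.replicate_succ', List.append_assoc]; rfl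
    rw [e] at h
    exact (Exec.seq (.push trivial) h).mono (by omega)

/-- Push several letters. -/
def pushes : List (Σ k, Γ k) → Prog Γ
  | [] => .skip
  | x :: l => .seq (.push x.1 x.2) (pushes l)

theorem pushes_exec (l : List (Σ k, Γ k)) (s : Stk Γ) : Exec (fun _ => True) (pushes l) s
    (l.foldl (fun s x => update s x.1 (x.2 :: s x.1)) s) (l.length + 1) := by
  induction l generalizing s with
  | nil => exact Exec.skip trivial
  | cons x l ih => exact (Exec.seq (.push trivial) (ih _)).mono (by simp; omega)

end

/-- Move the letters of a stack to two stacks. -/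
def dup (k a b : Reg) : Prog RegΓ := each k fun x => .seq (.push a x) (.push b x)

theorem go_dup {s s' : Stk RegΓ} {k a b : Reg} (hd : [k, a, b].Nodup) (hk : s' k = [])
    (ha : s' a = (s k).reverse ++ s a) (hb : s' b = (s k).reverse ++ s b)
    (ho : ∀ x, x ≠ k → x ≠ a → x ≠ b → s' x = s x) : Go (dup k a b) s s' ((s k).length * 5 + 1) := by
  simp only [List.nodup_cons, List.mem_cons, not_or, List.not_mem_nil, not_false_eq_true,
    List.nodup_nil, and_true] at hd
  obtain ⟨⟨h₁, h₂⟩, h₃⟩ := hd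
  obtain ⟨s'', h, e₁, e₂, e₃, e₄⟩ := each_exec (Γ := RegΓ) (k := k) (T := 2)
    (P := fun x => Prog.seq (.push a x) (.push b x))
    (fun s s' => s' k = [] ∧ s' a = (s k).reverse ++ s a ∧ s' b = (s k).reverse ++ s b ∧
      ∀ x, x ≠ k → x ≠ a → x ≠ b → s' x = s x)
    (fun s hs => ⟨hs, by simp [hs], by simp [hs], fun _ _ _ _ => rfl⟩)
    (fun s x l hs => ⟨_, Exec.seq (.push trivial) (.push trivial), by simp [h₁, h₂], by
      rintro s₂ ⟨e₁, e₂, e₃, e₄⟩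
      refine ⟨e₁, ?_, ?_, fun y y₁ y₂ y₃ => ?_⟩
      · rw [e₂, hs]; simp [h₁, h₂, h₃, Ne.symm h₁]
      · rw [e₃, hs]; simp [h₁, h₂, Ne.symm h₂, Ne.symm h₃]
      · rw [e₄ y y₁ y₂ y₃]; simp [y₁, y₂, y₃]⟩) s
  have : s' = s'' := by
    funext x
    by_cases x₁ : x = k
    · rw [x₁, hk, e₁]
    by_cases x₂ : x = a
    · rw [x₂, ha, e₂]
    by_cases x₃ : x = b
    · rw [x₃, hb, e₃]
    rw [ho x x₁ x₂ x₃, e₄ x x₁ x₂ x₃]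
  rw [this]
  exact h

/-! ### Counting in binary -/

/-- The binary word of length `B` and value `i`, least significant bit first. -/
def word : ℕ → ℕ → List Bool
  | 0, _ => []
  | B + 1, i => decide (i % 2 = 1) :: word B (i / 2)

theorem length_word (B i : ℕ) : (word B i).length = B := by
  induction B generalizing i with
  | zero => rfl
  | succ B ih => simp [word, ih]

theorem word_zero (B : ℕ) : word B 0 = List.replicate B false := by
  induction B with
  | zero => rfl
  | succ B ih => simp [word, ih, List.replicate_succ]

theorem exists_word (w : List Bool) : ∃ i < 2 ^ w.length, w = word w.length i := by
  induction w with
  | nil => exact ⟨0, by simp, rfl⟩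
  | cons b w ih =>
    obtain ⟨i, hi, h⟩ := ih
    refine ⟨2 * i + b.toNat, ?_, ?_⟩
    · have := b.toNat_le
      rw [List.length_cons, pow_succ]; omega
    · rw [List.length_cons, word]
      have h₁ : (2 * i + b.toNat) / 2 = i := by cases b <;> simp; omega
      have h₂ : decide ((2 * i + b.toNat) % 2 = 1) = b := by cases b <;> simp
      rw [h₁, h₂, ← h]

/-- The least significant bit comes first, so the carry runs through the initial block of ones. -/
theorem word_succ {B i : ℕ} (hi : i < 2 ^ B) :
    (i + 1 = 2 ^ B ∧ word B i = List.replicate B true) ∨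
    (i + 1 < 2 ^ B ∧ ∃ j r, word B i = List.replicate j true ++ false :: r ∧
      word B (i + 1) = List.replicate j false ++ true :: r) := by
  induction B generalizing i with
  | zero => left; simp at hi; simp [hi, word]
  | succ B ih =>
    rw [pow_succ] at hi ⊢
    rcases Nat.mod_two_eq_zero_or_one i with h | h
    · right
      refine ⟨by omega, 0, word B (i / 2), ?_, ?_⟩
      · simp [word, h]
      · have h₁ : (i + 1) / 2 = i / 2 := by omega
        have h₂ : (i + 1) % 2 = 1 := by omega
        simp [word, h₁, h₂]
    · have h₁ : (i + 1) / 2 = i / 2 + 1 := by omega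
      have h₂ : (i + 1) % 2 = 0 := by omega
      rcases ih (i := i / 2) (by omega) with ⟨h₃, h₄⟩ | ⟨h₃, j, r, h₄, h₅⟩
      · left
        exact ⟨by omega, by simp [word, h, h₄, List.replicate_succ]⟩
      · right
        refine ⟨by omega, j + 1, r, ?_, ?_⟩
        · simp [word, h, h₄, List.replicate_succ]
        · simp [word, h₁, h₂, h₅, List.replicate_succ]

/-- The letter `true`. -/
def isTrue (x : Option (Option Bool)) : Bool := x == some (some true)

/-- Replace the word on the stack `ext 0` by its successor; remove the flag on the stack `ext 5` if
there is none. -/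
def increment : Prog RegΓ :=
  .seq (mvWhile isTrue (.ext 0) .ta) <| .seq (.case (.ext 0) fun
    | none => .pop (.ext 5)
    | some _ => .seq (.pop (.ext 0)) (.push (.ext 0) (some true)))
  (each .ta fun _ => .push (.ext 0) (some false))

theorem go_return (s : Stk RegΓ) : Go (each .ta fun _ => .push (.ext 0) (some false)) s
    (update (update s .ta []) (.ext 0) (List.replicate (s .ta).length (some false) ++ s (.ext 0)))
    ((s .ta).length * 4 + 1) := by
  obtain ⟨s', h, hs⟩ := each_exec (Γ := RegΓ) (k := .ta) (T := 1)
    (P := fun _ => .push (.ext 0) (some false))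
    (fun s s' => s' = update (update s .ta []) (.ext 0)
      (List.replicate (s .ta).length (some false) ++ s (.ext 0)))
    (fun s hs => by
      refine (update_eq_iff.2 ⟨by simp [hs], fun x hx => ?_⟩).symm
      rw [← hs, update_eq_self])
    (fun s x l hs => ⟨_, .push trivial, by simp, by
      rintro s₂ rfl
      rw [hs]
      funext y
      by_cases y₁ : y = .ext 0
      · subst y₁; simp [List.replicate_succ']
      by_cases y₂ : y = .ta
      · subst y₂; simp
      simp [y₁, y₂]⟩) s
  rwa [hs] at h

theorem go_increment_some {s s' : Stk RegΓ} {j : ℕ} {r : List (Option Bool)}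
    (hs : s (.ext 0) = List.replicate j (some true) ++ some false :: r) (hta : s .ta = [])
    (h₀ : s' (.ext 0) = List.replicate j (some false) ++ some true :: r)
    (h₁ : ∀ x, x ≠ .ext 0 → s' x = s x) : Go increment s s' (j * 8 + 10) := by
  have g₁ : Go (mvWhile isTrue (.ext 0) .ta) s (update (update s (.ext 0) (some false :: r)) .ta
      (List.replicate j (some true))) (j * 4 + 1) := by
    have h := go_mvWhile (p := isTrue) (s := s)
      (s' := update (update s (.ext 0) (some false :: r)) .ta (List.replicate j (some true)))
      (k := .ext 0) (k' := .ta) (by decide) hs (by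
        intro a ha; rw [List.eq_of_mem_replicate ha]; rfl) rfl (by simp) (by simp [hta])
      (by intro x h₁ h₂; simp [h₁, h₂])
    rwa [List.length_replicate] at h
  set s₁ := update (update s (.ext 0) (some false :: r)) .ta (List.replicate j (some true)) with hs₁
  have g₂ : Go (.case (.ext 0) fun
      | none => .pop (.ext 5)
      | some _ => .seq (.pop (.ext 0)) (.push (.ext 0) (some true))) s₁
      (update s₁ (.ext 0) (some true :: r)) 3 := by
    refine Exec.case trivial ?_
    have e : s₁ (.ext 0) = some false :: r := by simp [hs₁]
    rw [e]
    have h := (go_pop s₁ (.ext 0)).seq (go_push _ (.ext 0) (some true))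
    rw [update_idem, update_self, e] at h
    exact h
  have g₃ := go_return (update s₁ (.ext 0) (some true :: r))
  have e : s' = update (update (update s₁ (.ext 0) (some true :: r)) .ta []) (.ext 0)
      (List.replicate (update s₁ (.ext 0) (some true :: r) .ta).length (some false) ++
        update s₁ (.ext 0) (some true :: r) (.ext 0)) := by
    refine eq_update_iff.2 ⟨by simp [h₀, hs₁], fun x hx => ?_⟩
    by_cases hx' : x = .ta
    · subst hx'; rw [h₁ _ hx, hta]; simp
    · rw [h₁ x hx]; simp [hx, hx', hs₁]
  rw [e]
  refine (g₁.seq (g₂.seq g₃)).mono ?_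
  simp [hs₁]
  omega

/-- The overflow marks the end of the enumeration: the word returns to zero, and the removal of the
flag stops the main loop. -/
theorem go_increment_none {s : Stk RegΓ} {j : ℕ}
    (hs : s (.ext 0) = List.replicate j (some true)) (hta : s .ta = []) (hf : s (.ext 5) = [some true]) :
    Go increment s (update (update s (.ext 5) []) (.ext 0) (List.replicate j (some false)))
      (j * 8 + 10) := by
  have g₁ : Go (mvWhile isTrue (.ext 0) .ta) s (update (update s (.ext 0) []) .ta
      (List.replicate j (some true))) (j * 4 + 1) := by
    have h := go_mvWhile (p := isTrue) (s := s)
      (s' := update (update s (.ext 0) []) .ta (List.replicate j (some true)))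
      (k := .ext 0) (k' := .ta) (by decide) (l := List.replicate j (some true)) (r := [])
      (by simpa using hs) (by
        intro a ha; rw [List.eq_of_mem_replicate ha]; rfl) rfl (by simp) (by simp [hta])
      (by intro x h₁ h₂; simp [h₁, h₂])
    rwa [List.length_replicate] at h
  set s₁ := update (update s (.ext 0) []) .ta (List.replicate j (some true)) with hs₁
  have g₂ : Go (.case (.ext 0) fun
      | none => .pop (.ext 5)
      | some _ => .seq (.pop (.ext 0)) (.push (.ext 0) (some true))) s₁
      (update s₁ (.ext 5) []) 2 := by
    refine Exec.case trivial ?_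
    have e : s₁ (.ext 0) = [] := by simp [hs₁]
    rw [e]
    have h := go_pop s₁ (.ext 5)
    have e' : s₁ (.ext 5) = [some true] := by simp [hs₁, hf]
    rw [e'] at h
    exact h
  have g₃ := go_return (update s₁ (.ext 5) [])
  have e : update (update s (.ext 5) []) (.ext 0) (List.replicate j (some false)) =
      update (update (update s₁ (.ext 5) []) .ta []) (.ext 0)
      (List.replicate (update s₁ (.ext 5) [] .ta).length (some false) ++
        update s₁ (.ext 5) [] (.ext 0)) := by
    funext x
    by_cases x₁ : x = .ext 0
    · subst x₁; simp [hs₁]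
    by_cases x₂ : x = .ta
    · subst x₂; simp [hta]
    by_cases x₃ : x = .ext 5
    · subst x₃; simp
    simp [hs₁, x₁, x₂, x₃]
  rw [e]
  refine (g₁.seq (g₂.seq g₃)).mono ?_
  simp [hs₁]
  omega

/-! ### Products in unary -/

/-- Move letters, and run a program for each of them. -/
def mvEach (k k' : Reg) (Q : Prog RegΓ) : Prog RegΓ := each k fun x => .seq (.push k' x) Q

/-- Multiplication in unary: `Q` adds `N` letters once for each letter moved. The invariant `J`
records what `Q` needs to know about other stacks when it is itself a loop. -/
theorem go_mvEach {k k' : Reg} {Q : Prog RegΓ} {N T : ℕ} (hd : [k, k', .ext 0].Nodup)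
    (J : Stk RegΓ → Prop) (hJ : ∀ s x l, (x = k ∨ x = k' ∨ x = .ext 0) → J s → J (update s x l))
    (hQ : ∀ s, J s → Go Q s (update s (.ext 0) (List.replicate N (some false) ++ s (.ext 0))) T)
    (s : Stk RegΓ) (hs : J s) : Go (mvEach k k' Q) s
      (update (update (update s k []) k' ((s k).reverse ++ s k')) (.ext 0)
        (List.replicate ((s k).length * N) (some false) ++ s (.ext 0)))
      ((s k).length * (T + 4) + 1) := by
  simp only [List.nodup_cons, List.mem_cons, not_or, List.not_mem_nil, not_false_eq_true,
    List.nodup_nil, and_true] at hd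
  obtain ⟨⟨h₁, h₂⟩, h₃⟩ := hd
  generalize hl : s k = l
  induction l generalizing s with
  | nil =>
    have e : update (update (update s k []) k' ([].reverse ++ s k')) (.ext 0)
        (List.replicate (([] : List (Option Bool)).length * N) (some false) ++ s (.ext 0)) = s := by
      rw [← hl]
      simp only [hl, List.reverse_nil, List.nil_append, List.length_nil, Nat.zero_mul,
        List.replicate_zero]
      funext y
      by_cases y₁ : y = .ext 0
      · subst y₁; simp
      by_cases y₂ : y = k'
      · subst y₂; simp [y₁]
      by_cases y₃ : y = k
      · subst y₃; simp [y₁, y₂, hl]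
      simp [y₁, y₂, y₃]
    rw [e]
    exact (Exec.loop_done trivial (by rw [hl]; rfl)).mono (by omega)
  | cons x l ih =>
    set s₁ := update (update s k l) k' (x :: s k') with hs₁
    set s₂ := update s₁ (.ext 0) (List.replicate N (some false) ++ s₁ (.ext 0)) with hs₂
    have hJ₁ : J s₁ := hJ _ _ _ (by simp) (hJ _ _ _ (by simp) hs)
    have g := hQ s₁ hJ₁
    have g' := ih s₂ (hJ _ _ _ (by simp) hJ₁) (by simp [hs₂, hs₁, h₁, h₂])
    have e : update (update (update s₂ k []) k' (l.reverse ++ s₂ k')) (.ext 0)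
        (List.replicate (l.length * N) (some false) ++ s₂ (.ext 0)) =
        update (update (update s k []) k' ((x :: l).reverse ++ s k')) (.ext 0)
        (List.replicate ((x :: l).length * N) (some false) ++ s (.ext 0)) := by
      funext y
      by_cases y₁ : y = .ext 0
      · subst y₁
        simp [hs₂, hs₁, Ne.symm h₂, Ne.symm h₃, ← List.append_assoc, List.replicate_append_replicate,
          Nat.add_mul]
      by_cases y₂ : y = k'
      · subst y₂; simp [hs₂, hs₁, h₃]
      by_cases y₃ : y = k
      · subst y₃; simp [h₁, h₂]
      simp [hs₂, hs₁, y₁, y₂, y₃]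
    rw [e] at g'
    have hpush := go_push (update s k l) k' x
    have ek : update s k l k' = s k' := update_of_ne (Ne.symm h₁) _ _
    rw [ek] at hpush
    have hpop := go_pop s k
    rw [hl, List.tail_cons] at hpop
    refine (Exec.loop_step (t := 1 + (1 + T) + 1) trivial (by rw [hl]; rfl) (.case trivial ?_) g').mono ?_
    · rw [hl]
      exact hpop.seq (hpush.seq g)
    · rw [List.length_cons]
      ring_nf
      omega

/-- Push the word of zeros on the stack `ext 0`; its length depends on the length of `ext 1` and
`ext 3`. -/
def zeros : Prog RegΓ :=
  .seq (pushN (.ext 0) (some false) 120) <|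
  .seq (mvEach (.ext 1) .ta <| .seq (pushN (.ext 0) (some false) 72) <|
    .seq (mvEach (.ext 3) .tp (pushN (.ext 0) (some false) 9)) (mvAll .tp (.ext 3)))
  (mvAll .ta (.ext 1))

/-- Two nested loops compute `120 + l * (72 + 9 * l)` in unary. They are driven by two copies of the
parameter, as one stack cannot drive both loops. -/
theorem go_zeros (s : Stk RegΓ) (h₀ : s (.ext 0) = []) (ha : s .ta = []) (hp : s .tp = []) :
    Go zeros s (update s (.ext 0) (List.replicate
      (120 + (s (.ext 1)).length * (72 + 9 * (s (.ext 3)).length)) (some false)))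
      (300 + (s (.ext 1)).length * (100 + 20 * (s (.ext 3)).length)) := by
  have inner : ∀ u : Stk RegΓ, (u .tp = [] ∧ u (.ext 3) = s (.ext 3)) →
      Go (.seq (pushN (.ext 0) (some false) 72) <|
        .seq (mvEach (.ext 3) .tp (pushN (.ext 0) (some false) 9)) (mvAll .tp (.ext 3))) u
      (update u (.ext 0) (List.replicate (72 + 9 * (s (.ext 3)).length) (some false) ++ u (.ext 0)))
      (75 + 18 * (s (.ext 3)).length) := by
    rintro u ⟨hup, hu3⟩
    set u₁ := update u (.ext 0) (List.replicate 72 (some false) ++ u (.ext 0)) with hu₁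
    have g₁ : Go _ u u₁ _ := pushN_exec (.ext 0) (some false) 72 u
    have g₂ := go_mvEach (k := .ext 3) (k' := .tp) (N := 9) (T := 10) (by decide) (fun _ => True)
      (fun _ _ _ _ _ => trivial) (fun s _ => pushN_exec (Γ := RegΓ) (.ext 0) (some false) 9 s) u₁ trivial
    have e3 : u₁ (.ext 3) = s (.ext 3) := by simp [hu₁, hu3]
    have ep : u₁ .tp = [] := by simp [hu₁, hup]
    rw [e3, ep] at g₂
    set u₂ := update (update (update u₁ (.ext 3) []) .tp ((s (.ext 3)).reverse ++ [])) (.ext 0)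
      (List.replicate ((s (.ext 3)).length * 9) (some false) ++ u₁ (.ext 0)) with hu₂
    have g₃ := go_mvAll (s := u₂) (s' := update u (.ext 0)
      (List.replicate (72 + 9 * (s (.ext 3)).length) (some false) ++ u (.ext 0)))
      (k := .tp) (k' := .ext 3) (by decide) (by simp [hup]) (by simp [hu₂, hu3]) (by
        intro x x₁ x₂
        by_cases x₃ : x = .ext 0
        · subst x₃
          simp only [hu₂, hu₁, update_self, ← List.append_assoc, List.replicate_append_replicate]
          congr 2
          omega
        · simp [hu₂, hu₁, x₁, x₂, x₃])
    refine (g₁.seq (g₂.seq g₃)).mono ?_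
    have : (u₂ .tp).length = (s (.ext 3)).length := by simp [hu₂]
    rw [this]
    omega
  set s₁ := update s (.ext 0) (List.replicate 120 (some false) ++ s (.ext 0)) with hs₁
  have g₁ : Go _ s s₁ _ := pushN_exec (.ext 0) (some false) 120 s
  have g₂ := go_mvEach (k := .ext 1) (k' := .ta) (N := 72 + 9 * (s (.ext 3)).length) (by decide)
    (fun u => u .tp = [] ∧ u (.ext 3) = s (.ext 3))
    (by rintro u x l (rfl | rfl | rfl) ⟨h₁, h₂⟩ <;> simp [h₁, h₂]) inner s₁
    (by simp [hs₁, hp])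
  have e1 : s₁ (.ext 1) = s (.ext 1) := by simp [hs₁]
  have ea : s₁ .ta = [] := by simp [hs₁, ha]
  rw [e1, ea] at g₂
  set s₂ := update (update (update s₁ (.ext 1) []) .ta ((s (.ext 1)).reverse ++ [])) (.ext 0)
      (List.replicate ((s (.ext 1)).length * (72 + 9 * (s (.ext 3)).length)) (some false) ++
        s₁ (.ext 0)) with hs₂
  have g₃ := go_mvAll (s := s₂) (s' := update s (.ext 0) (List.replicate
      (120 + (s (.ext 1)).length * (72 + 9 * (s (.ext 3)).length)) (some false)))
      (k := .ta) (k' := .ext 1) (by decide) (by simp [ha]) (by simp [hs₂]) (by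
        intro x x₁ x₂
        by_cases x₃ : x = .ext 0
        · subst x₃
          simp only [hs₂, hs₁, h₀, update_self, List.append_nil, List.replicate_append_replicate]
          congr 1
          omega
        · simp [hs₂, hs₁, x₁, x₂, x₃])
  refine (g₁.seq (g₂.seq g₃)).mono ?_
  have : (s₂ .ta).length = (s (.ext 1)).length := by simp [hs₂]
  rw [this]
  ring_nf
  omega

theorem stk_update_eq {s s' : Stk RegΓ} {k : Reg} {l : List (Option Bool)} (h₁ : s' k = l)
    (h₂ : ∀ x, x ≠ k → s' x = s x) : update s k l = s' :=
  (eq_update_iff.2 ⟨h₁, h₂⟩).symm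

/-! ### Reading the input -/

/-- The letter is a bit. -/
def isLetter : Option (Option Bool) → Bool
  | some (some _) => true
  | _ => false

/-- One more vertex on all counters and sets. -/
def units : List (Σ k, RegΓ k) :=
  [⟨.cop 0, none⟩, ⟨.cop 1, none⟩, ⟨.cop 2, none⟩, ⟨.cop 3, none⟩, ⟨.cop 4, none⟩, ⟨.cop 5, none⟩,
   ⟨.set 0, some false⟩, ⟨.set 1, some false⟩, ⟨.set 2, some false⟩, ⟨.set 3, some false⟩,
   ⟨.set 4, some false⟩, ⟨.set 5, some false⟩, ⟨.set 6, some false⟩]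

/-- Read a letter of the adjacency matrix. -/
def scanLetter (x : Option Bool) : Prog RegΓ :=
  .seq (.push .rev x) <| match x with
    -- Each row ends with a separator, so the unary counters and the empty sets obtain length `n`.
    -- Removing a letter of `ext 4` for each row compares `n` with the number of bits of the
    -- parameter.
    | none => .seq (.pop (.ext 4)) (pushes units)
    | some _ => .skip

/-- The effect of reading the adjacency matrix from the stack `ext 2`. -/
structure Scanned (s s' : Stk RegΓ) : Prop where
  ext2 : s' (.ext 2) = []
  rev : s' .rev = (s (.ext 2)).reverse ++ s .rev
  cop : ∀ i, s' (.cop i) = List.replicate ((s (.ext 2)).count none) none ++ s (.cop i)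
  set : ∀ i, s' (.set i) = List.replicate ((s (.ext 2)).count none) (some false) ++ s (.set i)
  ext4 : s' (.ext 4) = (s (.ext 4)).drop ((s (.ext 2)).count none)
  other : ∀ x, x ≠ .ext 2 → x ≠ .rev → (∀ i, x ≠ .cop i) → (∀ i, x ≠ .set i) → x ≠ .ext 4 →
    s' x = s x

theorem exists_scanned (s : Stk RegΓ) : ∃ s', Go (each (.ext 2) scanLetter) s s'
    ((s (.ext 2)).length * 20 + 1) ∧ Scanned s s' := by
  refine each_exec (Γ := RegΓ) (k := .ext 2) (T := 17) Scanned (fun s hs => ?_) (fun s x l hs => ?_) s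
  · exact ⟨hs, by simp [hs], by simp [hs], by simp [hs], by simp [hs], fun _ _ _ _ _ _ => rfl⟩
  set s₁ : Stk RegΓ := update (update s (.ext 2) l) .rev (x :: s .rev) with hs₁
  have hpush : Go (.push .rev x) (update s (.ext 2) l) s₁ 1 := by
    have h := go_push (update s (.ext 2) l) .rev x
    rwa [update_of_ne (by decide)] at h
  rcases x with _ | b
  · set s₂ : Stk RegΓ := update s₁ (.ext 4) (s₁ (.ext 4)).tail with hs₂
    have hpop : Go (.pop (.ext 4)) s₁ s₂ 1 := go_pop s₁ (.ext 4)
    refine ⟨_, (hpush.seq (hpop.seq (pushes_exec units s₂))).mono (by simp [units]), ?_, ?_⟩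
    · simp [units, hs₂, hs₁]
    · rintro s₃ ⟨e₁, e₂, e₃, e₄, e₅, e₆⟩
      refine ⟨e₁, ?_, fun i => ?_, fun i => ?_, ?_, fun y y₁ y₂ y₃ y₄ y₅ => ?_⟩
      · rw [e₂, hs]; simp [units, hs₂, hs₁]
      · rw [e₃, hs]
        fin_cases i <;> simp [units, hs₂, hs₁, List.replicate_succ']
      · rw [e₄, hs]
        fin_cases i <;> simp [units, hs₂, hs₁, List.replicate_succ']
      · rw [e₅, hs]
        simp [units, hs₂, hs₁, Nat.add_comm]
      · rw [e₆ y y₁ y₂ y₃ y₄ y₅]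
        simp [units, hs₂, hs₁, y₁, y₂, y₃, y₄, y₅]
  · refine ⟨s₁, (hpush.seq (go_skip s₁)).mono (by omega), by simp [hs₁], ?_⟩
    rintro s₃ ⟨e₁, e₂, e₃, e₄, e₅, e₆⟩
    refine ⟨e₁, ?_, fun i => ?_, fun i => ?_, ?_, fun y y₁ y₂ y₃ y₄ y₅ => ?_⟩
    · rw [e₂, hs]; simp [hs₁]
    · rw [e₃, hs]; simp [hs₁]
    · rw [e₄, hs]; simp [hs₁]
    · rw [e₅, hs]; simp [hs₁]
    · rw [e₆ y y₁ y₂ y₃ y₄ y₅]; simp [hs₁, y₁, y₂]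

/-- Read the input from the stack `ext 2`. -/
def parse : Prog RegΓ :=
  .seq (mvWhile isLetter (.ext 2) .ta) <| .seq (.pop (.ext 2)) <| .seq (dup .ta (.ext 1) (.ext 3)) <|
  .seq (mvAll (.ext 3) .ta) <| .seq (dup .ta (.ext 3) (.ext 4)) <|
  .seq (each (.ext 2) scanLetter) (mvAll .rev .mat)

/-- The stacks while the parameter is read. -/
def reading (t e₁ e₂ e₃ e₄ : List (Option Bool)) : Stk RegΓ
  | .ta => t
  | .ext i => ![[], e₁, e₂, e₃, e₄, []] i
  | _ => []

/-- The contents of the stacks that commands do not use. -/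
def rest (w l m f : List (Option Bool)) : Stk RegΓ
  | .ext i => if i = 0 then w else if i = 2 then [] else if i = 4 then m else if i = 5 then f else l
  | _ => []

theorem count_rows (n : ℕ) (A : ℕ → ℕ → Bool) : ((List.range n).flatMap (row n A)).count none = n := by
  have h : ∀ l : List ℕ, (l.flatMap (row n A)).count none = l.length := by
    intro l
    induction l with
    | nil => rfl
    | cons a l ih =>
      rw [List.flatMap_cons, List.count_append, ih, row, List.count_append]
      have : List.count none ((List.range n).map fun j => some (A a j)) = 0 := by
        rw [List.count_eq_zero]; simp
      rw [this]
      simp [Nat.add_comm]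
  simpa using h (List.range n)

/-- The bits of the parameter are needed three times: on `ext 1` for the outer loop of `zeros` and
for the instances, on `ext 3` for the inner loop, and on `ext 4` for the comparison with `n`. The
copies pass through `ta` because moving a stack reverses it. -/
theorem go_parse (n : ℕ) (A : ℕ → ℕ → Bool) (l : List Bool) :
    Go parse (update (fun _ => []) (.ext 2)
        (l.map some ++ none :: (List.range n).flatMap (row n A)))
      (asm n A ⟨fun _ _ => false, [], []⟩ (fun _ => 0)
        (rest [] (l.map some) ((l.map some).drop n) []))
      (30 * (l.length + 1 + n * (n + 1))) := by
  set L := l.map some with hL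
  set R := (List.range n).flatMap (row n A) with hR
  have hLl : L.length = l.length := by simp [hL]
  have hRl : R.length = n * (n + 1) := length_rows A
  have e₀ : (update (fun _ => []) (.ext 2) (L ++ none :: R) : Stk RegΓ) =
      reading [] [] (L ++ none :: R) [] [] := by
    refine stk_update_eq rfl fun x hx => ?_
    cases x with
    | ext i => fin_cases i <;> first | rfl | exact absurd rfl hx
    | _ => rfl
  rw [e₀]
  have frame : ∀ {a b : Stk RegΓ} {p q r : Reg}, (∀ x, (∀ i, x ≠ .ext i) → x ≠ .ta → a x = b x) →
      (∀ i : Fin 6, Reg.ext i ≠ p → Reg.ext i ≠ q → Reg.ext i ≠ r → a (.ext i) = b (.ext i)) →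
      (.ta = p ∨ .ta = q ∨ .ta = r ∨ a .ta = b .ta) → ∀ x, x ≠ p → x ≠ q → x ≠ r → a x = b x := by
    intro a b p q r h₁ h₂ h₃ x hp hq hr
    by_cases hx : x = .ta
    · subst hx
      rcases h₃ with h | h | h | h
      exacts [absurd h hp, absurd h hq, absurd h hr, h]
    · cases x with
      | ext i => exact h₂ i hp hq hr
      | _ => exact h₁ _ (by simp) hx
  have rr : ∀ {t e₁ e₂ e₃ e₄ t' e₁' e₂' e₃' e₄' : List (Option Bool)},
      ∀ x, (∀ i, x ≠ .ext i) → x ≠ .ta → reading t e₁ e₂ e₃ e₄ x = reading t' e₁' e₂' e₃' e₄' x := by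
    intro t e₁ e₂ e₃ e₄ t' e₁' e₂' e₃' e₄' x h₁ h₂
    cases x with
    | ext i => exact absurd rfl (h₁ i)
    | ta => exact absurd rfl h₂
    | _ => rfl
  have g₁ : Go (mvWhile isLetter (.ext 2) .ta) (reading [] [] (L ++ none :: R) [] [])
      (reading L.reverse [] (none :: R) [] []) (L.length * 4 + 1) :=
    go_mvWhile (by decide) (l := L) (r := none :: R) rfl (by
      intro a ha
      obtain ⟨b, _, rfl⟩ := List.mem_map.1 ha
      rfl) rfl rfl
      (by simp [reading]) fun x x₁ x₂ => frame (p := .ext 2) (q := .ta) (r := .ta) rr (by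
        intro i; fin_cases i <;> simp [reading]) (by simp) x x₁ x₂ x₂
  have g₂ : Go (.pop (.ext 2)) (reading L.reverse [] (none :: R) [] [])
      (reading L.reverse [] R [] []) 1 := by
    have h := go_pop (reading L.reverse [] (none :: R) [] []) (.ext 2)
    have e : update (reading L.reverse [] (none :: R) [] []) (.ext 2)
        (reading L.reverse [] (none :: R) [] [] (.ext 2)).tail = reading L.reverse [] R [] [] := by
      refine stk_update_eq rfl fun x hx => ?_
      exact frame (p := .ext 2) (q := .ext 2) (r := .ext 2) rr (by
        intro i; fin_cases i <;> simp [reading]) (by simp [reading]) x hx hx hx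
    rwa [e] at h
  have g₃ : Go (dup .ta (.ext 1) (.ext 3)) (reading L.reverse [] R [] []) (reading [] L R L [])
      (L.length * 5 + 1) := by
    have h := go_dup (s := reading L.reverse [] R [] []) (s' := reading [] L R L []) (k := .ta)
      (a := .ext 1) (b := .ext 3) (by decide) rfl (by simp [reading]) (by simp [reading])
      (frame rr (by intro i; fin_cases i <;> simp [reading]) (by simp))
    simpa [reading] using h
  have g₄ : Go (mvAll (.ext 3) .ta) (reading [] L R L []) (reading L.reverse L R [] [])
      (L.length * 4 + 1) :=
    go_mvAll (by decide) rfl (by simp [reading]) fun x x₁ x₂ =>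
      frame (p := .ext 3) (q := .ta) (r := .ta) rr
        (by intro i; fin_cases i <;> simp [reading]) (by simp) x x₁ x₂ x₂
  have g₅ : Go (dup .ta (.ext 3) (.ext 4)) (reading L.reverse L R [] []) (reading [] L R L L)
      (L.length * 5 + 1) := by
    have h := go_dup (s := reading L.reverse L R [] []) (s' := reading [] L R L L) (k := .ta)
      (a := .ext 3) (b := .ext 4) (by decide) rfl (by simp [reading]) (by simp [reading])
      (frame rr (by intro i; fin_cases i <;> simp [reading]) (by simp))
    simpa [reading] using h
  obtain ⟨s', g₆, h⟩ := exists_scanned (reading [] L R L L)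
  have hc : R.count none = n := count_rows n A
  have ext2 : reading [] L R L L (.ext 2) = R := rfl
  rw [ext2] at g₆
  have hrev : s' .rev = R.reverse := by rw [h.rev, ext2]; simp [reading]
  have g₇ : Go (mvAll .rev .mat) s' (asm n A ⟨fun _ _ => false, [], []⟩ (fun _ => 0)
      (rest [] L (L.drop n) [])) (R.length * 4 + 1) := by
    have hmat : s' .mat = [] := by
      rw [h.other .mat (by decide) (by decide) (by simp) (by simp) (by decide)]; rfl
    have g := go_mvAll (s := s') (s' := asm n A ⟨fun _ _ => false, [], []⟩ (fun _ => 0)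
      (rest [] L (L.drop n) [])) (k := .rev) (k' := .mat) (by decide) rfl
      (by rw [hrev, hmat]; simp [asm, hR]) (by
        intro x x₁ x₂
        cases x with
        | cop i => rw [h.cop, ext2, hc]; simp [asm, reading]
        | set i => rw [h.set, ext2, hc]; simp [asm, reading]
        | ext i =>
          fin_cases i
          · exact (h.other (.ext 0) (by decide) (by decide) (by simp) (by simp) (by decide)).symm
          · exact (h.other (.ext 1) (by decide) (by decide) (by simp) (by simp) (by decide)).symm
          · exact h.ext2.symm
          · exact (h.other (.ext 3) (by decide) (by decide) (by simp) (by simp) (by decide)).symm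
          · have := h.ext4
            rw [ext2, hc] at this
            exact this.symm
          · exact (h.other (.ext 5) (by decide) (by decide) (by simp) (by simp) (by decide)).symm
        | mat => exact absurd rfl x₂
        | rev => exact absurd rfl x₁
        | _ =>
          rw [h.other _ (by simp) (by simp) (by simp) (by simp) (by simp)]
          simp [asm, reading, rest])
    rwa [hrev, List.length_reverse] at g
  refine (g₁.seq (g₂.seq (g₃.seq (g₄.seq (g₅.seq (g₆.seq g₇)))))).mono ?_
  rw [hLl, hRl]
  omega

/-! ### Initialization and the steps of the main loop -/

/-- The computations before the main loop. -/
def startup : Prog RegΓ :=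
  .seq Cmd.setup.comp (.seq zeros (.push (.ext 5) (some true)))

/-- Copy the word and the parameter. -/
def load : Prog RegΓ :=
  .seq (mvAll (.ext 0) .ta) <| .seq (dup .ta (.ext 0) .tape) <| .seq (dup (.ext 1) .ta .out) <|
  .seq (mvAll .ta (.ext 1)) (.push .out none)

section

variable {n : ℕ} {A : ℕ → ℕ → Bool}

theorem fits_zero : Fits n ∅ fun _ => 0 := fun p => by simp

theorem rest_update_zero (w w' l m f : List (Option Bool)) (st : St) (ρ : Fin 6 → ℕ) :
    update (asm n A st ρ (rest w l m f)) (.ext 0) w' = asm n A st ρ (rest w' l m f) := by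
  refine stk_update_eq (by simp [asm, rest]) fun x hx => ?_
  cases x with
  | ext i =>
    have hi : i ≠ 0 := fun h => hx (by rw [h])
    simp only [asm, rest, if_neg hi]
  | _ => rfl

theorem rest_update_five (w l m f f' : List (Option Bool)) (st : St) (ρ : Fin 6 → ℕ) :
    update (asm n A st ρ (rest w l m f)) (.ext 5) f' = asm n A st ρ (rest w l m f') := by
  refine stk_update_eq (by simp [asm, rest]) fun x hx => ?_
  cases x with
  | ext i =>
    have hi : i ≠ 5 := fun h => hx (by rw [h])
    simp only [asm, rest, if_neg hi]
  | _ => rfl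

theorem go_startup : ∃ T, PolyB T ∧ ∀ (n : ℕ) (A : ℕ → ℕ → Bool) (st : St)
    (l : List (Option Bool)), Go startup (asm n A st (fun _ => 0) (rest [] l [] []))
      (asm n A (Cmd.setup.eval n A (fun _ => 0) st) (fun _ => 0)
        (rest (List.replicate (120 + l.length * (72 + 9 * l.length)) (some false)) l [] [some true]))
      (T n + (301 + l.length * (100 + 20 * l.length))) := by
  obtain ⟨T, hT, h⟩ := Cmd.setup.go_comp ∅ wf_setup
  refine ⟨T, hT, fun n A st l => ?_⟩
  have g₁ := h n A st (fun _ => 0) (rest [] l [] []) fits_zero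
  have g₂ := go_zeros (asm n A (Cmd.setup.eval n A (fun _ => 0) st) (fun _ => 0) (rest [] l [] []))
    rfl rfl rfl
  have e₁ : asm n A (Cmd.setup.eval n A (fun _ => 0) st) (fun _ => 0) (rest [] l [] []) (.ext 1) =
    l := rfl
  have e₃ : asm n A (Cmd.setup.eval n A (fun _ => 0) st) (fun _ => 0) (rest [] l [] []) (.ext 3) =
    l := rfl
  rw [rest_update_zero, e₁, e₃] at g₂
  have g₃ := go_push (asm n A (Cmd.setup.eval n A (fun _ => 0) st) (fun _ => 0)
    (rest (List.replicate (120 + l.length * (72 + 9 * l.length)) (some false)) l [] [])) (.ext 5)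
    (some true)
  rw [rest_update_five] at g₃
  exact (g₁.seq (g₂.seq g₃)).mono (by omega)

/-- The parameter goes to the bottom of `out` in reversed order, followed by a separator, so that
the matrix printed on top completes the reversed encoding of an instance. -/
theorem go_load (st : St) (ht : st.tape = []) (ho : st.out = []) (w : List Bool)
    (l m f : List (Option Bool)) :
    Go load (asm n A st (fun _ => 0) (rest (w.map some) l m f))
      (asm n A ⟨st.set, w, none :: l.reverse⟩ (fun _ => 0) (rest (w.map some) l m f))
      (9 * w.length + 9 * l.length + 5) := by
  set s := asm n A st (fun _ => 0) (rest (w.map some) l m f) with hs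
  set s₁ : Stk RegΓ := update (update s (.ext 0) []) .ta (w.map some).reverse with hs₁
  set s₂ : Stk RegΓ := update s .tape (w.map some) with hs₂
  set s₃ : Stk RegΓ := update (update (update s₂ (.ext 1) []) .ta l.reverse) .out l.reverse with hs₃
  set s₄ : Stk RegΓ := update s₂ .out l.reverse with hs₄
  have e0 : s (.ext 0) = w.map some := rfl
  have e1 : s (.ext 1) = l := rfl
  have ea : s .ta = [] := rfl
  have et : s .tape = [] := by simp [hs, asm, ht]
  have eo : s .out = [] := by simp [hs, asm, ho]
  have g₁ : Go (mvAll (.ext 0) .ta) s s₁ (w.length * 4 + 1) := by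
    have h := go_mvAll (s := s) (s' := s₁) (k := .ext 0) (k' := .ta) (by decide) (by simp [hs₁])
      (by simp [hs₁, e0, ea]) (by intro x h₁ h₂; simp [hs₁, h₁, h₂])
    rwa [e0, List.length_map] at h
  have g₂ : Go (dup .ta (.ext 0) .tape) s₁ s₂ (w.length * 5 + 1) := by
    have h := go_dup (s := s₁) (s' := s₂) (k := .ta) (a := .ext 0) (b := .tape) (by decide)
      (by simp [hs₂, ea]) (by simp [hs₁, hs₂, e0]) (by simp [hs₁, hs₂, et])
      (by intro x h₁ h₂ h₃; simp [hs₁, hs₂, h₁, h₂, h₃])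
    have e : (s₁ .ta).length = w.length := by simp [hs₁]
    rwa [e] at h
  have g₃ : Go (dup (.ext 1) .ta .out) s₂ s₃ (l.length * 5 + 1) := by
    have h := go_dup (s := s₂) (s' := s₃) (k := .ext 1) (a := .ta) (b := .out) (by decide)
      (by simp [hs₃]) (by simp [hs₂, hs₃, e1, ea]) (by simp [hs₂, hs₃, e1, eo])
      (by intro x h₁ h₂ h₃; simp [hs₃, h₁, h₂, h₃])
    have e : (s₂ (.ext 1)).length = l.length := by simp [hs₂, e1]
    rwa [e] at h
  have g₄ : Go (mvAll .ta (.ext 1)) s₃ s₄ (l.length * 4 + 1) := by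
    have h := go_mvAll (s := s₃) (s' := s₄) (k := .ta) (k' := .ext 1) (by decide)
      (by simp [hs₄, hs₂, ea]) (by simp [hs₄, hs₃, hs₂, e1])
      (by
        intro x h₁ h₂
        by_cases h₃ : x = .out
        · subst h₃; simp [hs₃, hs₄]
        · simp [hs₃, hs₄, h₁, h₂, h₃])
    have e : (s₃ .ta).length = l.length := by simp [hs₃]
    rwa [e] at h
  have g₅ := go_push s₄ .out none
  have e : update s₄ .out (none :: s₄ .out) =
      asm n A ⟨st.set, w, none :: l.reverse⟩ (fun _ => 0) (rest (w.map some) l m f) := by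
    refine stk_update_eq (by simp [asm, hs₄]) fun x hx => ?_
    by_cases h₁ : x = .tape
    · subst h₁; simp [hs₄, hs₂, asm]
    · simp only [hs₄, hs₂, hs, update_of_ne hx, update_of_ne h₁]
      cases x <;> first | rfl | exact absurd rfl hx | exact absurd rfl h₁
  rw [e] at g₅
  exact (g₁.seq (g₂.seq (g₃.seq (g₄.seq g₅)))).mono (by omega)

end

/-! ### Searching through a finite sequence -/

section

variable {K : Type} {Γ : K → Type} [DecidableEq K]

/-- A loop that visits states with the indices `0, 1, …, N - 1` until the property `Q` holds. -/
theorem Exec.search {B : Stk Γ → Prop} {k : K} {p : Option (Γ k) → Bool} {P : Prog Γ} {N T : ℕ}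
    (H : ℕ → Stk Γ → Prop) (Q : ℕ → Prop) (F : Bool → Stk Γ → Prop)
    (hH : ∀ i s, H i s → B s ∧ p (s k).head? = true)
    (hF : ∀ b s, F b s → B s ∧ p (s k).head? = false)
    (hstep : ∀ i < N, ∀ s, H i s → ∃ s', Exec B P s s' T ∧ ((Q i ∧ F true s') ∨
      (¬ Q i ∧ i + 1 = N ∧ F false s') ∨ (¬ Q i ∧ i + 1 < N ∧ H (i + 1) s')))
    {i : ℕ} (hi : i < N) {s : Stk Γ} (hs : H i s) : ∃ b s', (b = true ↔ ∃ j, i ≤ j ∧ j < N ∧ Q j) ∧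
      F b s' ∧ Exec B (.loop k p P) s s' ((N - i) * (T + 1) + 1) := by
  obtain ⟨d, hd⟩ : ∃ d, N - i = d + 1 := ⟨N - i - 1, by omega⟩
  rw [hd]
  induction d generalizing i s with
  | zero =>
    obtain ⟨s', h, h'⟩ := hstep i hi s hs
    obtain ⟨h₁, h₂⟩ := hH i s hs
    have finish : ∀ b, F b s' → Exec B (.loop k p P) s s' ((0 + 1) * (T + 1) + 1) := fun b hb =>
      (Exec.loop_step h₁ h₂ h (.loop_done (hF b s' hb).1 (hF b s' hb).2)).mono (by omega)
    rcases h' with ⟨hq, hf⟩ | ⟨hq, hn, hf⟩ | ⟨_, hn, _⟩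
    · exact ⟨true, s', by simpa using ⟨i, le_rfl, hi, hq⟩, hf, finish _ hf⟩
    · refine ⟨false, s', by
        simp only [Bool.false_eq_true, false_iff, not_exists, not_and]
        intro j h₁ h₂
        rwa [show j = i by omega], hf, finish _ hf⟩
    · omega
  | succ d ih =>
    obtain ⟨s', h, h'⟩ := hstep i hi s hs
    obtain ⟨h₁, h₂⟩ := hH i s hs
    rcases h' with ⟨hq, hf⟩ | ⟨_, hn, _⟩ | ⟨hq, hn, hs'⟩
    · refine ⟨true, s', by simpa using ⟨i, le_rfl, hi, hq⟩, hf,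
        (Exec.loop_step h₁ h₂ h (.loop_done (hF _ s' hf).1 (hF _ s' hf).2)).mono ?_⟩
      nlinarith
    · omega
    · obtain ⟨b, s'', hb, hf, g⟩ := ih hn hs' (by omega)
      refine ⟨b, s'', hb.trans ⟨fun ⟨j, h₁, h₂⟩ => ⟨j, by omega, h₂⟩, fun ⟨j, h₁, h₂, h₃⟩ =>
        ⟨j, ?_, h₂, h₃⟩⟩, hf, (Exec.loop_step h₁ h₂ h g).mono (by ring_nf; omega)⟩
      rcases Nat.lt_or_ge i j with h | h
      · exact h
      · exact absurd (by rwa [show i = j by omega]) hq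

/-- Empty several stacks. -/
def sweep (ks : List K) : Prog Γ :=
  ks.foldr (fun k P => .seq (.loop k Option.isSome (.pop k)) P) .skip

theorem size_update_nil [Fintype K] (s : Stk Γ) (k : K) :
    size (update s k []) + (s k).length = size s := by
  unfold size
  rw [← Finset.add_sum_erase _ _ (Finset.mem_univ k),
    ← Finset.add_sum_erase Finset.univ (fun k => (s k).length) (Finset.mem_univ k)]
  have : ∑ x ∈ Finset.univ.erase k, (update s k [] x).length =
      ∑ x ∈ Finset.univ.erase k, (s x).length :=
    Finset.sum_congr rfl fun x hx => by rw [update_of_ne (Finset.ne_of_mem_erase hx)]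
  rw [this, update_self]
  simp [Nat.add_comm]

theorem sweep_exec [Fintype K] (ks : List K) (s : Stk Γ) : ∃ s',
    Exec (fun _ => True) (sweep ks) s s' (size s * 2 + ks.length + 1) ∧ (∀ k ∈ ks, s' k = []) ∧
      ∀ k, k ∉ ks → s' k = s k := by
  induction ks generalizing s with
  | nil => exact ⟨s, Exec.mono (Exec.skip trivial) (by simp), by simp, fun _ _ => rfl⟩
  | cons k ks ih =>
    obtain ⟨s', g, h₁, h₂⟩ := ih (update s k [])
    refine ⟨s', ((clear_exec s k).seq g).mono ?_, fun j hj => ?_, fun j hj => ?_⟩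
    · have := size_update_nil s k
      rw [List.length_cons]
      omega
    · by_cases hj' : j ∈ ks
      · exact h₁ j hj'
      · rw [h₂ j hj', (List.mem_cons.1 hj).resolve_right hj', update_self]
    · rw [List.mem_cons, not_or] at hj
      rw [h₂ j hj.2, update_of_ne hj.1]

end

/-! ### The steps of the main loop -/

/-- Write the Vertex Cover instance for the current word. -/
def query : Prog RegΓ := .seq load Cmd.decode.comp

/-- The main loop starts its rounds with these stacks. -/
noncomputable def head {n : ℕ} (G : SimpleGraph (Fin n)) (k : ℕ) (X : Fin 7 → ℕ → Bool) (i : ℕ)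
    (f : List (Option Bool)) :
    Stk RegΓ :=
  asm n (adjB G) ⟨X, [], []⟩ (fun _ => 0)
    (rest ((word (tapeLen k) i).map some) (k.bits.map some) [] f)

section

variable {n : ℕ} {G : SimpleGraph (Fin n)} {k : ℕ}

/-- The sets after the computations before the main loop. -/
noncomputable def base (G : SimpleGraph (Fin n)) : Fin 7 → ℕ → Bool :=
  (Cmd.setup.eval n (adjB G) (fun _ => 0) ⟨fun _ _ => false, [], []⟩).set

/-- The Vertex Cover instance for the `i`-th word. -/
noncomputable def nthInst (G : SimpleGraph (Fin n)) (k i : ℕ) : SimpleGraph (Fin n) :=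
  inst G (side n (adjB G) (base G) (none :: (k.bits.map some).reverse) (word (tapeLen k) i))

/-- The sets that rounds of the main loop do not change are as before it. -/
def Fresh (G : SimpleGraph (Fin n)) (X : Fin 7 → ℕ → Bool) : Prop :=
  ∀ i, i ≠ 1 → i ≠ 5 → i ≠ 6 → X i = base G i

theorem svd_iff_nthInst : SplitVertexDeletion n G k ↔
    ∃ i, 0 ≤ i ∧ i < 2 ^ tapeLen k ∧ VertexCover n (nthInst G k i) k := by
  rw [svd_iff G k (fun _ => 0) ⟨fun _ _ => false, [], []⟩ (fun _ => rfl)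
    (none :: (k.bits.map some).reverse)]
  constructor
  · rintro ⟨w, hw, h⟩
    obtain ⟨i, hi, e⟩ := exists_word w
    rw [hw] at hi e
    refine ⟨i, Nat.zero_le i, hi, ?_⟩
    rw [nthInst, ← e]
    exact h
  · rintro ⟨i, _, _, h⟩
    exact ⟨_, length_word _ _, h⟩

theorem length_encode (H : SimpleGraph (Fin n)) :
    (encode H k).length = k.bits.length + 1 + n * (n + 1) := by
  rw [encode_adjB]
  simp only [List.length_append, List.length_map, List.length_cons, length_rows]
  omega

/-- The sets `1`, `5` and `6` are left changed by a round. This is harmless because the preparation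
resets them, so the instance depends only on the sets preserved by `Fresh`. -/
theorem go_query : ∃ T, PolyB T ∧ ∀ (n : ℕ) (G : SimpleGraph (Fin n)) (k : ℕ)
    (X : Fin 7 → ℕ → Bool) (i : ℕ) (f : List (Option Bool)), Fresh G X → ∃ X' tp, Fresh G X' ∧
      tp.length ≤ tapeLen k ∧ Go query (head G k X i f) (asm n (adjB G)
        ⟨X', tp, (encode (nthInst G k i) k).reverse⟩ (fun _ => 0)
        (rest ((word (tapeLen k) i).map some) (k.bits.map some) [] f))
        (T n + (9 * tapeLen k + 9 * k.bits.length + 5)) := by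
  obtain ⟨T, hT, h⟩ := Cmd.decode.go_comp ∅ wf_decode
  refine ⟨T, hT, fun n G k X i f hX => ?_⟩
  have g₁ := go_load (n := n) (A := adjB G) ⟨X, [], []⟩ rfl rfl (word (tapeLen k) i)
    (k.bits.map some) [] f
  rw [length_word, List.length_map] at g₁
  set st : St := ⟨X, word (tapeLen k) i, none :: (k.bits.map some).reverse⟩ with hst
  have g₂ := h n (adjB G) st (fun _ => 0)
    (rest ((word (tapeLen k) i).map some) (k.bits.map some) [] f) fits_zero
  rw [eval_decode] at g₂
  have e : (Cmd.prep.eval n (adjB G) (fun _ => 0) st).set 6 =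
      side n (adjB G) (base G) (none :: (k.bits.map some).reverse) (word (tapeLen k) i) := by
    rw [eval_prep_congr _ (base G) st hX]; rfl
  rw [e] at g₂
  refine ⟨(Cmd.prep.eval n (adjB G) (fun _ => 0) st).set, (Cmd.prep.eval n (adjB G) (fun _ => 0) st).tape,
    fun j h₁ h₅ h₆ => ?_, ?_, ?_⟩
  rotate_left 2
  · have e' : (encode (nthInst G k i) k).reverse = ((List.range n).flatMap (row n (instA (adjB G)
        (side n (adjB G) (base G) (none :: (k.bits.map some).reverse)
          (word (tapeLen k) i))))).reverse ++ st.out := by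
      rw [nthInst, encode_inst, List.reverse_append, List.reverse_cons, List.append_assoc]
      rfl
    rw [e']
    exact (g₁.seq g₂).mono (by omega)
  · rw [(avoids_prep h₁ h₅ h₆).eval]
    exact hX j h₁ h₅ h₆
  · have := eval_tape_length (n := n) (A := adjB G) Cmd.prep (fun _ => 0) st
    rwa [hst, length_word] at this

theorem go_advance {X : Fin 7 → ℕ → Bool} {i : ℕ} (hi : i < 2 ^ tapeLen k) :
    (i + 1 = 2 ^ tapeLen k ∧ Go increment (head G k X i [some true]) (head G k X 0 [])
      (tapeLen k * 8 + 10)) ∨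
    (i + 1 < 2 ^ tapeLen k ∧ Go increment (head G k X i [some true]) (head G k X (i + 1) [some true])
      (tapeLen k * 8 + 10)) := by
  rcases word_succ hi with ⟨h, e⟩ | ⟨h, j, r, e, e'⟩
  · left
    refine ⟨h, ?_⟩
    have g := go_increment_none (s := head G k X i [some true]) (j := tapeLen k)
      (by show (word (tapeLen k) i).map some = _; rw [e]; simp) rfl rfl
    rw [head, rest_update_five, rest_update_zero] at g
    rw [head, head, word_zero, List.map_replicate]
    exact g
  · right
    refine ⟨h, ?_⟩
    have hj : j ≤ tapeLen k := by
      have := congrArg List.length e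
      simp only [length_word, List.length_append, List.length_replicate, List.length_cons] at this
      omega
    refine (go_increment_some (j := j) (r := r.map some) ?_ rfl ?_ fun x hx => ?_).mono (by omega)
    · show (word (tapeLen k) i).map some = _
      rw [e]; simp
    · show (word (tapeLen k) (i + 1)).map some = _
      rw [e']; simp
    · rw [head, head, ← rest_update_zero ((word (tapeLen k) i).map some), update_of_ne hx]

/-- The words have fixed length and the sets are bit vectors of length `n`, so every round starts
with the same amount of memory. -/
theorem size_head (X X' : Fin 7 → ℕ → Bool) (i i' : ℕ) (f f' : List (Option Bool))
    (hf : f.length = f'.length) : size (head G k X i f) = size (head G k X' i' f') := by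
  refine Finset.sum_congr rfl fun x _ => ?_
  cases x with
  | ext j =>
    simp only [head, asm, rest]
    split_ifs <;> simp [length_word, hf]
  | set j => simp [head, asm]
  | _ => rfl

end

/-! ### The algorithm -/

theorem carry_exec {K : Type} {Γ : K → Type} [DecidableEq K] {k k' : K} (hk : k ≠ k')
    (e : Γ k → Γ k') (s : Stk Γ) : Exec (fun _ => True) (each k fun x => .push k' (e x)) s
      (update (update s k []) k' ((s k).reverse.map e ++ s k')) ((s k).length * 4 + 1) := by
  obtain ⟨s', h, hs⟩ := each_exec (k := k) (T := 1) (P := fun x => .push k' (e x))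
    (fun s s' => s' = update (update s k []) k' ((s k).reverse.map e ++ s k'))
    (fun s hs => by
      refine (update_eq_iff.2 ⟨by simp [hs], fun x hx => ?_⟩).symm
      rw [← hs, update_eq_self])
    (fun s x l hs => ⟨_, .push trivial, by simp [hk], by
      rintro s₂ rfl
      rw [hs]
      funext y
      by_cases y₁ : y = k'
      · subst y₁; simp [hk, Ne.symm hk]
      by_cases y₂ : y = k
      · subst y₂; simp [hk]
      simp [y₁, y₂]⟩) s
  rwa [hs] at h

section

set_option linter.unusedSectionVars false

variable {J : Type} {Δ : J → Type} [DecidableEq J]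

/-- Move the output to the stack `j` of the subroutine. -/
def transfer (j : J) (e : Option Bool → Δ j) : Prog (Sum.elim RegΓ Δ) :=
  each (Sum.inl .out) fun x => .push (Sum.inr j) (e x)

theorem transfer_exec (j : J) (e : Option Bool → Δ j) (r : Stk RegΓ) :
    Exec (fun _ => True) (transfer j e) (join r fun _ => [])
      (join (update r .out []) (update (fun _ => []) j ((r .out).reverse.map e)))
      ((r .out).length * 4 + 1) := by
  have h := carry_exec (Γ := Sum.elim RegΓ Δ) (k := Sum.inl .out) (k' := Sum.inr j) (by simp) e
    (join r fun _ => [])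
  rw [join_update_right, join_update_left]
  exact (congrArg (fun l => Exec (fun _ => True) (transfer j e) (join r fun _ => [])
    (update (update (join r fun _ => []) (Sum.inl .out) []) (Sum.inr j) l)
    ((r .out).length * 4 + 1)) (List.append_nil ((r .out).reverse.map e))).mp h

theorem size_update_single [Fintype J] (j : J) (l : List (Δ j)) :
    size (update (fun _ => []) j l : Stk Δ) = l.length := by
  rw [size, Finset.sum_eq_single j]
  · rw [update_self]
  · intro b _ hb
    rw [update_of_ne hb]; rfl
  · simp

variable [Fintype J] (Q : Prog (Sum.elim RegΓ Δ)) (j₀ j₁ : J) (e₀ : Option Bool ≃ Δ j₀) (e₁ : Δ j₁ ≃ Bool)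

/-- The subroutine answers `b` on the word `w` in time `T` and space `S`. -/
def Replies (w : List (Option Bool)) (b : Bool) (T S : ℕ) : Prop :=
  ∀ r : Stk RegΓ, ∃ F : Stk Δ, (F j₁).head? = some (e₁.symm b) ∧ size F ≤ S ∧
    Exec (fun x => size x ≤ size r + S) Q (join r (update (fun _ => []) j₀ (w.map e₀))) (join r F) T

/-- The stacks that are emptied after a negative answer. -/
noncomputable def waste : List (Reg ⊕ J) := Sum.inl .tape :: Finset.univ.toList.map Sum.inr

theorem mem_waste {x : Reg ⊕ J} : x ∈ waste ↔ x = Sum.inl .tape ∨ ∃ j, x = Sum.inr j := by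
  simp [waste, eq_comm]

theorem length_waste : (waste (J := J)).length = Fintype.card J + 1 := by
  simp [waste]

/-- Continue after a negative answer. -/
noncomputable def proceed : Prog (Sum.elim RegΓ Δ) :=
  .seq (sweep waste) <| .seq (increment.lift Δ) <| .case (Sum.inl (.ext 5)) fun
    | none => .push (Sum.inr j₁) (e₁.symm false)
    | some _ => .skip

/-- A round of the main loop. -/
noncomputable def attempt : Prog (Sum.elim RegΓ Δ) :=
  .seq (query.lift Δ) <| .seq (transfer j₀ e₀) <| .seq Q <| .case (Sum.inr j₁) fun x =>
    if x.map e₁ = some true then .pop (Sum.inl (.ext 5)) else proceed j₁ e₁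

/-- The algorithm for Split Vertex Deletion. -/
noncomputable def solver : Prog (Sum.elim RegΓ Δ) :=
  .seq (parse.lift Δ) <| .case (Sum.inl (.ext 4)) fun
    | none => .seq (startup.lift Δ) (.loop (Sum.inl (.ext 5)) Option.isSome (attempt Q j₀ j₁ e₀ e₁))
    | some _ => .push (Sum.inr j₁) (e₁.symm true)

variable {Q j₀ j₁ e₀ e₁}

/-- The main loop has ended with the answer `b`. -/
def Done (e₁ : Δ j₁ ≃ Bool) (S : ℕ) (b : Bool) (s : Stk (Sum.elim RegΓ Δ)) : Prop :=
  s (Sum.inl (.ext 5)) = [] ∧ (s (Sum.inr j₁)).head? = some (e₁.symm b) ∧ size s ≤ S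

variable {n k : ℕ} {G : SimpleGraph (Fin n)}

theorem sweep_join {X : Fin 7 → ℕ → Bool} {tp : List Bool} {i : ℕ} {f : List (Option Bool)}
    {F : Stk Δ} {s' : Stk (Sum.elim RegΓ Δ)} (h₁ : ∀ x ∈ waste, s' x = [])
    (h₂ : ∀ x, x ∉ waste → s' x = (join (asm n (adjB G) ⟨X, tp, []⟩ (fun _ => 0)
      (rest ((word (tapeLen k) i).map some) (k.bits.map some) [] f)) F : Stk (Sum.elim RegΓ Δ)) x) :
    s' = join (head G k X i f) fun _ => [] := by
  funext x
  rcases x with x | j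
  · by_cases hx : x = .tape
    · subst hx
      exact h₁ _ (mem_waste.2 (Or.inl rfl))
    · rw [h₂ _ (by rw [mem_waste]; simp [hx])]
      cases x <;> first | rfl | exact absurd rfl hx
  · exact h₁ _ (mem_waste.2 (Or.inr ⟨j, rfl⟩))

/-- The number of steps of a negative answer's continuation is linear in the size. -/
theorem proceed_exec {X : Fin 7 → ℕ → Bool} (tp : List Bool) {i : ℕ} (hi : i < 2 ^ tapeLen k)
    (F : Stk Δ) {s : Stk (Sum.elim RegΓ Δ)} (hs : s = join (asm n (adjB G) ⟨X, tp, []⟩ (fun _ => 0)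
      (rest ((word (tapeLen k) i).map some) (k.bits.map some) [] [some true])) F) :
    ∃ s', Exec (fun _ => True) (proceed j₁ e₁) s s'
      (size s * 2 + Fintype.card J + tapeLen k * 8 + 15) ∧
      ((i + 1 = 2 ^ tapeLen k ∧ s' (Sum.inl (.ext 5)) = [] ∧
        (s' (Sum.inr j₁)).head? = some (e₁.symm false)) ∨
      (i + 1 < 2 ^ tapeLen k ∧ s' = join (head G k X (i + 1) [some true]) fun _ => [])) := by
  obtain ⟨s', g₁, h₁, h₂⟩ := sweep_exec (waste (J := J)) s
  rw [hs] at h₂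
  rw [length_waste, sweep_join h₁ h₂] at g₁
  rcases go_advance (G := G) (X := X) hi with ⟨h, g₂⟩ | ⟨h, g₂⟩
  · refine ⟨update (join (head G k X 0 []) fun _ => []) (Sum.inr j₁) [e₁.symm false], ?_, Or.inl ⟨h, ?_, ?_⟩⟩
    · refine (g₁.seq ((g₂.lift (fun _ => []) fun _ _ => trivial).seq (.case trivial ?_))).mono
        (t := (size s * 2 + (Fintype.card J + 1) + 1) + ((tapeLen k * 8 + 10) + (1 + 1))) (by omega)
      exact Exec.push trivial
    · rw [update_of_ne (by simp)]; rfl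
    · rw [update_self]; rfl
  · refine ⟨_, (g₁.seq ((g₂.lift (fun _ => []) fun _ _ => trivial).seq (.case trivial ?_))).mono
        (t := (size s * 2 + (Fintype.card J + 1) + 1) + ((tapeLen k * 8 + 10) + (1 + 1))) (by omega),
        Or.inr ⟨h, rfl⟩⟩
    exact Exec.skip trivial

/-- The effect of a round of the main loop. -/
theorem attempt_exec {X : Fin 7 → ℕ → Bool} {i t T S M τ : ℕ} {b : Bool} (hi : i < 2 ^ tapeLen k)
    (hq : ∃ X' tp, Fresh G X' ∧ tp.length ≤ tapeLen k ∧ Go query (head G k X i [some true])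
      (asm n (adjB G) ⟨X', tp, (encode (nthInst G k i) k).reverse⟩ (fun _ => 0)
        (rest ((word (tapeLen k) i).map some) (k.bits.map some) [] [some true])) t)
    (hr : Replies Q j₀ j₁ e₀ e₁ (encode (nthInst G k i) k) b T S)
    -- Emptying the stacks takes two steps per letter, and its space is estimated by size plus time;
    -- hence the factor 3.
    (hM : 3 * (size (head G k X i [some true]) + t + S) + 4 * (encode (nthInst G k i) k).length +
      Fintype.card J + 8 * tapeLen k + 20 ≤ M)
    (hτ : t + 4 * (encode (nthInst G k i) k).length + 3 * T +
      2 * (size (head G k X i [some true]) + t) + Fintype.card J + 8 * tapeLen k + 20 ≤ τ) :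
    ∃ s', Exec (fun x => size x ≤ M) (attempt Q j₀ j₁ e₀ e₁)
      (join (head G k X i [some true]) fun _ => []) s' τ ∧ ((b = true ∧ Done e₁ M true s') ∨
      (¬ b = true ∧ i + 1 = 2 ^ tapeLen k ∧ Done e₁ M false s') ∨
      (¬ b = true ∧ i + 1 < 2 ^ tapeLen k ∧ ∃ X', Fresh G X' ∧
        s' = join (head G k X' (i + 1) [some true]) fun _ => [])) := by
  obtain ⟨X', tp, hX', -, g₁⟩ := hq
  set N := size (head G k X i [some true]) with hN
  set E := encode (nthInst G k i) k with hE
  set r := asm n (adjB G) ⟨X', tp, E.reverse⟩ (fun _ => 0)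
    (rest ((word (tapeLen k) i).map some) (k.bits.map some) [] [some true]) with hrr
  have hsize := g₁.size_le
  rw [← hN] at hsize
  have hout : r .out = E.reverse := rfl
  have e₁' : update r .out [] = asm n (adjB G) ⟨X', tp, []⟩ (fun _ => 0)
      (rest ((word (tapeLen k) i).map some) (k.bits.map some) [] [some true]) := by
    refine stk_update_eq rfl fun x hx => ?_
    cases x <;> first | rfl | exact absurd rfl hx
  have hsz : size (update r .out []) + E.length = size r := by
    have := size_update_nil r .out
    rwa [hout, List.length_reverse] at this
  have g₂ := transfer_exec j₀ e₀ r
  rw [hout, List.reverse_reverse, List.length_reverse] at g₂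
  obtain ⟨F, hF₁, hF₂, g₃⟩ := hr (update r .out [])
  have h₃ := g₃.size_le
  rw [size_join, size_join, size_update_single, List.length_map] at h₃
  have h₃' : size (join (update r .out []) F) = size (update r .out []) + size F := size_join _ _
  set s₂ : Stk (Sum.elim RegΓ Δ) := join (update r .out []) F with hs₂
  have q₁ : Exec (fun x => size x ≤ M) (query.lift Δ) (join (head G k X i [some true]) fun _ => [])
      (join r fun _ => []) t :=
    (g₁.lift (B' := fun _ => True) (fun _ => []) fun _ _ => trivial).bounded (by
      rw [size_join]
      have : size (fun _ => [] : Stk Δ) = 0 := by simp [size]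
      omega)
  have q₂ := g₂.bounded (S := M) (by
      rw [size_join]
      have : size (fun _ => [] : Stk Δ) = 0 := by simp [size]
      omega)
  have q₃ := g₃.imp (B' := fun x => size x ≤ M) fun x hx => by omega
  have hx : Option.map e₁ (F j₁).head? = some b := by rw [hF₁]; simp
  rcases Bool.eq_false_or_eq_true b with hb | hb
  · subst hb
    have hp := Exec.pop (B := fun _ => True) (k := Sum.inl (.ext 5)) (s := s₂) trivial
    have h₅ := hp.size_le
    refine ⟨_, (q₁.seq (q₂.seq (q₃.seq (.case (by omega) (t := 1) (s' := update s₂ (Sum.inl (.ext 5))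
      (s₂ (Sum.inl (.ext 5))).tail) ?_)))).mono (by omega), Or.inl ⟨rfl, ?_, ?_, by omega⟩⟩
    · split
      · exact Exec.pop (by omega)
      · exact absurd hx ‹_›
    · rw [update_self]; rfl
    · rw [update_of_ne (by simp)]
      exact hF₁
  · subst hb
    obtain ⟨s', g₄, h⟩ := proceed_exec (j₁ := j₁) (e₁ := e₁) (G := G) (X := X') tp hi F
      (s := s₂) (by rw [hs₂, e₁'])
    have h₄ := g₄.size_le
    refine ⟨s', (q₁.seq (q₂.seq (q₃.seq (.case (by omega)
      (t := size s₂ * 2 + Fintype.card J + tapeLen k * 8 + 15) ?_)))).mono (by omega), ?_⟩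
    · split
      · rename_i h'
        exact absurd (Option.some.inj (hx.symm.trans h')) (by simp)
      · exact g₄.bounded (by omega)
    · rcases h with ⟨h, h', h''⟩ | ⟨h, h'⟩
      · exact Or.inr (Or.inl ⟨by simp, h, h', h'', by omega⟩)
      · exact Or.inr (Or.inr ⟨by simp, h, X', hX', h'⟩)

end

theorem svd_of_le {n k : ℕ} (G : SimpleGraph (Fin n)) (h : n ≤ k) : SplitVertexDeletion n G k := by
  refine ⟨Finset.univ, by simpa using h, ∅, Set.univ, by simp, by simp, by simp, fun x => ?_⟩
  exact absurd (Finset.mem_coe.2 (Finset.mem_univ x.1)) x.2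

/-- A number with more than `n` bits is at least `2 ^ n`. -/
theorem lt_of_length_bits {n k : ℕ} (h : n < k.bits.length) : n ≤ k := by
  rw [Nat.size_eq_bits_len] at h
  exact (Nat.lt_two_pow_self.trans_le (Nat.lt_size.1 h)).le

/-- The running time and the space of the algorithm; the subroutine contributes `T` and `S`. -/
theorem exists_solver_bound : ∃ U, PolyB U ∧ ∀ {J : Type} {Δ : J → Type} [DecidableEq J] [Fintype J]
    (Q : Prog (Sum.elim RegΓ Δ)) (j₀ j₁ : J) (e₀ : Option Bool ≃ Δ j₀) (e₁ : Δ j₁ ≃ Bool)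
    (n : ℕ) (G : SimpleGraph (Fin n)) (k T S : ℕ),
    (∀ H : SimpleGraph (Fin n), ∃ b, (b = true ↔ VertexCover n H k) ∧
      Replies Q j₀ j₁ e₀ e₁ (encode H k) b T S) →
    ∃ b s', (b = true ↔ SplitVertexDeletion n G k) ∧
      Exec (fun x => size x ≤ 31 * (encode G k).length + 20 * U n + 3 * S + Fintype.card J + 20)
        (solver Q j₀ j₁ e₀ e₁) (join (update (fun _ => []) (.ext 2) (encode G k)) fun _ => []) s'
        (31 * (encode G k).length + 2 ^ tapeLen k * (20 * U n + 3 * T + Fintype.card J + 30)) ∧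
      size s' ≤ 31 * (encode G k).length + 20 * U n + 3 * S + Fintype.card J + 20 ∧
      (s' (Sum.inr j₁)).head? = some (e₁.symm b) := by
  obtain ⟨T₁, hT₁, h₁⟩ := go_startup
  obtain ⟨T₂, hT₂, h₂⟩ := go_query
  -- The quadratic term generously dominates what is quadratic in the number of bits of `k`, such as
  -- `tapeLen k`, once that number is at most `n`.
  refine ⟨fun n => T₁ n + T₂ n + 3000 * ((n + 1) * (n + 1)),
    (hT₁.add hT₂).add ((PolyB.const 3000).mul ((PolyB.id.add (.const 1)).mul
      (PolyB.id.add (.const 1)))), ?_⟩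
  intro J Δ _ _ Q j₀ j₁ e₀ e₁ n G k T S hQ
  have hlen (H : SimpleGraph (Fin n)) : (encode H k).length = k.bits.length + 1 + n * (n + 1) :=
    length_encode H
  have g₀ := go_parse n (adjB G) k.bits
  rw [← encode_adjB, ← hlen G] at g₀
  have hs₀ : size (update (fun _ => []) (.ext 2) (encode G k) : Stk RegΓ) = (encode G k).length :=
    size_update_single (Δ := RegΓ) _ _
  have hnil : size (fun _ => [] : Stk Δ) = 0 := by simp [size]
  have g₀' := g₀.lift (B' := fun _ => True) (fun _ => [] : Stk Δ) fun _ _ => trivial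
  have hsz₀ := g₀.size_le
  rw [hs₀] at hsz₀
  set I := (encode G k).length with hI
  have hlen' (H : SimpleGraph (Fin n)) : (encode H k).length = I := by rw [hlen, hI, hlen]
  set V := T₁ n + T₂ n + 3000 * ((n + 1) * (n + 1)) with hV
  set M := 31 * I + 20 * V + 3 * S + Fintype.card J + 20 with hM
  set τ := 20 * V + 3 * T + Fintype.card J + 30 with hτ
  set s₀ := asm n (adjB G) ⟨fun _ _ => false, [], []⟩ (fun _ => 0)
    (rest [] (k.bits.map some) ((k.bits.map some).drop n) []) with hs₀'
  have hj₀ : size (join s₀ fun _ => [] : Stk (Sum.elim RegΓ Δ)) ≤ 31 * I := by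
    rw [size_join]; omega
  have q₀ := g₀'.bounded (S := M) (by rw [size_join]; omega)
  have hpow : 1 ≤ 2 ^ tapeLen k := Nat.one_le_two_pow
  have hτ' : τ ≤ 2 ^ tapeLen k * τ := Nat.le_mul_of_pos_left _ hpow
  have hx : (join s₀ fun _ => [] : Stk (Sum.elim RegΓ Δ)) (Sum.inl (.ext 4)) =
    (k.bits.map some).drop n := rfl
  -- If `k` has more than `n` bits, all vertices may be deleted and the answer is yes at once.
  -- Otherwise quantities that are polynomial in the number of bits are polynomial in `n`.
  rcases Nat.lt_or_ge n k.bits.length with hn | hn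
  · refine ⟨true, update (join s₀ fun _ => []) (Sum.inr j₁) [e₁.symm true],
      by simpa using svd_of_le G (lt_of_length_bits hn), ?_, ?_, by rw [update_self]; rfl⟩
    · refine (q₀.seq (.case (by omega) (t := 1) ?_)).mono (t := 30 * I + (1 + 1)) (by omega)
      rw [hx]
      obtain ⟨a, l, hl⟩ : ∃ a l, (k.bits.map some).drop n = a :: l := by
        refine List.exists_cons_of_ne_nil fun h => ?_
        rw [List.drop_eq_nil_iff, List.length_map] at h
        omega
      rw [hl]
      exact Exec.push (by omega)
    · refine (size_update_le _ _ _ 1 (by simp)).trans (by omega)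
  have hd : (k.bits.map some).drop n = [] := List.drop_eq_nil_iff.2 (by simpa using hn)
  rw [hd] at hx hs₀'
  have hp : n * n + 2 * n + 1 = (n + 1) * (n + 1) := by ring
  have hI' := hlen G
  have hp' : n * (n + 1) = n * n + n := by ring
  have hl₁ : k.bits.length * (100 + 20 * k.bits.length) ≤ n * (100 + 20 * n) :=
    Nat.mul_le_mul hn (by omega)
  have hl₂ : k.bits.length * (72 + 9 * k.bits.length) ≤ n * (72 + 9 * n) :=
    Nat.mul_le_mul hn (by omega)
  have hB : tapeLen k = 120 + k.bits.length * (72 + 9 * k.bits.length) := rfl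
  have hq₁ : n * (100 + 20 * n) = 100 * n + 20 * (n * n) := by ring
  have hq₂ : n * (72 + 9 * n) = 72 * n + 9 * (n * n) := by ring
  have g₁ := h₁ n (adjB G) ⟨fun _ _ => false, [], []⟩ (k.bits.map some)
  have e : asm n (adjB G) (Cmd.setup.eval n (adjB G) (fun _ => 0) ⟨fun _ _ => false, [], []⟩)
      (fun _ => 0) (rest (List.replicate (120 + (k.bits.map some).length *
        (72 + 9 * (k.bits.map some).length)) (some false)) (k.bits.map some) [] [some true]) =
      head G k (base G) 0 [some true] := by
    have e₁ : (Cmd.setup.eval n (adjB G) (fun _ => 0) ⟨fun _ _ => false, [], []⟩).tape = [] :=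
      List.length_eq_zero_iff.1 (Nat.le_zero.1 (eval_tape_length _ _ _))
    have e₂ : (Cmd.setup.eval n (adjB G) (fun _ => 0) ⟨fun _ _ => false, [], []⟩).out = [] :=
      silent_setup.eval _ _
    have e₃ : Cmd.setup.eval n (adjB G) (fun _ => 0) ⟨fun _ _ => false, [], []⟩ =
        ⟨base G, [], []⟩ := by
      have h₃ (st : St) (h : st.set = base G) (h' : st.tape = []) (h'' : st.out = []) :
          st = ⟨base G, [], []⟩ := by
        rw [← h, ← h', ← h'']
      exact h₃ _ rfl e₁ e₂
    rw [e₃, head, word_zero, List.map_replicate, List.length_map, hB]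
  rw [e, ← hs₀', List.length_map] at g₁
  have hsz₁ := g₁.size_le
  have q₁ := (g₁.lift (B' := fun _ => True) (fun _ => [] : Stk Δ) fun _ _ => trivial).bounded
    (S := M) (by rw [size_join]; omega)
  have hhead (X : Fin 7 → ℕ → Bool) (i : ℕ) :
      size (head G k X i [some true]) = size (head G k (base G) 0 [some true]) :=
    size_head _ _ _ _ _ _ rfl
  obtain ⟨b, s', hb, ⟨-, hd₁, hd₂⟩, q₂⟩ := Exec.search (B := fun x => size x ≤ M)
    (k := Sum.inl (.ext 5)) (p := Option.isSome) (P := attempt Q j₀ j₁ e₀ e₁) (N := 2 ^ tapeLen k)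
    (T := 17 * V + 3 * T + Fintype.card J + 20)
    (fun i s => ∃ X, Fresh G X ∧ s = (join (head G k X i [some true]) fun _ => []))
    (fun i => VertexCover n (nthInst G k i) k) (fun b s => Done e₁ M b s)
    (by
      rintro i s ⟨X, hX, rfl⟩
      refine ⟨?_, rfl⟩
      rw [size_join, hhead]; omega)
    (by
      rintro b s ⟨hs₁, -, hs₂⟩
      exact ⟨hs₂, by rw [hs₁]; rfl⟩)
    (by
      rintro i hi s ⟨X, hX, rfl⟩
      obtain ⟨b, hb, hr⟩ := hQ (nthInst G k i)
      have := attempt_exec (M := M) (τ := 17 * V + 3 * T + Fintype.card J + 20) hi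
        (h₂ n G k X i [some true] hX) hr (by rw [hhead, hlen']; omega) (by rw [hhead, hlen']; omega)
      rwa [hb] at this)
    (i := 0) hpow ⟨base G, fun _ _ _ _ => rfl, rfl⟩
  rw [← svd_iff_nthInst] at hb
  refine ⟨b, s', hb, (q₀.seq (.case (by omega) (t := T₁ n + (301 + k.bits.length *
    (100 + 20 * k.bits.length)) + (2 ^ tapeLen k * (17 * V + 3 * T + Fintype.card J + 20 + 1) + 1))
    ?_)).mono ?_, hd₂, hd₁⟩
  · rw [hx]
    exact q₁.seq q₂
  · have : 2 ^ tapeLen k * (17 * V + 3 * T + Fintype.card J + 20 + 1) + 2 ^ tapeLen k * (V + 9) ≤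
        2 ^ tapeLen k * τ := by
      rw [← Nat.mul_add]
      exact Nat.mul_le_mul_left _ (by omega)
    have h' : V + 9 ≤ 2 ^ tapeLen k * (V + 9) := Nat.le_mul_of_pos_left _ hpow
    omega

theorem Machine.Answers.mono {M : Machine} {w : List (Option Bool)} {b : Bool} {T T' S S' : ℝ}
    (h : M.Answers w b T S) (hT : T ≤ T') (hS : S ≤ S') : M.Answers w b T' S' := by
  obtain ⟨⟨t, c, ht, h₁⟩, h₂⟩ := h
  exact ⟨⟨t, c, ht.trans hT, h₁⟩, fun t c hc => (h₂ t c hc).trans hS⟩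

/-- The subroutine that runs a machine. -/
def Machine.sim (M : Machine) : Prog (AllΓ M.tm.Γ M.tm.Λ M.tm.σ) :=
  .seq (.push (Sum.inr none) (some M.tm.main, M.tm.initialState)) (simLoop M.tm.m)

/-- The simulation does not touch the working stacks `r`, so their size simply adds to the space of
the machine. -/
theorem Machine.replies (M : Machine) {D : ℕ} (hD : ∀ l, simTime (M.tm.m l) + 2 ≤ D)
    {w : List (Option Bool)} {b : Bool} {T S : ℝ} (h : M.Answers w b T S) :
    letI := M.tm.kDecidableEq
    letI := M.tm.kFin
    Replies (Δ := SimΓ M.tm.Γ M.tm.Λ M.tm.σ) M.sim (some M.tm.k₀) (some M.tm.k₁)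
      M.inputAlphabet.symm M.outputAlphabet w b (⌊T⌋₊ * (D + 1) + 2) (⌊S⌋₊ + D + 1) := by
  let _ := M.tm.kDecidableEq
  let _ := M.tm.kFin
  intro r
  obtain ⟨c, hc, hs, hw, -, g⟩ := M.simLoop_exec hD h r
  refine ⟨simStk c, hc, ?_, ?_⟩
  · rw [size_simStk]
    have : ∑ k, (c.stk k).length = M.size c := rfl
    omega
  · set s₀ : Stk (SimΓ M.tm.Γ M.tm.Λ M.tm.σ) :=
      update (fun _ => []) (some M.tm.k₀) (w.map M.inputAlphabet.symm) with hs₀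
    have e : simStk (M.start w) = update s₀ none [(some M.tm.main, M.tm.initialState)] := by
      rw [simStk_eq]
      refine congrArg (fun s => update s none _) ?_
      refine (openStk_update _ _ _).trans (congrArg (fun s => update s _ _) ?_)
      funext x
      cases x <;> rfl
    rw [e, join_update_right] at g
    have p : Exec (fun x => SplitVD.size x ≤ SplitVD.size r + (⌊S⌋₊ + D + 1))
        (.push (Sum.inr none) (some M.tm.main, M.tm.initialState)) (join r s₀)
        (update (join r s₀) (Sum.inr none) ((some M.tm.main, M.tm.initialState) :: s₀ none)) 1 := by
      refine Exec.push ?_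
      rw [size_join, hs₀, size_update_single, List.length_map]
      omega
    have hn : s₀ none = [] := update_of_ne (by simp) _ _
    rw [hn] at p
    exact (p.seq (g.imp fun x hx => by omega)).mono (by omega)

/-- Split Vertex Deletion by repeated calls of a machine for Vertex Cover. -/
theorem exists_machine : ∃ U, PolyB U ∧ (∀ n, 1 ≤ U n) ∧ ∀ M : Machine, ∃ (M' : Machine) (C : ℕ),
    ∀ (n : ℕ) (G : SimpleGraph (Fin n)) (k : ℕ) (f g : ℝ),
      (∀ H : SimpleGraph (Fin n), ∃ b, (b = true ↔ VertexCover n H k) ∧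
        M.Answers (encode H k) b f g) →
      1 ≤ ⌊f⌋₊ ∧ 1 ≤ ⌊g⌋₊ ∧ ∃ b, (b = true ↔ SplitVertexDeletion n G k) ∧
        M'.Answers (encode G k) b ((C * (2 ^ tapeLen k * (U n + ⌊f⌋₊)) : ℕ) : ℝ)
          ((C * (U n + ⌊g⌋₊) : ℕ) : ℝ) := by
  obtain ⟨U, hU, h⟩ := exists_solver_bound
  refine ⟨fun n => U n + (n + 1) * (n + 1), hU.add ((PolyB.id.add (.const 1)).mul
    (PolyB.id.add (.const 1))), fun n => by nlinarith, fun M => ?_⟩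
  let _ := M.tm.kDecidableEq
  let _ := M.tm.kFin
  obtain ⟨D, hD⟩ := M.exists_simTime
  have hfin : ∀ k, Finite (AllΓ M.tm.Γ M.tm.Λ M.tm.σ k) := by
    have := M.tm.ΛFin
    have := M.tm.σFin
    rintro (k | _ | k)
    · exact inferInstanceAs (Finite (Option Bool))
    · exact inferInstanceAs (Finite (Option M.tm.Λ × M.tm.σ))
    · exact M.finite_alphabet k
  set P : Prog (AllΓ M.tm.Γ M.tm.Λ M.tm.σ) := solver (Δ := SimΓ M.tm.Γ M.tm.Λ M.tm.σ) M.sim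
    (some M.tm.k₀) (some M.tm.k₁) M.inputAlphabet.symm M.outputAlphabet with hP
  -- The output stack is that of the simulated machine, so a positive answer of a call is already in
  -- place as the final answer.
  refine ⟨P.machine (Sum.inl (Reg.ext 2)) (Sum.inr (some M.tm.k₁)) (Equiv.refl _) M.outputAlphabet,
    200 + Fintype.card (Option M.tm.K) + 3 * (D + 1), fun n G k f g hM => ?_⟩
  have hlen : (encode G k).length = k.bits.length + 1 + n * (n + 1) := length_encode G
  obtain ⟨b₀, -, hb₀⟩ := hM G
  -- The machine also answers on `G` itself, whose encoding it must hold. So `g` is at least the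
  -- input length, including the bits of `k`, and `f` is at least 1.
  obtain ⟨_, -, -, hg, hf, -⟩ := M.simLoop_exec hD hb₀ fun _ => []
  refine ⟨hf, by omega, ?_⟩
  obtain ⟨b, s', hb, hx, hs', hout⟩ := h (Δ := SimΓ M.tm.Γ M.tm.Λ M.tm.σ) M.sim (some M.tm.k₀)
    (some M.tm.k₁) M.inputAlphabet.symm M.outputAlphabet n G k (⌊f⌋₊ * (D + 1) + 2) (⌊g⌋₊ + D + 1)
    fun H => by
      obtain ⟨b, hb, ha⟩ := hM H
      exact ⟨b, hb, M.replies hD ha⟩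
  have e : join (update (fun _ => []) (Reg.ext 2) (encode G k)) (fun _ => []) =
      (update (fun _ => [] : Stk (AllΓ M.tm.Γ M.tm.Λ M.tm.σ)) (Sum.inl (Reg.ext 2))
        ((encode G k).map (Equiv.refl (Option Bool)).symm)) := by
    have : (join (fun _ => []) fun _ => [] : Stk (AllΓ M.tm.Γ M.tm.Λ M.tm.σ)) = fun _ => [] := by
      funext x
      cases x <;> rfl
    rw [join_update_left, this]
    exact congrArg (update (fun _ => [] : Stk (AllΓ M.tm.Γ M.tm.Λ M.tm.σ)) (Sum.inl (Reg.ext 2)))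
      (List.map_id _).symm
  rw [e] at hx
  refine ⟨b, hb, (P.machine_answers (Sum.inl (Reg.ext 2)) (Sum.inr (some M.tm.k₁))
    (Equiv.refl _) M.outputAlphabet _ b _ _ s' hx hs' hout).mono ?_ ?_⟩
  · beta_reduce
    rw [Nat.cast_le]
    set E := 2 ^ tapeLen k with hE
    -- The bits of `k` in the input need not be bounded in terms of `n`; for the time they are
    -- absorbed by the number of tapes.
    have hℓ : k.bits.length ≤ E := by
      refine le_trans ?_ Nat.lt_two_pow_self.le
      unfold tapeLen
      nlinarith
    have hE1 : 1 ≤ E := Nat.one_le_two_pow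
    set V := U n + (n + 1) * (n + 1) with hV
    have hI : (encode G k).length ≤ E * (2 * V) := by
      have h₁ : n * (n + 1) + 1 ≤ V := by nlinarith
      have h₂ : V ≤ E * V := Nat.le_mul_of_pos_left _ hE1
      have h₃ : E ≤ E * V := Nat.le_mul_of_pos_right _ (by omega)
      have h₄ : E * (2 * V) = 2 * (E * V) := by ring
      omega
    have h₀ : E * (20 * U n + 3 * (⌊f⌋₊ * (D + 1) + 2) + Fintype.card (Option M.tm.K) + 31) +
        31 * (E * (2 * V)) ≤
        E * ((200 + Fintype.card (Option M.tm.K) + 3 * (D + 1)) * (V + ⌊f⌋₊)) := by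
      have : 31 * (E * (2 * V)) = E * (62 * V) := by ring
      rw [this, ← Nat.mul_add]
      refine Nat.mul_le_mul_left _ ?_
      have hV1 : 1 ≤ V := by nlinarith
      nlinarith [Nat.zero_le (Fintype.card (Option M.tm.K) * (V - 1)), Nat.zero_le (D * V),
        Nat.le_mul_of_pos_right (Fintype.card (Option M.tm.K)) hV1]
    have h₁ : E * (20 * U n + 3 * (⌊f⌋₊ * (D + 1) + 2) + Fintype.card (Option M.tm.K) + 31) =
      E * (20 * U n + 3 * (⌊f⌋₊ * (D + 1) + 2) + Fintype.card (Option M.tm.K) + 30) + E := by ring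
    have h₂ : E * ((200 + Fintype.card (Option M.tm.K) + 3 * (D + 1)) * (V + ⌊f⌋₊)) =
      (200 + Fintype.card (Option M.tm.K) + 3 * (D + 1)) * (E * (V + ⌊f⌋₊)) := by ring
    omega
  · beta_reduce
    rw [Nat.cast_le]
    set V := U n + (n + 1) * (n + 1) with hV
    have hV1 : 1 ≤ V := by nlinarith
    nlinarith [Nat.zero_le (D * V), Nat.le_mul_of_pos_right (Fintype.card (Option M.tm.K)) hV1,
      Nat.le_mul_of_pos_right D hV1, Nat.zero_le (Fintype.card (Option M.tm.K) * ⌊g⌋₊)]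

/-! ### The bounds -/

theorem one_le_quasi (c k : ℕ) : 1 ≤ (k : ℝ) ^ ((c : ℝ) * Real.log k) := by
  -- For `k = 0` the logarithm is `0` by convention, and `0 ^ 0 = 1`.
  rcases Nat.eq_zero_or_pos k with rfl | hk
  · simp
  · have : (1 : ℝ) ≤ k := by exact_mod_cast hk
    exact Real.one_le_rpow this (mul_nonneg (Nat.cast_nonneg c) (Real.log_nonneg this))

/-- For `k ≥ 2` the number of bits is `O(log k)`, so `tapeLen k` is `O(log² k)`, and `exp (c * log²
k)` is `k ^ (c * log k)`. The square is what the final estimate of the running time needs. -/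
theorem two_pow_tapeLen_le {c : ℕ} (hc : 4000 ≤ c) (k : ℕ) :
    ((2 : ℝ) ^ tapeLen k) ^ 2 ≤ 2 ^ 402 * (k : ℝ) ^ ((c : ℝ) * Real.log k) := by
  have hq := one_le_quasi c k
  rcases Nat.lt_or_ge k 2 with hk | hk
  · have hℓ : k.bits.length ≤ 1 := by
      interval_cases k <;> simp
    -- With at most one bit the tape has length at most `120 + 72 + 9 = 201`; squaring gives the
    -- exponent `402`.
    have ht : tapeLen k ≤ 201 := by
      unfold tapeLen
      interval_cases k.bits.length <;> norm_num
    calc ((2 : ℝ) ^ tapeLen k) ^ 2 = 2 ^ (tapeLen k * 2) := by rw [pow_mul]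
      _ ≤ 2 ^ 402 := pow_le_pow_right₀ (by norm_num) (by omega)
      _ ≤ _ := le_mul_of_one_le_right (by positivity) hq
  · set x := Real.log k with hx
    set m := k.bits.length with hm
    have hk0 : (0 : ℝ) < k := by exact_mod_cast (by omega : 0 < k)
    have hl2 := Real.log_two_gt_d9
    have hl2' := Real.log_two_lt_d9
    have hx2 : Real.log 2 ≤ x := Real.log_le_log (by norm_num) (by exact_mod_cast hk)
    have hm1 : 2 ^ (m - 1) ≤ k := by
      rw [hm, Nat.size_eq_bits_len]
      refine Nat.lt_size.1 ?_
      have : 0 < k.size := Nat.size_pos.2 (by omega)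
      omega
    have hm0 : 1 ≤ m := by
      rw [hm, Nat.size_eq_bits_len]
      exact Nat.size_pos.2 (by omega)
    have hmx : ((m : ℝ) - 1) * Real.log 2 ≤ x := by
      have h : (2 : ℝ) ^ (m - 1) ≤ k := by exact_mod_cast hm1
      have := Real.log_le_log (by positivity) h
      rwa [Real.log_pow, Nat.cast_sub hm0, Nat.cast_one] at this
    -- Both `m - 1` and `1` are at most `x / log 2`, and `2 / log 2 < 3`.
    have hm3 : (m : ℝ) ≤ 3 * x := by nlinarith
    have hm1' : (1 : ℝ) ≤ m := by exact_mod_cast hm0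
    -- As `m ≥ 1`, the length is at most `201 m² ≤ 201 * 9 * x²`. Below, `2 * 1809 * log 2 < 4000`
    -- is used.
    have ht : (tapeLen k : ℝ) ≤ 1809 * x ^ 2 := by
      have : (tapeLen k : ℝ) = 120 + m * (72 + 9 * m) := by
        rw [tapeLen, ← hm]; push_cast; ring
      rw [this]
      nlinarith
    have e : ((2 : ℝ) ^ tapeLen k) ^ 2 = Real.exp (tapeLen k * 2 * Real.log 2) := by
      rw [← pow_mul, mul_comm _ (Real.log 2), Real.exp_mul, Real.exp_log (by norm_num)]
      exact_mod_cast (Real.rpow_natCast 2 (tapeLen k * 2)).symm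
    have hc' : (4000 : ℝ) ≤ c := by exact_mod_cast hc
    have h : ((2 : ℝ) ^ tapeLen k) ^ 2 ≤ (k : ℝ) ^ ((c : ℝ) * x) := by
      rw [e, Real.rpow_def_of_pos hk0, Real.exp_le_exp, ← hx]
      nlinarith [sq_nonneg x, Nat.cast_nonneg (α := ℝ) (tapeLen k)]
    refine h.trans (le_mul_of_one_le_left (by positivity) (one_le_pow₀ (by norm_num)))

/-- For `n ≥ 1` one has `n + 1 ≤ 2n`; the summand `1` covers `n = 0` and is later absorbed by `f` or
`g`, which are at least 1. -/
theorem succ_pow_le (n a c : ℕ) (h : a ≤ c) : ((n : ℝ) + 1) ^ a ≤ 2 ^ a * ((n : ℝ) ^ c + 1) := by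
  rcases Nat.eq_zero_or_pos n with rfl | hn
  · rw [Nat.cast_zero, zero_add, one_pow]
    nlinarith [one_le_pow₀ (n := a) (one_le_two (α := ℝ)), pow_nonneg (le_refl (0 : ℝ)) c]
  · have h₁ : (1 : ℝ) ≤ n := by exact_mod_cast hn
    calc ((n : ℝ) + 1) ^ a ≤ (2 * n) ^ a := pow_le_pow_left₀ (by positivity) (by linarith) a
      _ = 2 ^ a * (n : ℝ) ^ a := mul_pow _ _ _
      _ ≤ 2 ^ a * ((n : ℝ) ^ c + 1) := by
        have := pow_le_pow_right₀ h₁ h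
        gcongr
        linarith

end SplitVD

/-- The exponent constant `c` is absolute; the leading constant `C` may depend on the Vertex Cover
algorithm. For `k = 0` and `k = 1` the factor `k ^ (c * log k)` is `1`. -/
theorem theorem1p1 :
    ∃ c : ℕ, ∀ f g : ℕ → ℕ → ℝ, SplitVD.SolvableIn SplitVD.VertexCover f g →
      ∃ C : ℝ, SplitVD.SolvableIn SplitVD.SplitVertexDeletion
        (fun k n => C * (f k n * (k : ℝ) ^ ((c : ℝ) * Real.log (k : ℝ)) + (n : ℝ) ^ c))
        (fun k n => C * (g k n + (n : ℝ) ^ c)) := by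
  obtain ⟨U, ⟨a, ha⟩, hU1, h⟩ := SplitVD.exists_machine
  -- `4000` pays for the square of the number of tapes, and `2 * a` for the square of the polynomial
  -- `U` of degree `a`.
  refine ⟨4000 + 2 * a, fun f g ⟨M, hM⟩ => ?_⟩
  obtain ⟨M', C, hC⟩ := h M
  set c := 4000 + 2 * a with hc
  have hquasi := SplitVD.two_pow_tapeLen_le (c := c) (by omega)
  set A : ℝ := 2 ^ 402 + a ^ 2 * 2 ^ (a * 2) with hA
  refine ⟨C * (2 * A + 1), M', fun n G k => ?_⟩
  obtain ⟨hf, hg, b, hb, hans⟩ := hC n G k (f k n) (g k n) fun H => hM n H k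
  have hnc : (0 : ℝ) ≤ (n : ℝ) ^ c := by positivity
  have hUn : (U n : ℝ) ≤ a * (n + 1) ^ a := by exact_mod_cast ha n
  have hU2 : (U n : ℝ) ^ 2 ≤ a ^ 2 * 2 ^ (a * 2) * ((n : ℝ) ^ c + 1) := by
    calc (U n : ℝ) ^ 2 ≤ (a * (n + 1) ^ a) ^ 2 := pow_le_pow_left₀ (Nat.cast_nonneg _) hUn 2
      _ = a ^ 2 * ((n : ℝ) + 1) ^ (a * 2) := by rw [mul_pow, pow_mul]
      _ ≤ a ^ 2 * (2 ^ (a * 2) * ((n : ℝ) ^ c + 1)) := by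
        gcongr
        exact SplitVD.succ_pow_le n (a * 2) c (by omega)
      _ = _ := by ring
  have hR0 : (0 : ℝ) ≤ a ^ 2 * 2 ^ (a * 2) := by positivity
  have hP0 : (0 : ℝ) ≤ 2 ^ 402 := by positivity
  generalize (2 : ℝ) ^ 402 = P at *
  generalize (a : ℝ) ^ 2 * 2 ^ (a * 2) = R at *
  refine ⟨b, hb, hans.mono ?_ ?_⟩
  · set q : ℝ := (k : ℝ) ^ ((c : ℝ) * Real.log k) with hq
    set E : ℝ := 2 ^ SplitVD.tapeLen k with hE
    have hE1 : 1 ≤ E := one_le_pow₀ (by norm_num)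
    have hf1 : 1 ≤ f k n := (Nat.one_le_floor_iff _).1 hf
    have hff : (⌊f k n⌋₊ : ℝ) ≤ f k n := Nat.floor_le (by linarith)
    have hfq : 1 ≤ f k n * q := one_le_mul_of_one_le_of_one_le hf1 (SplitVD.one_le_quasi c k)
    have hEq : E ^ 2 ≤ P * q := hquasi k
    -- The product of a quantity in `k` and one in `n` is turned into a sum, as the claimed bound
    -- requires; this uses `f ≥ 1`.
    have h₁ : E * U n ≤ E ^ 2 * f k n + U n ^ 2 := by
      nlinarith [sq_nonneg (E - U n), sq_nonneg E, sq_nonneg (U n : ℝ)]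
    have h₂ : E * ⌊f k n⌋₊ ≤ E ^ 2 * f k n := mul_le_mul (by nlinarith) hff (by positivity) (by positivity)
    have h₃ : E ^ 2 * f k n ≤ P * (f k n * q) := by
      calc E ^ 2 * f k n ≤ P * q * f k n := by gcongr
        _ = _ := by ring
    have key : E * (U n + ⌊f k n⌋₊) ≤ (2 * A + 1) * (f k n * q + (n : ℝ) ^ c) := by
      rw [hA]
      nlinarith [mul_nonneg hP0 hnc, mul_nonneg hR0 hnc, mul_nonneg hR0 (sub_nonneg.2 hfq)]
    push_cast
    rw [mul_assoc]
    exact mul_le_mul_of_nonneg_left key (Nat.cast_nonneg C)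
  · have hg1 : 1 ≤ g k n := (Nat.one_le_floor_iff _).1 hg
    have hgg : (⌊g k n⌋₊ : ℝ) ≤ g k n := Nat.floor_le (by linarith)
    have hU : (1 : ℝ) ≤ U n := by exact_mod_cast hU1 n
    have key : (U n : ℝ) + ⌊g k n⌋₊ ≤ (2 * A + 1) * (g k n + (n : ℝ) ^ c) := by
      rw [hA]
      nlinarith [mul_nonneg hP0 hnc, mul_nonneg hR0 hnc, mul_nonneg hR0 (sub_nonneg.2 hg1),
        mul_nonneg hP0 (sub_nonneg.2 hg1)]
    push_cast
    rw [mul_assoc]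
    exact mul_le_mul_of_nonneg_left key (Nat.cast_nonneg C)
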